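/- Theorem (Complex scaling in dimension one). Let $0<\theta<\pi$, $L>0$, and let $V\in L^\infty(\mathbb R;\mathbb C)$ with $\operatorname{supp}V\subset(-L,L)$. Let $\Gamma\subset\mathbb C$ be a $C^1$ simple curve with a regular injective parametrization $\gamma:\mathbb R\to\Gamma$ such that $[-L,L]\subset\Gamma$ and, for some $z_\pm\in\mathbb C$ and some compact $K\subset\mathbb C$, $$\Gamma\setminus K=\Big(\big(z_++e^{i\theta}(0,\infty)\big)\cup\big(z_--e^{i\theta}(0,\infty)\big)\Big)\setminus K .$$ Assume that $\operatorname{Im}\gamma(t)\to\pm\infty$ as $t\to\pm\infty$ and that along $\gamma$ the point $-L$ comes before the point $L$ (so that $\Gamma=\Gamma_-\cup[-L,L]\cup\Gamma_+$ with $\Gamma_\pm$ attached to $\pm L$ and $\operatorname{Im}z\to\pm\infty$ on $\Gamma_\pm$). Let $L^2(\Gamma)$ be taken with respect to arc length, let $\partial_{z,\Gamma}u=\gamma'(t)^{-1}\partial_t(u\circ\gamma)$ (in the weak sense), let $H^2(\Gamma)$ be the space of $u\in L^2(\Gamma)$ with $\partial_{z,\Gamma}u,\partial_{z,\Gamma}^2u\in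 L^2(\Gamma)$, and let $P_{V,\Gamma}=-\partial_{z,\Gamma}^2+V$, where $V$ is extended by $0$ to $\Gamma\setminus\mathbb R$. Put $$\Lambda_\Gamma=\{\lambda\in\mathbb C\setminus(-\infty,0]:-\theta<\arg\lambda<\pi-\theta\},\qquad \arg\lambda\in(-\pi,\pi).$$ Let $P_V=-\partial_x^2+V$ on $\mathbb R$. The resolvent $(P_V-\lambda^2)^{-1}$, $\operatorname{Im}\lambda\gg1$, has a meromorphic continuation $R_V(\lambda):L^2_{\rm comp}(\mathbb R)\to L^2_{\rm loc}(\mathbb R)$ to $\lambda\in\mathbb C$ with polar parts of finite rank; its poles are the resonances of $P_V$. If $R_V(\lambda)=\sum_{j=1}^J A_j(\lambda-\lambda_0)^{-j}+A_0(\lambda)$ near $\lambda_0$ with $A_0$ holomorphic near $\lambda_0$, the multiplicity is $$m(\lambda_0)=\dim\operatorname{span}\{A_1(L^2_{\rm comp}),\dots,A_J(L^2_{\rm comp})\}$$ (so $m(\lambda_0)=0$ if $\lambda_0$ is not a resonance). Then: 1. For every $\lambda\in\Lambda_\Gamma$ the operator $P_{V,\Gamma}-\lambda^2:H^2(\Gamma)\to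 L^2(\Gamma)$ is Fredholm. 2. The spectrum of $P_{V,\Gamma}$ in $\Lambda_\Gamma$ is discrete: the set of $\lambda\in\Lambda_\Gamma$ for which $P_{V,\Gamma}-\lambda^2:H^2(\Gamma)\to L^2(\Gamma)$ is not invertible has no accumulation point in $\Lambda_\Gamma$, and for each such $\lambda$ the number $\lambda^2$ is an eigenvalue of $P_{V,\Gamma}$. 3. For $\lambda\in\Lambda_\Gamma$, $\lambda^2$ is an eigenvalue of $P_{V,\Gamma}$ if and only if $\lambda$ is a resonance of $P_V$. 4. For every $\lambda\in\Lambda_\Gamma$ and all sufficiently small $\varepsilon>0$, the inverse $(\zeta^2-P_{V,\Gamma})^{-1}$ exists on the circle $|\zeta-\lambda|=\varepsilon$, the operator $$\Pi_{\lambda,\Gamma}=\frac1{2\pi i}\oint_{|\zeta-\lambda|=\varepsilon}(\zeta^2-P_{V,\Gamma})^{-1}\,2\zeta\,d\zeta:L^2(\Gamma)\to L^2(\Gamma)$$ (positively oriented circle) has finite rank, and $m(\lambda)=\operatorname{tr}_{L^2(\Gamma)}\Pi_{\lambda,\Gamma}$. -/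

import Mathlib

open MeasureTheory Set Filter Topology
open scoped ENNReal

noncomputable section

/-! ### Simple curves in the complex plane and the arc length measure -/

/-- A `C¹` simple curve in `ℂ`, given by a regular injective parametrization `ℝ → ℂ`. -/
structure SimpleCurve where
  γ : ℝ → ℂ
  contDiff : ContDiff ℝ 1 γ
  deriv_ne_zero : ∀ t, deriv γ t ≠ 0
  injective : Function.Injective γ

namespace SimpleCurve

/-- The arc length measure `|dz| = |γ'(t)| dt`, in the parameter `t`. Functions on `Γ` are
identified throughout with functions of the parameter. -/
def arcLength (Γ : SimpleCurve) : Measure ℝ :=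
  volume.withDensity (fun t => ‖deriv Γ.γ t‖ₑ)

theorem ae_arcLength (Γ : SimpleCurve) : ae Γ.arcLength = ae (volume : Measure ℝ) := by
  ext s
  have h := ae_withDensity_iff (μ := (volume : Measure ℝ)) (p := fun t => t ∈ s)
    (f := fun t => ‖deriv Γ.γ t‖ₑ) (measurable_deriv Γ.γ).enorm
  have h' : (∀ᵐ t ∂Γ.arcLength, t ∈ s) ↔ ∀ᵐ t : ℝ, t ∈ s := by
    simpa [arcLength, Γ.deriv_ne_zero] using h
  exact h'

/-- The values on `Γ` of a function `V` on the real line: `V(z)` at the points of `Γ ∩ ℝ`, and `0`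
at the other points of `Γ`. -/
def restrict (Γ : SimpleCurve) (V : ℝ → ℂ) (t : ℝ) : ℂ :=
  if (Γ.γ t).im = 0 then V (Γ.γ t).re else 0

/-- A Lebesgue null set of the real line is null on `Γ`. -/
theorem volume_real_preimage (Γ : SimpleCurve) {N : Set ℝ} (hN : volume N = 0) :
    volume {t | (Γ.γ t).im = 0 ∧ (Γ.γ t).re ∈ N} = 0 := by
  obtain ⟨M, hNM, hM, hM0⟩ := exists_measurable_superset_of_null hN
  set A : Set ℝ := {t | (Γ.γ t).im = 0 ∧ (Γ.γ t).re ∈ M} with hA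
  suffices h : volume A = 0 from
    measure_mono_null (show {t | (Γ.γ t).im = 0 ∧ (Γ.γ t).re ∈ N} ⊆ A from
      fun t ht => ⟨ht.1, hNM ht.2⟩) h
  have hc : Continuous Γ.γ := Γ.contDiff.continuous
  have hAm : MeasurableSet A :=
    (measurableSet_eq_fun (Complex.measurable_im.comp hc.measurable) measurable_const).inter
      ((Complex.measurable_re.comp hc.measurable) hM)
  have hd : ∀ t, HasDerivAt Γ.γ (deriv Γ.γ t) t := fun t =>
    ((Γ.contDiff.differentiable one_ne_zero) t).hasDerivAt
  have hre : ∀ t, HasDerivAt (fun s => (Γ.γ s).re) (deriv Γ.γ t).re t := fun t =>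
    Complex.reCLM.hasFDerivAt.comp_hasDerivAt t (hd t)
  have him : ∀ t, HasDerivAt (fun s => (Γ.γ s).im) (deriv Γ.γ t).im t := fun t =>
    Complex.imCLM.hasFDerivAt.comp_hasDerivAt t (hd t)
  have hinj : InjOn (fun s => (Γ.γ s).re) A := fun s hs t ht hst =>
    Γ.injective (Complex.ext hst (hs.1.trans ht.1.symm))
  have himg : volume ((fun s => (Γ.γ s).re) '' A) = 0 :=
    measure_mono_null (image_subset_iff.2 fun t ht => ht.2) hM0
  have key : ∀ f' : ℝ → ℝ, Measurable f' →
      (∀ t ∈ A, HasDerivWithinAt (fun s => (Γ.γ s).re) (f' t) A t) →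
      ∀ᵐ t, t ∈ A → f' t = 0 := by
    intro f' hf' hf
    have h := lintegral_image_eq_lintegral_abs_deriv_mul hAm hf hinj (fun _ => 1)
    rw [Measure.restrict_eq_zero.2 himg, lintegral_zero_measure] at h
    simp only [mul_one] at h
    have h0 := (lintegral_eq_zero_iff (by fun_prop)).1 h.symm
    have h1 := (ae_restrict_iff' hAm).1 h0
    filter_upwards [h1] with t ht htA
    have := ht htA
    simpa using this
  have hdm : Measurable (deriv Γ.γ) := measurable_deriv _
  have k1 := key (fun t => (deriv Γ.γ t).re) (by fun_prop) fun t _ => (hre t).hasDerivWithinAt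
  have k2 := key (fun t => (deriv Γ.γ t).re + (deriv Γ.γ t).im) (by fun_prop) fun t ht =>
    (((hre t).add (him t)).hasDerivWithinAt).congr
      (fun s hs => by simp [hs.1]) (by simp [ht.1])
  have k3 : ∀ᵐ t, t ∉ A := by
    filter_upwards [k1, k2] with t h1 h2 htA
    apply Γ.deriv_ne_zero t
    have e1 := h1 htA
    have e2 := h2 htA
    exact Complex.ext (by simpa using e1) (by simp only [Complex.zero_im]; linarith)
  simpa [ae_iff] using k3

theorem memLp_restrict (Γ : SimpleCurve) {V : ℝ → ℂ} (hV : MemLp V ∞ volume) :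
    MemLp (Γ.restrict V) ∞ Γ.arcLength := by
  have hc : Continuous Γ.γ := Γ.contDiff.continuous
  have pull : ∀ {p : ℝ → Prop}, (∀ᵐ x, p x) →
      ∀ᵐ t ∂Γ.arcLength, (Γ.γ t).im = 0 → p (Γ.γ t).re := by
    intro p hp
    rw [ae_arcLength]
    have := Γ.volume_real_preimage (N := {x | ¬ p x}) (by simpa [ae_iff] using hp)
    rw [ae_iff]
    simpa [Classical.not_imp] using this
  have hS : MeasurableSet {t | (Γ.γ t).im = 0} :=
    measurableSet_eq_fun (Complex.measurable_im.comp hc.measurable) measurable_const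
  obtain ⟨W, hW, hVW⟩ := hV.aestronglyMeasurable
  have hmeas : AEStronglyMeasurable (Γ.restrict V) Γ.arcLength := by
    refine ⟨Γ.restrict W, ?_, ?_⟩
    · exact StronglyMeasurable.ite hS
        (hW.comp_measurable (Complex.measurable_re.comp hc.measurable)) stronglyMeasurable_const
    · filter_upwards [pull hVW] with t ht
      by_cases h : (Γ.γ t).im = 0
      · simp [restrict, h, ht h]
      · simp [restrict, h]
  refine memLp_top_of_bound hmeas (eLpNorm V ∞ volume).toReal ?_
  have hb : ∀ᵐ x, ‖V x‖ ≤ (eLpNorm V ∞ volume).toReal := by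
    filter_upwards [ae_le_eLpNormEssSup (f := V) (μ := volume)] with x hx
    rw [eLpNorm_exponent_top]
    have := ENNReal.toReal_mono (by simpa using hV.2.ne) hx
    simpa using this
  filter_upwards [pull hb] with t ht
  by_cases h : (Γ.γ t).im = 0
  · simpa [restrict, h] using ht h
  · simp [restrict, h]

end SimpleCurve

/-! ### Weak derivatives and Sobolev spaces -/

/-- `w` is the weak derivative of `u` on the real line: `w` is locally integrable and `u` is almost
everywhere equal to a primitive of `w`. -/
def HasWeakDeriv (u w : ℝ → ℂ) : Prop :=
  LocallyIntegrable w volume ∧ ∃ c : ℂ, ∀ᵐ t, u t = c + ∫ s in (0 : ℝ)..t, w s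

theorem HasWeakDeriv.congr {u u' w w' : ℝ → ℂ} (h : HasWeakDeriv u w)
    (hu : u =ᵐ[volume] u') (hw : w =ᵐ[volume] w') : HasWeakDeriv u' w' := by
  obtain ⟨hl, c, hc⟩ := h
  refine ⟨hl.congr hw, c, ?_⟩
  filter_upwards [hc, hu] with t h1 h2
  rw [← h2, h1]
  congr 1
  exact intervalIntegral.integral_congr_ae (hw.mono fun s hs _ => hs)

theorem HasWeakDeriv.zero : HasWeakDeriv 0 0 :=
  ⟨locallyIntegrable_zero, 0, by simp⟩

theorem HasWeakDeriv.add {u u' w w' : ℝ → ℂ} (h : HasWeakDeriv u w) (h' : HasWeakDeriv u' w') :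
    HasWeakDeriv (u + u') (w + w') := by
  obtain ⟨hl, c, hc⟩ := h
  obtain ⟨hl', c', hc'⟩ := h'
  refine ⟨hl.add hl', c + c', ?_⟩
  filter_upwards [hc, hc'] with t h1 h2
  have e : ∫ s in (0 : ℝ)..t, (w + w') s = (∫ s in (0 : ℝ)..t, w s) + ∫ s in (0 : ℝ)..t, w' s :=
    intervalIntegral.integral_add
      (LocallyIntegrable.integrableOn_isCompact hl isCompact_uIcc).intervalIntegrable
      (LocallyIntegrable.integrableOn_isCompact hl' isCompact_uIcc).intervalIntegrable
  rw [Pi.add_apply, h1, h2, e]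
  ring

theorem HasWeakDeriv.const_smul {u w : ℝ → ℂ} (k : ℂ) (h : HasWeakDeriv u w) :
    HasWeakDeriv (k • u) (k • w) := by
  obtain ⟨hl, c, hc⟩ := h
  refine ⟨hl.smul k, k * c, ?_⟩
  filter_upwards [hc] with t h1
  simp only [Pi.smul_apply, smul_eq_mul, h1, intervalIntegral.integral_const_mul]
  ring

namespace SimpleCurve

/-- `L²(Γ)`, with respect to arc length. -/
abbrev L2 (Γ : SimpleCurve) : Type := Lp ℂ 2 Γ.arcLength

/-- `v = ∂_{z,Γ} u = γ'(t)⁻¹ ∂ₜ u`, in the weak sense: the weak derivative of `u` in the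
parameter `t` is `γ' v`. -/
def HasDerivAlong (Γ : SimpleCurve) (u v : ℝ → ℂ) : Prop :=
  HasWeakDeriv u (fun t => deriv Γ.γ t * v t)

/-- `H²(Γ)`: the functions `u ∈ L²(Γ)` with `∂_{z,Γ} u ∈ L²(Γ)` and `∂_{z,Γ}² u ∈ L²(Γ)`. A function
`u` is recorded together with its (uniquely determined) derivatives, as the triple
`(u, ∂_{z,Γ} u, ∂_{z,Γ}² u)`, so that `H²(Γ)` carries the Sobolev norm
`max (‖u‖, ‖∂_{z,Γ} u‖, ‖∂_{z,Γ}² u‖)`. -/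
def H2 (Γ : SimpleCurve) : Submodule ℂ (Γ.L2 × Γ.L2 × Γ.L2) where
  carrier := {p | Γ.HasDerivAlong p.1 p.2.1 ∧ Γ.HasDerivAlong p.2.1 p.2.2}
  zero_mem' := by
    have h : ((0 : Γ.L2) : ℝ → ℂ) =ᵐ[volume] 0 := by
      rw [EventuallyEq, ← Γ.ae_arcLength]; exact Lp.coeFn_zero ℂ 2 Γ.arcLength
    have key : Γ.HasDerivAlong (0 : Γ.L2) (0 : Γ.L2) := by
      refine HasWeakDeriv.zero.congr h.symm ?_
      filter_upwards [h] with t ht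
      rw [ht]
      simp
    exact ⟨key, key⟩
  add_mem' := by
    have h : ∀ f g : Γ.L2, ((f + g : Γ.L2) : ℝ → ℂ) =ᵐ[volume] f + g := fun f g => by
      rw [EventuallyEq, ← Γ.ae_arcLength]; exact Lp.coeFn_add f g
    have key : ∀ f g f' g' : Γ.L2, Γ.HasDerivAlong f g → Γ.HasDerivAlong f' g' →
        Γ.HasDerivAlong (f + f' : Γ.L2) (g + g' : Γ.L2) := fun f g f' g' h1 h2 => by
      refine (HasWeakDeriv.add h1 h2).congr (h f f').symm ?_
      filter_upwards [h g g'] with t ht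
      rw [ht]
      simp only [Pi.add_apply, mul_add]
    exact fun {p q} hp hq => ⟨key _ _ _ _ hp.1 hq.1, key _ _ _ _ hp.2 hq.2⟩
  smul_mem' := by
    have h : ∀ (c : ℂ) (f : Γ.L2), ((c • f : Γ.L2) : ℝ → ℂ) =ᵐ[volume] c • (f : ℝ → ℂ) :=
      fun c f => by
        rw [EventuallyEq, ← Γ.ae_arcLength]; exact Lp.coeFn_smul c f
    have key : ∀ (c : ℂ) (f g : Γ.L2), Γ.HasDerivAlong f g →
        Γ.HasDerivAlong (c • f : Γ.L2) (c • g : Γ.L2) := fun c f g h1 => by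
      refine (HasWeakDeriv.const_smul c h1).congr (h c f).symm ?_
      filter_upwards [h c g] with t ht
      simp only [Pi.smul_apply, smul_eq_mul, ht]
      ring
    exact fun c p hp => ⟨key c _ _ hp.1, key c _ _ hp.2⟩

/-- The inclusion `H²(Γ) → L²(Γ)`. -/
def incl (Γ : SimpleCurve) : Γ.H2 →L[ℂ] Γ.L2 :=
  ContinuousLinearMap.fst ℂ Γ.L2 (Γ.L2 × Γ.L2) ∘L Γ.H2.subtypeL

/-- `∂_{z,Γ}² : H²(Γ) → L²(Γ)`. -/
def deriv2 (Γ : SimpleCurve) : Γ.H2 →L[ℂ] Γ.L2 :=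
  ContinuousLinearMap.snd ℂ Γ.L2 Γ.L2 ∘L ContinuousLinearMap.snd ℂ Γ.L2 (Γ.L2 × Γ.L2) ∘L
    Γ.H2.subtypeL

/-- Multiplication by (the restriction to `Γ` of) `V ∈ L^∞(ℝ; ℂ)` on `L²(Γ)`. -/
def mulPotential (Γ : SimpleCurve) {V : ℝ → ℂ} (hV : MemLp V ∞ volume) : Γ.L2 →L[ℂ] Γ.L2 :=
  (ContinuousLinearMap.mul ℂ ℂ).holderL Γ.arcLength ∞ 2 2 ((Γ.memLp_restrict hV).toLp (Γ.restrict V))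

/-- `P_{V,Γ} = -∂_{z,Γ}² + V : H²(Γ) → L²(Γ)`. -/
def P (Γ : SimpleCurve) {V : ℝ → ℂ} (hV : MemLp V ∞ volume) : Γ.H2 →L[ℂ] Γ.L2 :=
  -Γ.deriv2 + Γ.mulPotential hV ∘L Γ.incl

/-- `λ²` belongs to the spectrum of `P_{V,Γ}`. -/
def IsSpectral (Γ : SimpleCurve) {V : ℝ → ℂ} (hV : MemLp V ∞ volume) (lam : ℂ) : Prop :=
  ¬ (Γ.P hV - lam ^ 2 • Γ.incl).IsInvertible

/-- `λ²` is an eigenvalue of `P_{V,Γ}`. -/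
def IsEigen (Γ : SimpleCurve) {V : ℝ → ℂ} (hV : MemLp V ∞ volume) (lam : ℂ) : Prop :=
  ∃ u : Γ.H2, Γ.incl u ≠ 0 ∧ Γ.P hV u = lam ^ 2 • Γ.incl u

/-- `(ζ² - P_{V,Γ})⁻¹ : L²(Γ) → L²(Γ)` (with the value `0` where the inverse does not exist). -/
def resolvent (Γ : SimpleCurve) {V : ℝ → ℂ} (hV : MemLp V ∞ volume) (ζ : ℂ) : Γ.L2 →L[ℂ] Γ.L2 :=
  Γ.incl ∘L (ζ ^ 2 • Γ.incl - Γ.P hV).inverse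

/-- `(2πi)⁻¹ ∮ (ζ² - P_{V,Γ})⁻¹ 2ζ dζ` over the positively oriented circle of centre `λ` and
radius `ε`. -/
def riesz (Γ : SimpleCurve) {V : ℝ → ℂ} (hV : MemLp V ∞ volume) (lam : ℂ) (ε : ℝ) :
    Γ.L2 →L[ℂ] Γ.L2 :=
  (2 * (Real.pi : ℂ) * Complex.I)⁻¹ • ∮ ζ in C(lam, ε), (2 * ζ) • Γ.resolvent hV ζ

/-- The geometric assumptions on `Γ`: outside a compact set `Γ` consists of the two rays
`z₊ + e^{iθ}(0,∞)` and `z₋ - e^{iθ}(0,∞)`, it contains `[-L, L]`, and, when it is traversed so that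
`Im z` runs from `-∞` to `+∞`, the point `-L` comes before the point `L`. -/
structure IsScalingContour (Γ : SimpleCurve) (θ L : ℝ) : Prop where
  rays : ∃ (zp zm : ℂ) (K : Set ℂ), IsCompact K ∧
    range Γ.γ \ K =
      ({z | ∃ s : ℝ, 0 < s ∧ z = zp + s * Complex.exp (θ * Complex.I)} ∪
        {z | ∃ s : ℝ, 0 < s ∧ z = zm - s * Complex.exp (θ * Complex.I)}) \ K
  segment : ∀ x ∈ Icc (-L) L, (x : ℂ) ∈ range Γ.γ
  im_atTop : Tendsto (fun t => (Γ.γ t).im) atTop atTop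
  im_atBot : Tendsto (fun t => (Γ.γ t).im) atBot atBot
  oriented : ∀ a b : ℝ, Γ.γ a = ((-L : ℝ) : ℂ) → Γ.γ b = (L : ℂ) → a < b

end SimpleCurve

/-- The sector `Λ_Γ = {λ ∈ ℂ \ (-∞, 0] : -θ < arg λ < π - θ}`. -/
def scalingSector (θ : ℝ) : Set ℂ :=
  {lam | lam ∈ Complex.slitPlane ∧ -θ < lam.arg ∧ lam.arg < Real.pi - θ}

/-- `T` has finite rank and its trace, computed in any Hilbert basis, is `τ`. -/
def HasFiniteRankTrace {H : Type} [NormedAddCommGroup H] [InnerProductSpace ℂ H]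
    (T : H →L[ℂ] H) (τ : ℂ) : Prop :=
  FiniteDimensional ℂ T.range ∧
    ∀ (ι : Type) (b : HilbertBasis ι ℂ H), HasSum (fun i => inner ℂ (b i) (T (b i))) τ

/-! ### The scattering resolvent, resonances and their multiplicities -/

/-- `f` vanishes (almost everywhere) outside `[-M, M]`. -/
def VanishesOutside (M : ℝ) (f : ℝ → ℂ) : Prop :=
  ∀ᵐ x, x ∉ Icc (-M) M → f x = 0

/-- `L²_comp(ℝ)`. -/
def L2Comp : Submodule ℂ (Lp ℂ 2 (volume : Measure ℝ)) where
  carrier := {f | ∃ M, VanishesOutside M f}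
  zero_mem' := ⟨0, by
    filter_upwards [Lp.coeFn_zero ℂ 2 (volume : Measure ℝ)] with x hx _
    exact hx⟩
  add_mem' := by
    rintro f g ⟨M, hM⟩ ⟨M', hM'⟩
    refine ⟨max M M', ?_⟩
    filter_upwards [hM, hM', Lp.coeFn_add f g] with x h1 h2 h3 hx
    have e1 : x ∉ Icc (-M) M := fun h => hx
      ⟨(neg_le_neg (le_max_left _ _)).trans h.1, h.2.trans (le_max_left _ _)⟩
    have e2 : x ∉ Icc (-M') M' := fun h => hx
      ⟨(neg_le_neg (le_max_right _ _)).trans h.1, h.2.trans (le_max_right _ _)⟩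
    rw [h3, Pi.add_apply, h1 e1, h2 e2, add_zero]
  smul_mem' := by
    rintro c f ⟨M, hM⟩
    refine ⟨M, ?_⟩
    filter_upwards [hM, Lp.coeFn_smul c f] with x h1 h2 hx
    simp [h2, h1 hx]

/-- `L²_loc(ℝ)`. -/
def L2Loc : Submodule ℂ (ℝ →ₘ[(volume : Measure ℝ)] ℂ) where
  carrier := {f | ∀ M : ℝ, MemLp f 2 (volume.restrict (Icc (-M) M))}
  zero_mem' := fun _ =>
    (memLp_congr_ae (ae_restrict_of_ae AEEqFun.coeFn_zero)).2 MemLp.zero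
  add_mem' := fun {f g} hf hg M =>
    (memLp_congr_ae (ae_restrict_of_ae (AEEqFun.coeFn_add f g))).2 ((hf M).add (hg M))
  smul_mem' := fun c f hf M =>
    (memLp_congr_ae (ae_restrict_of_ae (AEEqFun.coeFn_smul c f))).2 ((hf M).const_smul c)

/-- A family `B(λ) : L²_comp(ℝ) → L²_loc(ℝ)` is holomorphic on `U`: for every `M`, the truncated
operators `1_{[-M,M]} B(λ) 1_{[-M,M]}` are a norm-holomorphic family of bounded operators on
`L²(ℝ)`. -/
def HolomorphicFamilyOn (B : ℂ → L2Comp →ₗ[ℂ] L2Loc) (U : Set ℂ) : Prop :=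
  ∀ M : ℝ, ∃ T : ℂ → Lp ℂ 2 (volume : Measure ℝ) →L[ℂ] Lp ℂ 2 (volume : Measure ℝ),
    DifferentiableOn ℂ T U ∧
    ∀ lam ∈ U, ∀ f : L2Comp, VanishesOutside M (f : Lp ℂ 2 (volume : Measure ℝ)) →
      T lam f =ᵐ[volume] (Icc (-M) M).indicator (B lam f : ℝ →ₘ[(volume : Measure ℝ)] ℂ)

/-- Near `λ₀`, `R(λ) = ∑_{j=1}^J A_j / (λ - λ₀)^j + B(λ)` with `A_j` of finite rank and `B`
holomorphic near `λ₀` (`A_j` is `A (j - 1)` in the code). -/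
def HasLaurentExpansion (R : ℂ → L2Comp →ₗ[ℂ] L2Loc) (lam₀ : ℂ) {J : ℕ}
    (A : Fin J → L2Comp →ₗ[ℂ] L2Loc) : Prop :=
  (∀ j, Module.Finite ℂ (LinearMap.range (A j))) ∧
  ∃ (B : ℂ → L2Comp →ₗ[ℂ] L2Loc) (U : Set ℂ), IsOpen U ∧ lam₀ ∈ U ∧ HolomorphicFamilyOn B U ∧
    ∀ lam ∈ U, lam ≠ lam₀ →
      R lam = ∑ j : Fin J, ((lam - lam₀) ^ ((j : ℕ) + 1))⁻¹ • A j + B lam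

/-- `R` is a meromorphic family of operators `L²_comp(ℝ) → L²_loc(ℝ)` on `ℂ`. -/
def IsMeromorphicFamily (R : ℂ → L2Comp →ₗ[ℂ] L2Loc) : Prop :=
  ∀ lam₀ : ℂ, ∃ (J : ℕ) (A : Fin J → L2Comp →ₗ[ℂ] L2Loc), HasLaurentExpansion R lam₀ A

/-- `u ∈ H²(ℝ)` and `(-∂ₓ² + V - λ²) u = f`. -/
def IsH2Solution (V : ℝ → ℂ) (lam : ℂ) (u f : ℝ → ℂ) : Prop :=
  ∃ v w : ℝ → ℂ, MemLp u 2 volume ∧ MemLp v 2 volume ∧ MemLp w 2 volume ∧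
    HasWeakDeriv u v ∧ HasWeakDeriv v w ∧
    ∀ᵐ x, -w x + V x * u x - lam ^ 2 * u x = f x

/-- `R` is the scattering resolvent of `P_V = -∂ₓ² + V`: the meromorphic continuation to `ℂ`, as a
family of operators `L²_comp(ℝ) → L²_loc(ℝ)`, of `(P_V - λ²)⁻¹`, `Im λ ≫ 1`. -/
def IsScatteringResolvent (V : ℝ → ℂ) (R : ℂ → L2Comp →ₗ[ℂ] L2Loc) : Prop :=
  IsMeromorphicFamily R ∧
  ∃ C : ℝ, ∀ lam : ℂ, C < lam.im → ∀ f : L2Comp,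
    IsH2Solution V lam (R lam f : ℝ →ₘ[(volume : Measure ℝ)] ℂ) (f : Lp ℂ 2 (volume : Measure ℝ))

/-- `λ₀` is a pole of the meromorphic family `R`. -/
def IsPole (R : ℂ → L2Comp →ₗ[ℂ] L2Loc) (lam₀ : ℂ) : Prop :=
  ∃ (J : ℕ) (A : Fin J → L2Comp →ₗ[ℂ] L2Loc), HasLaurentExpansion R lam₀ A ∧ ∃ j, A j ≠ 0

/-- `dim span {A_1(L²_comp), …, A_J(L²_comp)}`: the multiplicity of the pole with polar part
`A_1, …, A_J` (it is `0` if there is no pole). -/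
def polarMultiplicity {J : ℕ} (A : Fin J → L2Comp →ₗ[ℂ] L2Loc) : ℕ :=
  Module.finrank ℂ (⨆ j, LinearMap.range (A j) : Submodule ℂ L2Loc)

end

/-! ### Primitives of locally integrable functions -/

/-! Along the curve the stationary equation is the linear system `u' = γ' v`, `v' = γ' (q - λ²) u`
in the parameter, and all the operators involved are explicit in terms of its solutions. The Jost
solutions `p` and `m` equal `e^{iλz}` to the right and `e^{-iλz}` to the left of the potential. They
are entire in `λ`, and so is their Wronskian `W`. Both the spectrum in the sector and the resonances
turn out to be the zeros of `W`, with the same multiplicities.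

For `λ` in the sector, `κ = Im (λ e^{iθ})` is positive. Since `γ` stays at bounded distance from
`e^{iθ} ℓ`, with `ℓ` the arc length, `p = O(e^{-κℓ})` and `m = O(e^{κℓ})` along the whole curve. If
`W ≠ 0`, the Green kernel built from `p`, `m` and `1/W` is dominated by `e^{-κ|ℓ(t) - ℓ(s)|}`, which
is bounded on `L²` by Schur's test; hence the operator is invertible (`isInvertible`). If `W = 0`,
then `p` and `m` are proportional, so `m` decays at both ends and is an eigenfunction (`isEigen`).

The real line is itself a curve, with `θ = 0`, so the same Green formula yields the resolvent of
`P_V` high in the upper half plane. An algebraic identity (`kernel_eq`) splits the Green kernel into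
an entire Volterra kernel and `W⁻¹ m(t) p(s)`, and this continues meromorphically to `ℂ`. Since the
curve and the line share the segment that carries `V`, the two Wronskians agree (`jost_W_eq`), so
eigenvalues and resonances coincide.

It remains to compare multiplicities at a zero of order `n`, where `W = (ζ - λ₀)^n g`. On the line,
the polar coefficients are triangular combinations of Taylor coefficients of `m` and of `p/g`; their
ranges span the first `n` Taylor coefficients of `m`, which are independent because to the left they
are multiples of `t^l e^{-iλ₀t}` (`exists_hasLaurentExpansion`). The identity theorem makes the
polar part independent of the chosen resolvent.

On the curve, consider the moments `M_k = (2πi)⁻¹ ∮ 2ζ (ζ² - λ₀²)^k (ζ² - P)⁻¹ dζ`. They satisfy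
`M_j M_k = M_{j+k}` for `j, k ≥ 0` and `M_k = 0` for `k ≥ n`. Thus `M_0`, the Riesz operator, is a
projection, and its range lies in the span of the same `n` Taylor coefficients. As `M_{n-1} ≠ 0` and
`M_1` is nilpotent, the rank is exactly `n` (`finrank_range`), and the trace of a projection of
finite rank is its rank. Finally `-M_{-1}` inverts `P - λ₀²` up to the finite rank operator `M_0`,
which gives the Fredholm property. -/

theorem MeasureTheory.LocallyIntegrable.intervalIntegrable' {w : ℝ → ℂ}
    (h : LocallyIntegrable w volume) (a b : ℝ) : IntervalIntegrable w volume a b :=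
  (h.integrableOn_isCompact isCompact_uIcc).intervalIntegrable

/-- `u` is a primitive of the locally integrable function `w`. -/
def HasPrim (u w : ℝ → ℂ) : Prop :=
  LocallyIntegrable w volume ∧ ∀ t, u t = u 0 + ∫ s in (0 : ℝ)..t, w s

namespace HasPrim

variable {u v w z : ℝ → ℂ}

theorem sub_eq (h : HasPrim u w) (a b : ℝ) : u b - u a = ∫ s in a..b, w s := by
  rw [h.2 b, h.2 a, ← intervalIntegral.integral_interval_sub_left (h.1.intervalIntegrable' 0 b)
    (h.1.intervalIntegrable' 0 a)]
  ring

theorem continuous (h : HasPrim u w) : Continuous u := by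
  have : u = fun t => u 0 + ∫ s in (0 : ℝ)..t, w s := funext h.2
  rw [this]
  exact continuous_const.add
    (intervalIntegral.continuous_primitive (fun a b => h.1.intervalIntegrable' a b) 0)

theorem of_sub_eq (hw : LocallyIntegrable w volume) (t₀ : ℝ)
    (h : ∀ t, u t = u t₀ + ∫ s in t₀..t, w s) : HasPrim u w := by
  refine ⟨hw, fun t => ?_⟩
  rw [h t, h 0, add_assoc, intervalIntegral.integral_add_adjacent_intervals
    (hw.intervalIntegrable' _ _) (hw.intervalIntegrable' _ _)]

theorem congr (h : HasPrim u w) (hw : w =ᵐ[volume] z) : HasPrim u z := by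
  refine ⟨h.1.congr hw, fun t => ?_⟩
  rw [h.2 t]
  congr 1
  exact intervalIntegral.integral_congr_ae (hw.mono fun s hs _ => hs)

theorem add (h : HasPrim u w) (h' : HasPrim v z) : HasPrim (fun t => u t + v t)
    (fun t => w t + z t) := by
  refine ⟨h.1.add h'.1, fun t => ?_⟩
  simp only
  rw [intervalIntegral.integral_add (h.1.intervalIntegrable' _ _) (h'.1.intervalIntegrable' _ _),
    h.2 t, h'.2 t]
  ring

theorem const_mul (c : ℂ) (h : HasPrim u w) : HasPrim (fun t => c * u t) (fun t => c * w t) := by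
  refine ⟨h.1.smul c, fun t => ?_⟩
  simp only
  rw [intervalIntegral.integral_const_mul, h.2 t]
  ring

theorem sub (h : HasPrim u w) (h' : HasPrim v z) : HasPrim (fun t => u t - v t)
    (fun t => w t - z t) := by
  have := h.add (h'.const_mul (-1))
  simpa [sub_eq_add_neg] using this

theorem eq_of_ae_zero (h : HasPrim u w) {a b : ℝ} (h0 : ∀ᵐ s, s ∈ uIoc a b → w s = 0) :
    u b = u a := by
  have := h.sub_eq a b
  rw [intervalIntegral.integral_zero_ae h0] at this
  exact sub_eq_zero.1 this

theorem eq_of_ae_eq_zero (h : HasPrim u w) (h0 : w =ᵐ[volume] 0) (a b : ℝ) : u b = u a :=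
  h.eq_of_ae_zero (h0.mono fun _ hs _ => hs)

theorem of_hasDerivAt (h : ∀ t, HasDerivAt u (w t) t) (hw : Continuous w) : HasPrim u w := by
  refine ⟨hw.locallyIntegrable, fun t => ?_⟩
  rw [intervalIntegral.integral_eq_sub_of_hasDerivAt (fun s _ => h s) (hw.intervalIntegrable _ _)]
  ring

/-- Primitives of merely integrable functions need not be differentiable everywhere. Absolute
continuity is what allows an almost everywhere vanishing derivative to imply constancy in `mul`. The
real and imaginary parts of `w` are integrated separately. -/
theorem absolutelyContinuous (h : HasPrim u w) (a b : ℝ) :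
    AbsolutelyContinuousOnInterval u a b := by
  have hi := h.1.intervalIntegrable' a b
  have hre : IntervalIntegrable (fun s => (w s).re) volume a b := ⟨hi.1.re, hi.2.re⟩
  have him : IntervalIntegrable (fun s => (w s).im) volume a b := ⟨hi.1.im, hi.2.im⟩
  have key : ∀ {f : ℝ → ℝ}, IntervalIntegrable f volume a b →
      AbsolutelyContinuousOnInterval (fun x => ((∫ s in a..x, f s : ℝ) : ℂ)) a b := by
    intro f hf
    have h1 := hf.absolutelyContinuousOnInterval_intervalIntegral (c := a) left_mem_uIcc
    rw [absolutelyContinuousOnInterval_iff] at h1 ⊢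
    intro ε hε
    obtain ⟨δ, hδ, h2⟩ := h1 ε hε
    refine ⟨δ, hδ, fun E hE hE' => ?_⟩
    simpa only [Complex.isometry_ofReal.dist_eq] using h2 E hE hE'
  have hc : ∀ c : ℂ, AbsolutelyContinuousOnInterval (fun _ : ℝ => c) a b := fun c =>
    (LipschitzWith.const c).lipschitzOnWith.absolutelyContinuousOnInterval (K := 0)
  have h2 := ((hc (u a)).add (key hre)).add ((hc Complex.I).smul (key him))
  have h3 : ∀ x, x ∈ uIcc a b → u x = u a + ((∫ s in a..x, (w s).re : ℝ) : ℂ) +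
      Complex.I • ((∫ s in a..x, (w s).im : ℝ) : ℂ) := by
    intro x hx
    have h4 := h.sub_eq a x
    have hi' := h.1.intervalIntegrable' a x
    have hr : IntervalIntegrable (fun s => ((w s).re : ℂ)) volume a x :=
      ⟨hi'.1.re.ofReal, hi'.2.re.ofReal⟩
    have hm : IntervalIntegrable (fun s => ((w s).im : ℂ)) volume a x :=
      ⟨hi'.1.im.ofReal, hi'.2.im.ofReal⟩
    have h5 : ∫ s in a..x, w s = ((∫ s in a..x, (w s).re : ℝ) : ℂ) +
        ((∫ s in a..x, (w s).im : ℝ) : ℂ) * Complex.I := by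
      rw [← intervalIntegral.integral_ofReal, ← intervalIntegral.integral_ofReal,
        ← intervalIntegral.integral_mul_const, ← intervalIntegral.integral_add hr (hm.mul_const _)]
      simp [Complex.re_add_im]
    rw [h5] at h4
    rw [smul_eq_mul]
    linear_combination h4
  rw [absolutelyContinuousOnInterval_iff] at h2 ⊢
  intro ε hε
  obtain ⟨δ, hδ, h6⟩ := h2 ε hε
  refine ⟨δ, hδ, fun E hE hE' => ?_⟩
  refine lt_of_eq_of_lt ?_ (h6 E hE hE')
  refine Finset.sum_congr rfl fun i hi => ?_
  rw [h3 _ (hE.1 i hi).1, h3 _ (hE.1 i hi).2]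
  rfl

theorem ae_hasDerivAt (h : HasPrim u w) : ∀ᵐ t, HasDerivAt u (w t) t := by
  filter_upwards [_root_.LocallyIntegrable.ae_hasDerivAt_integral h.1] with t ht
  have : u = fun t => u 0 + ∫ s in (0 : ℝ)..t, w s := funext h.2
  rw [this]
  exact (ht 0).const_add _

/-- The difference between `u v` and the primitive of `w v + u z` is absolutely continuous with
derivative zero almost everywhere, hence constant. -/
theorem mul (h : HasPrim u w) (h' : HasPrim v z) :
    HasPrim (fun t => u t * v t) (fun t => w t * v t + u t * z t) := by
  have hl : LocallyIntegrable (fun t => w t * v t + u t * z t) volume := by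
    refine LocallyIntegrable.add ?_ ?_
    · have := h.1.smul_continuous h'.continuous
      simpa [mul_comm] using this
    · exact h'.1.continuous_smul h.continuous
  refine ⟨hl, fun t => ?_⟩
  have hI : HasPrim (fun t => ∫ s in (0 : ℝ)..t, (w s * v s + u s * z s))
      (fun t => w t * v t + u t * z t) := ⟨hl, by simp⟩
  have hac := ((h.absolutelyContinuous 0 t).smul (h'.absolutelyContinuous 0 t)).sub
    (hI.absolutelyContinuous 0 t)
  obtain ⟨C, hC⟩ := hac.const_of_ae_hasDerivAt_zero (by
    filter_upwards [h.ae_hasDerivAt, h'.ae_hasDerivAt, hI.ae_hasDerivAt] with s h1 h2 h3 _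
    have := (h1.mul h2).sub h3
    simpa using this)
  have e1 := hC t right_mem_uIcc
  have e2 := hC 0 left_mem_uIcc
  simp only [Pi.sub_apply, smul_eq_mul, Pi.mul_apply, intervalIntegral.integral_same,
    sub_zero] at e1 e2
  simp only
  linear_combination e1 - e2

theorem hasWeakDeriv (h : HasPrim u w) : HasWeakDeriv u w :=
  ⟨h.1, u 0, ae_of_all _ h.2⟩

end HasPrim

theorem HasWeakDeriv.exists_hasPrim {u w : ℝ → ℂ} (h : HasWeakDeriv u w) :
    ∃ v, u =ᵐ[volume] v ∧ HasPrim v w := by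
  obtain ⟨hl, c, hc⟩ := h
  exact ⟨fun t => c + ∫ s in (0 : ℝ)..t, w s, hc, hl, by simp⟩

theorem Continuous.ext_of_ae_eq {u v : ℝ → ℂ} (hu : Continuous u) (hv : Continuous v)
    (h : u =ᵐ[volume] v) : u = v :=
  Measure.eq_of_ae_eq h hu hv

/-! ### Volterra operators and linear systems with bounded measurable coefficients -/

/-- The induction step of Picard iteration: every integration against a weight bounded by `C` raises
the power by one and improves the factorial. -/
theorem norm_intervalIntegral_mul_le_pow {w v : ℝ → ℂ} {A B C D t₀ t : ℝ} (n : ℕ) (hC : 0 ≤ C)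
    (hw : ∀ᵐ s, s ∈ Icc A B → ‖w s‖ ≤ C)
    (hv : ∀ s ∈ Icc A B, ‖v s‖ ≤ D * (C * |s - t₀|) ^ n / n.factorial)
    (ht₀ : t₀ ∈ Icc A B) (ht : t ∈ Icc A B) :
    ‖∫ s in t₀..t, w s * v s‖ ≤ D * (C * |t - t₀|) ^ (n + 1) / (n + 1).factorial := by
  have hsub : uIoc t₀ t ⊆ Icc A B :=
    uIoc_subset_uIcc.trans (uIcc_subset_Icc ht₀ ht)
  calc ‖∫ s in t₀..t, w s * v s‖ ≤ ∫ s in uIoc t₀ t, ‖w s * v s‖ :=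
        intervalIntegral.norm_integral_le_integral_norm_uIoc
    _ ≤ ∫ s in uIoc t₀ t, D * C ^ (n + 1) / n.factorial * |s - t₀| ^ n := by
        refine integral_mono_of_nonneg (ae_of_all _ fun s => norm_nonneg _) ?_ ?_
        · have hc : Continuous fun s : ℝ => D * C ^ (n + 1) / n.factorial * |s - t₀| ^ n := by
            fun_prop
          exact (hc.integrableOn_uIcc (a := t₀) (b := t)).mono_set uIoc_subset_uIcc
        · refine (ae_restrict_iff' measurableSet_uIoc).2 ?_
          filter_upwards [hw] with s hs hmem
          have h1 := hs (hsub hmem)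
          have h2 := hv s (hsub hmem)
          rw [norm_mul]
          calc ‖w s‖ * ‖v s‖ ≤ C * (D * (C * |s - t₀|) ^ n / n.factorial) :=
                mul_le_mul h1 h2 (norm_nonneg _) hC
            _ = _ := by rw [mul_pow]; ring
    _ = D * (C * |t - t₀|) ^ (n + 1) / (n + 1).factorial := by
        rw [integral_const_mul, integral_pow_abs_sub_uIoc, Nat.factorial_succ, mul_pow]
        push_cast
        field_simp

/-- Iterating the two equations bounds both functions by `D (C |t - t₀|)^n / n!` for every `n`, and
this tends to zero. -/
theorem volterra_unique {w z u v : ℝ → ℂ} {A B C t₀ : ℝ} (hC : 0 ≤ C)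
    (hw : ∀ᵐ s, s ∈ Icc A B → ‖w s‖ ≤ C) (hz : ∀ᵐ s, s ∈ Icc A B → ‖z s‖ ≤ C)
    (ht₀ : t₀ ∈ Icc A B) (hu : ContinuousOn u (Icc A B)) (hv : ContinuousOn v (Icc A B))
    (eu : ∀ t ∈ Icc A B, u t = ∫ s in t₀..t, w s * v s)
    (ev : ∀ t ∈ Icc A B, v t = ∫ s in t₀..t, z s * u s) :
    ∀ t ∈ Icc A B, u t = 0 ∧ v t = 0 := by
  obtain ⟨D₁, hD₁⟩ := isCompact_Icc.exists_bound_of_continuousOn hu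
  obtain ⟨D₂, hD₂⟩ := isCompact_Icc.exists_bound_of_continuousOn hv
  set D := max D₁ D₂
  have key : ∀ n : ℕ, ∀ t ∈ Icc A B, ‖u t‖ ≤ D * (C * |t - t₀|) ^ n / n.factorial ∧
      ‖v t‖ ≤ D * (C * |t - t₀|) ^ n / n.factorial := by
    intro n
    induction n with
    | zero =>
      intro t ht
      simp only [pow_zero, mul_one, Nat.factorial_zero, Nat.cast_one, div_one]
      exact ⟨(hD₁ t ht).trans (le_max_left D₁ D₂), (hD₂ t ht).trans (le_max_right D₁ D₂)⟩
    | succ n ih =>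
      intro t ht
      rw [eu t ht, ev t ht]
      exact ⟨norm_intervalIntegral_mul_le_pow n hC hw (fun s hs => (ih s hs).2) ht₀ ht,
        norm_intervalIntegral_mul_le_pow n hC hz (fun s hs => (ih s hs).1) ht₀ ht⟩
  intro t ht
  have hlim : Tendsto (fun n : ℕ => D * (C * |t - t₀|) ^ n / n.factorial) atTop (𝓝 0) := by
    have := (FloorSemiring.tendsto_pow_div_factorial_atTop (C * |t - t₀|)).const_mul D
    simpa [mul_div_assoc] using this
  constructor
  · exact norm_le_zero_iff.1 (ge_of_tendsto' hlim fun n => (key n t ht).1)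
  · exact norm_le_zero_iff.1 (ge_of_tendsto' hlim fun n => (key n t ht).2)

/-- The Volterra operator `u ↦ ∫_{t₀}^t w u` on `C([A, B])`. -/
noncomputable def volterra {A B : ℝ} (t₀ : Icc A B) (w : ℝ → ℂ) (hw : LocallyIntegrable w volume) :
    C(Icc A B, ℂ) →L[ℂ] C(Icc A B, ℂ) :=
  have hAB : A ≤ B := t₀.2.1.trans t₀.2.2
  have hi : ∀ (u : C(Icc A B, ℂ)) (a b : ℝ),
      IntervalIntegrable (fun s => w s * u (projIcc A B hAB s)) volume a b := fun u a b =>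
    (hw.intervalIntegrable' a b).mul_continuousOn (by fun_prop)
  LinearMap.mkContinuous
    { toFun := fun u => ⟨fun t => ∫ s in (t₀ : ℝ)..t, w s * u (projIcc A B hAB s),
        (intervalIntegral.continuous_primitive (hi u) _).comp continuous_subtype_val⟩
      map_add' := fun u v => by
        ext t
        simp only [ContinuousMap.coe_mk, ContinuousMap.add_apply, mul_add]
        exact intervalIntegral.integral_add (hi u _ _) (hi v _ _)
      map_smul' := fun c u => by
        ext t
        simp only [ContinuousMap.coe_mk, ContinuousMap.smul_apply, smul_eq_mul, RingHom.id_apply]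
        rw [← intervalIntegral.integral_const_mul]
        congr 1
        ext s
        ring }
    (∫ s in Icc A B, ‖w s‖) fun u => by
      have hwi : IntegrableOn (fun s => ‖w s‖) (Icc A B) volume :=
        (hw.integrableOn_isCompact isCompact_Icc).norm
      rw [ContinuousMap.norm_le _ (by positivity)]
      intro t
      have hsub : uIoc (t₀ : ℝ) t ⊆ Icc A B :=
        uIoc_subset_uIcc.trans (uIcc_subset_Icc t₀.2 t.2)
      calc ‖∫ s in (t₀ : ℝ)..t, w s * u (projIcc A B hAB s)‖
          ≤ ∫ s in uIoc (t₀ : ℝ) t, ‖w s * u (projIcc A B hAB s)‖ :=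
            intervalIntegral.norm_integral_le_integral_norm_uIoc
        _ ≤ ∫ s in uIoc (t₀ : ℝ) t, ‖w s‖ * ‖u‖ := by
            refine integral_mono_of_nonneg (ae_of_all _ fun s => norm_nonneg _)
              ((hwi.mono_set hsub).mul_const _) (ae_of_all _ fun s => ?_)
            simp only [norm_mul]
            exact mul_le_mul_of_nonneg_left (u.norm_coe_le_norm _) (norm_nonneg _)
        _ = (∫ s in uIoc (t₀ : ℝ) t, ‖w s‖) * ‖u‖ := integral_mul_const _ _
        _ ≤ (∫ s in Icc A B, ‖w s‖) * ‖u‖ := by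
            refine mul_le_mul_of_nonneg_right ?_ (norm_nonneg _)
            exact setIntegral_mono_set hwi (ae_of_all _ fun s => norm_nonneg _)
              (Eventually.of_forall hsub)

theorem volterra_apply {A B : ℝ} (t₀ : Icc A B) (w : ℝ → ℂ) (hw : LocallyIntegrable w volume)
    (u : C(Icc A B, ℂ)) (t : Icc A B) :
    volterra t₀ w hw u t =
      ∫ s in (t₀ : ℝ)..t, w s * u (projIcc A B (t₀.2.1.trans t₀.2.2) s) := rfl

/-- The integral operator of the system `u' = w v`, `v' = (z₁ - k z₂) u`. -/
noncomputable def volterraSystem {A B : ℝ} (t₀ : Icc A B) {w z : ℝ → ℂ}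
    (hw : LocallyIntegrable w volume) (hz : LocallyIntegrable z volume) (k : ℂ) :
    (C(Icc A B, ℂ) × C(Icc A B, ℂ)) →L[ℂ] (C(Icc A B, ℂ) × C(Icc A B, ℂ)) :=
  ((volterra t₀ w hw).comp (ContinuousLinearMap.snd ℂ _ _)).prod
    ((volterra t₀ z hz).comp (ContinuousLinearMap.fst ℂ _ _)) -
  k • (0 : (C(Icc A B, ℂ) × C(Icc A B, ℂ)) →L[ℂ] C(Icc A B, ℂ)).prod
    ((volterra t₀ w hw).comp (ContinuousLinearMap.fst ℂ _ _))

theorem volterraSystem_apply {A B : ℝ} (t₀ : Icc A B) {w z : ℝ → ℂ}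
    (hw : LocallyIntegrable w volume) (hz : LocallyIntegrable z volume) (k : ℂ)
    (Y : C(Icc A B, ℂ) × C(Icc A B, ℂ)) (t : Icc A B) :
    (volterraSystem t₀ hw hz k Y).1 t =
      ∫ s in (t₀ : ℝ)..t, w s * Y.2 (projIcc A B (t₀.2.1.trans t₀.2.2) s) ∧
    (volterraSystem t₀ hw hz k Y).2 t =
      ∫ s in (t₀ : ℝ)..t, (z s - k * w s) * Y.1 (projIcc A B (t₀.2.1.trans t₀.2.2) s) := by
  constructor
  · simp [volterraSystem, volterra_apply]
  · simp only [volterraSystem, _root_.sub_apply, ContinuousLinearMap.prod_apply,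
      _root_.smul_apply, Prod.snd_sub, Prod.smul_snd, ContinuousMap.sub_apply,
      ContinuousLinearMap.comp_apply, ContinuousMap.smul_apply, volterra_apply, smul_eq_mul,
      ContinuousLinearMap.coe_fst']
    rw [← intervalIntegral.integral_const_mul, ← intervalIntegral.integral_sub]
    · congr 1
      ext s
      ring
    · exact (hz.intervalIntegrable' _ _).mul_continuousOn (by fun_prop)
    · exact ((hw.intervalIntegrable' _ _).mul_continuousOn (by fun_prop)).const_mul _

/-- `1 - x^n` is a unit and factors as `1 - x` times a geometric sum; the two factors commute, so
each of them is a unit. -/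
theorem isUnit_one_sub_of_norm_pow_lt_one {R : Type*} [NormedRing R] [CompleteSpace R] {x : R}
    {n : ℕ} (h : ‖x ^ n‖ < 1) : IsUnit (1 - x) := by
  have h1 : IsUnit (1 - x ^ n) := isUnit_one_sub_of_norm_lt_one h
  rw [← mul_neg_geom_sum x n] at h1
  have hcomm : Commute (1 - x) (∑ i ∈ Finset.range n, x ^ i) := by
    refine Commute.sum_right _ _ _ fun i _ => ?_
    exact (Commute.one_left _).sub_left (Commute.pow_right (Commute.refl x) i)
  exact (hcomm.isUnit_mul_iff.1 h1).1

/-- The operator need not be small, but its `n`-th power has norm at most `(C (B - A))^n / n!`,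
which is eventually below `1`. -/
theorem isUnit_one_sub_volterraSystem {A B C : ℝ} (t₀ : Icc A B) {w z : ℝ → ℂ}
    (hw : LocallyIntegrable w volume) (hz : LocallyIntegrable z volume) (k : ℂ) (hC : 0 ≤ C)
    (hwC : ∀ᵐ s, s ∈ Icc A B → ‖w s‖ ≤ C) (hzC : ∀ᵐ s, s ∈ Icc A B → ‖z s - k * w s‖ ≤ C) :
    IsUnit (1 - volterraSystem t₀ hw hz k) := by
  have hAB : A ≤ B := t₀.2.1.trans t₀.2.2
  set K := volterraSystem t₀ hw hz k with hK
  have key : ∀ (n : ℕ) (Y : C(Icc A B, ℂ) × C(Icc A B, ℂ)) (t : Icc A B),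
      ‖((K ^ n) Y).1 t‖ ≤ ‖Y‖ * (C * |(t : ℝ) - t₀|) ^ n / n.factorial ∧
      ‖((K ^ n) Y).2 t‖ ≤ ‖Y‖ * (C * |(t : ℝ) - t₀|) ^ n / n.factorial := by
    intro n Y
    induction n with
    | zero =>
      intro t
      simp only [pow_zero, one_apply_eq_self, mul_one, Nat.factorial_zero,
        Nat.cast_one, div_one]
      exact ⟨(Y.1.norm_coe_le_norm t).trans (norm_fst_le Y),
        (Y.2.norm_coe_le_norm t).trans (norm_snd_le Y)⟩
    | succ n ih =>
      intro t
      have e : (K ^ (n + 1)) Y = K ((K ^ n) Y) := by rw [pow_succ']; rfl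
      rw [e, hK, (volterraSystem_apply t₀ hw hz k _ t).1, (volterraSystem_apply t₀ hw hz k _ t).2]
      constructor
      · refine norm_intervalIntegral_mul_le_pow n hC hwC (fun s hs => ?_) t₀.2 t.2
        rw [projIcc_of_mem hAB hs]
        exact (ih ⟨s, hs⟩).2
      · refine norm_intervalIntegral_mul_le_pow n hC hzC (fun s hs => ?_) t₀.2 t.2
        rw [projIcc_of_mem hAB hs]
        exact (ih ⟨s, hs⟩).1
  have hlim := FloorSemiring.tendsto_pow_div_factorial_atTop (C * (B - A))
  obtain ⟨n, hn⟩ := (hlim.eventually_lt_const (show (0 : ℝ) < 1 / 2 by norm_num)).exists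
  have hn' : ‖K ^ n‖ < 1 := by
    refine lt_of_le_of_lt ?_ (show (1 / 2 : ℝ) < 1 by norm_num)
    refine ContinuousLinearMap.opNorm_le_bound _ (by norm_num) fun Y => ?_
    have h0 : 0 ≤ 1 / 2 * ‖Y‖ := by positivity
    have hb : ∀ t : Icc A B, ‖Y‖ * (C * |(t : ℝ) - t₀|) ^ n / n.factorial ≤ 1 / 2 * ‖Y‖ := by
      intro t
      have h1 : |(t : ℝ) - t₀| ≤ B - A := by
        rw [abs_le]
        constructor <;> linarith [t.2.1, t.2.2, t₀.2.1, t₀.2.2]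
      calc ‖Y‖ * (C * |(t : ℝ) - t₀|) ^ n / n.factorial
          ≤ ‖Y‖ * (C * (B - A)) ^ n / n.factorial := by gcongr
        _ = (C * (B - A)) ^ n / n.factorial * ‖Y‖ := by ring
        _ ≤ 1 / 2 * ‖Y‖ := mul_le_mul_of_nonneg_right hn.le (norm_nonneg _)
    rw [Prod.norm_def]
    exact max_le ((ContinuousMap.norm_le _ h0).2 fun t => ((key n Y t).1).trans (hb t))
      ((ContinuousMap.norm_le _ h0).2 fun t => ((key n Y t).2).trans (hb t))
  exact isUnit_one_sub_of_norm_pow_lt_one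
    (R := (C(Icc A B, ℂ) × C(Icc A B, ℂ)) →L[ℂ] (C(Icc A B, ℂ) × C(Icc A B, ℂ))) hn'

/-- The fixed point is `(1 - K)⁻¹ y`, and inversion is holomorphic on the units of the Banach
algebra of operators. -/
theorem exists_differentiable_fixedPoint {E : Type*} [NormedAddCommGroup E] [NormedSpace ℂ E]
    [CompleteSpace E] {K : ℂ → E →L[ℂ] E} (hK : Differentiable ℂ K)
    (hunit : ∀ lam, IsUnit (1 - K lam)) {y : ℂ → E} (hy : Differentiable ℂ y) :
    ∃ Y : ℂ → E, Differentiable ℂ Y ∧ ∀ lam, Y lam = y lam + K lam (Y lam) := by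
  refine ⟨fun lam => Ring.inverse (1 - K lam) (y lam), ?_, fun lam => ?_⟩
  · have h1 : Differentiable ℂ fun lam => Ring.inverse (1 - K lam) := fun lam =>
      DifferentiableAt.comp (g := Ring.inverse) (f := fun lam => 1 - K lam) lam
        (differentiableAt_inverse (𝕜 := ℂ) (hunit lam)) ((hK lam).const_sub 1)
    exact h1.clm_apply hy
  · have h1 := Ring.mul_inverse_cancel _ (hunit lam)
    have h2 : (1 - K lam) (Ring.inverse (1 - K lam) (y lam)) = y lam := by
      show ((1 - K lam) * Ring.inverse (1 - K lam)) (y lam) = _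
      rw [h1]
      rfl
    conv_rhs => enter [1]; rw [← h2]
    simp

theorem exists_volterra_solution {A B C : ℝ} (t₀ : Icc A B) {w z : ℝ → ℂ}
    (hw : LocallyIntegrable w volume) (hz : LocallyIntegrable z volume) (hC : 0 ≤ C)
    (hwC : ∀ᵐ s, s ∈ Icc A B → ‖w s‖ ≤ C) (hzC : ∀ᵐ s, s ∈ Icc A B → ‖z s‖ ≤ C)
    {u₀ v₀ : ℂ → ℂ} (hu₀ : Differentiable ℂ u₀) (hv₀ : Differentiable ℂ v₀) :
    ∃ Φ Ψ : ℂ → C(Icc A B, ℂ), Differentiable ℂ Φ ∧ Differentiable ℂ Ψ ∧ ∀ lam t,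
      Φ lam t = u₀ lam +
        ∫ s in (t₀ : ℝ)..t, w s * Ψ lam (projIcc A B (t₀.2.1.trans t₀.2.2) s) ∧
      Ψ lam t = v₀ lam +
        ∫ s in (t₀ : ℝ)..t, (z s - lam ^ 2 * w s) * Φ lam (projIcc A B (t₀.2.1.trans t₀.2.2) s) := by
  let E := C(Icc A B, ℂ) × C(Icc A B, ℂ)
  let K : ℂ → (E →L[ℂ] E) := fun lam => volterraSystem t₀ hw hz (lam ^ 2)
  let c : ℂ →L[ℂ] C(Icc A B, ℂ) := (ContinuousLinearMap.id ℂ ℂ).smulRight 1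
  have hc : ∀ k t, c k t = k := fun k t => by simp [c]
  -- The operator is affine in `λ²`, so its dependence on `λ` is polynomial.
  have hK : Differentiable ℂ K := by
    have h2 : Differentiable ℂ fun lam : ℂ => lam ^ 2 := differentiable_pow 2
    have h3 : ∀ {F : Type} [NormedAddCommGroup F] [NormedSpace ℂ F] (a b : F),
        Differentiable ℂ fun k : ℂ => a - k • b := by
      intro F _ _ a b
      fun_prop
    exact (h3 (F := E →L[ℂ] E) _ _).comp h2
  have hunit : ∀ lam, IsUnit (1 - K lam) := fun lam => by
    -- One constant has to bound both coefficients `w` and `z - λ² w`.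
    refine isUnit_one_sub_volterraSystem (C := C + ‖lam ^ 2‖ * C) t₀ hw hz _ (by positivity) ?_ ?_
    · filter_upwards [hwC] with s hs hmem
      have := hs hmem
      have h2 : 0 ≤ ‖lam ^ 2‖ * C := by positivity
      linarith
    · filter_upwards [hwC, hzC] with s hs hs' hmem
      refine (norm_sub_le _ _).trans (add_le_add (hs' hmem) ?_)
      rw [norm_mul]
      exact mul_le_mul_of_nonneg_left (hs hmem) (norm_nonneg _)
  obtain ⟨Y, hY, eq⟩ := exists_differentiable_fixedPoint hK hunit
    ((c.differentiable.comp hu₀).prodMk (c.differentiable.comp hv₀))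
  refine ⟨fun lam => (Y lam).1, fun lam => (Y lam).2, hY.fst, hY.snd, fun lam t => ?_⟩
  have h3 := volterraSystem_apply t₀ hw hz (lam ^ 2) (Y lam) t
  constructor
  · rw [← h3.1]
    show (Y lam).1 t = _
    conv_lhs => rw [eq lam, Prod.fst_add, ContinuousMap.add_apply]
    exact congrArg (· + _) (hc (u₀ lam) t)
  · rw [← h3.2]
    show (Y lam).2 t = _
    conv_lhs => rw [eq lam, Prod.snd_add, ContinuousMap.add_apply]
    exact congrArg (· + _) (hc (v₀ lam) t)

/-! ### Holomorphic families of continuous functions on the real line -/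

/-- `F(λ, ·)` depends holomorphically on `λ ∈ U` as a continuous function on `ℝ`, locally
uniformly on `ℝ`. -/
def HolFamOn (U : Set ℂ) (F : ℂ → ℝ → ℂ) : Prop :=
  ∀ A B : ℝ, ∃ Φ : ℂ → C(Icc A B, ℂ), DifferentiableOn ℂ Φ U ∧
    ∀ lam ∈ U, ∀ t : Icc A B, Φ lam t = F lam t

namespace HolFamOn

variable {U : Set ℂ} {F G : ℂ → ℝ → ℂ}

theorem mono {U' : Set ℂ} (h : HolFamOn U F) (hU : U' ⊆ U) : HolFamOn U' F := fun A B => by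
  obtain ⟨Φ, h1, h2⟩ := h A B
  exact ⟨Φ, h1.mono hU, fun lam hl => h2 lam (hU hl)⟩

theorem differentiableOn_eval (h : HolFamOn U F) (t : ℝ) :
    DifferentiableOn ℂ (fun lam => F lam t) U := by
  obtain ⟨Φ, h1, h2⟩ := h t t
  have h3 : DifferentiableOn ℂ
      (fun lam => ContinuousMap.evalCLM ℂ (⟨t, left_mem_Icc.2 le_rfl⟩ : Icc t t) (Φ lam)) U :=
    (ContinuousLinearMap.differentiable _).comp_differentiableOn h1
  exact h3.congr fun lam hl => (h2 lam hl ⟨t, left_mem_Icc.2 le_rfl⟩).symm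

theorem continuous (h : HolFamOn U F) {lam : ℂ} (hl : lam ∈ U) : Continuous (F lam) := by
  rw [continuous_iff_continuousAt]
  intro t
  obtain ⟨Φ, -, h2⟩ := h (t - 1) (t + 1)
  have h3 : ContinuousOn (F lam) (Icc (t - 1) (t + 1)) := by
    rw [continuousOn_iff_continuous_domRestrict]
    exact (Φ lam).continuous.congr fun s => h2 lam hl s
  exact h3.continuousAt (Icc_mem_nhds (by linarith) (by linarith))

theorem mul (hF : HolFamOn U F) (hG : HolFamOn U G) :
    HolFamOn U (fun lam t => F lam t * G lam t) := fun A B => by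
  obtain ⟨Φ, h1, h2⟩ := hF A B
  obtain ⟨Ψ, h3, h4⟩ := hG A B
  exact ⟨fun lam => Φ lam * Ψ lam, h1.mul h3, fun lam hl t => by
    simp [h2 lam hl, h4 lam hl]⟩

theorem add (hF : HolFamOn U F) (hG : HolFamOn U G) :
    HolFamOn U (fun lam t => F lam t + G lam t) := fun A B => by
  obtain ⟨Φ, h1, h2⟩ := hF A B
  obtain ⟨Ψ, h3, h4⟩ := hG A B
  exact ⟨fun lam => Φ lam + Ψ lam, h1.add h3, fun lam hl t => by
    simp [h2 lam hl, h4 lam hl]⟩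

theorem of_scalar {k : ℂ → ℂ} (hk : DifferentiableOn ℂ k U) :
    HolFamOn U (fun lam _ => k lam) := fun A B => by
  refine ⟨fun lam => k lam • 1, hk.smul_const _, fun lam hl t => by simp⟩

theorem const_mul {k : ℂ → ℂ} (hk : DifferentiableOn ℂ k U) (hF : HolFamOn U F) :
    HolFamOn U (fun lam t => k lam * F lam t) :=
  (of_scalar hk).mul hF

theorem sub (hF : HolFamOn U F) (hG : HolFamOn U G) :
    HolFamOn U (fun lam t => F lam t - G lam t) := by
  have := hF.add (const_mul (k := fun _ => -1) (differentiableOn_const _) hG)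
  simpa [sub_eq_add_neg] using this

theorem of_continuous {f : ℝ → ℂ} (hf : Continuous f) : HolFamOn U (fun _ => f) := fun A B =>
  ⟨fun _ => ⟨fun t => f t, by fun_prop⟩, differentiableOn_const _, fun _ _ _ => rfl⟩

/-- The removable singularity theorem applies to the family with values in `C([A, B])`, and
evaluation at `t` commutes with the difference quotient. -/
theorem dslope {lam₀ : ℂ} (hU : U ∈ 𝓝 lam₀) (h : HolFamOn U F) :
    HolFamOn U (fun lam t => _root_.dslope (fun mu => F mu t) lam₀ lam) := fun A B => by
  obtain ⟨Φ, h1, h2⟩ := h A B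
  refine ⟨_root_.dslope Φ lam₀, (Complex.differentiableOn_dslope hU).2 h1, fun lam hl t => ?_⟩
  have h3 := ContinuousLinearMap.dslope_comp
    (ContinuousMap.evalCLM ℂ t : C(Icc A B, ℂ) →L[ℂ] ℂ) Φ lam₀ lam
    (fun _ => h1.differentiableAt hU)
  rw [ContinuousMap.evalCLM_apply] at h3
  show _ = _root_.dslope (fun mu => F mu t) lam₀ lam
  rw [← h3]
  have h4 : ∀ mu ∈ U, ((ContinuousMap.evalCLM ℂ t : C(Icc A B, ℂ) →L[ℂ] ℂ) ∘ Φ) mu = F mu t :=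
    fun mu hmu => h2 mu hmu t
  rcases eq_or_ne lam lam₀ with rfl | hne
  · rw [dslope_same, dslope_same]
    exact Filter.EventuallyEq.deriv_eq (eventually_of_mem hU h4)
  · rw [dslope_of_ne _ hne, dslope_of_ne _ hne, slope_def_field, slope_def_field, h4 lam hl,
      h4 lam₀ (mem_of_mem_nhds hU)]

/-- Integration against a fixed locally integrable density. -/
theorem integral {φ : ℝ → ℂ} (hφ : LocallyIntegrable φ volume) (t₀ : ℝ) (h : HolFamOn U F) :
    HolFamOn U (fun lam t => ∫ s in t₀..t, F lam s * φ s) := fun A B => by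
  have h0 : t₀ ∈ Icc (min A t₀) (max B t₀) := ⟨min_le_right _ _, le_max_right _ _⟩
  obtain ⟨Φ, h1, h2⟩ := h (min A t₀) (max B t₀)
  let ι : C(Icc A B, Icc (min A t₀) (max B t₀)) :=
    ⟨Set.inclusion (Icc_subset_Icc (min_le_left _ _) (le_max_left _ _)), continuous_inclusion _⟩
  refine ⟨fun lam => ContinuousMap.compCLM ℂ ℂ ι (volterra ⟨t₀, h0⟩ φ hφ (Φ lam)),
    (ContinuousLinearMap.differentiable _).comp_differentiableOn
      ((ContinuousLinearMap.differentiable _).comp_differentiableOn h1), fun lam hl t => ?_⟩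
  show volterra ⟨t₀, h0⟩ φ hφ (Φ lam) (ι t) = _
  rw [volterra_apply]
  refine intervalIntegral.integral_congr fun s hs => ?_
  have hs' : s ∈ Icc (min A t₀) (max B t₀) := uIcc_subset_Icc h0 (ι t).2 hs
  rw [projIcc_of_mem _ hs', h2 lam hl, mul_comm]

end HolFamOn

/-- Solutions of the system `u' = w v`, `v' = (z - λ² w) u` with holomorphic initial data. -/
theorem exists_holFam_solution {w z : ℝ → ℂ}
    (hw : LocallyIntegrable w volume) (hz : LocallyIntegrable z volume)
    (hb : ∀ A B : ℝ, ∃ C, 0 ≤ C ∧ (∀ᵐ s, s ∈ Icc A B → ‖w s‖ ≤ C) ∧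
      ∀ᵐ s, s ∈ Icc A B → ‖z s‖ ≤ C) (t₀ : ℝ)
    {u₀ v₀ : ℂ → ℂ} (hu₀ : Differentiable ℂ u₀) (hv₀ : Differentiable ℂ v₀) :
    ∃ u v : ℂ → ℝ → ℂ, HolFamOn univ u ∧ HolFamOn univ v ∧ ∀ lam,
      HasPrim (u lam) (fun t => w t * v lam t) ∧
      HasPrim (v lam) (fun t => (z t - lam ^ 2 * w t) * u lam t) ∧
      u lam t₀ = u₀ lam ∧ v lam t₀ = v₀ lam := by
  -- Intervals of radius `|M|` around `t₀` are nonempty for every real `M`, so that solutions can be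
  -- chosen for all `M` at once.
  have h0 : ∀ M : ℝ, t₀ ∈ Icc (t₀ - |M|) (t₀ + |M|) := fun M => by
    constructor <;> linarith [abs_nonneg M]
  have h1 : ∀ M : ℝ, ∃ Φ Ψ : ℂ → C(Icc (t₀ - |M|) (t₀ + |M|), ℂ),
      Differentiable ℂ Φ ∧ Differentiable ℂ Ψ ∧ ∀ lam t,
      Φ lam t = u₀ lam +
        ∫ s in t₀..t, w s * Ψ lam (projIcc _ _ ((h0 M).1.trans (h0 M).2) s) ∧
      Ψ lam t = v₀ lam + ∫ s in t₀..t,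
        (z s - lam ^ 2 * w s) * Φ lam (projIcc _ _ ((h0 M).1.trans (h0 M).2) s) := fun M => by
    obtain ⟨C, hC, hwC, hzC⟩ := hb (t₀ - |M|) (t₀ + |M|)
    exact exists_volterra_solution ⟨t₀, h0 M⟩ hw hz hC hwC hzC hu₀ hv₀
  choose Φ Ψ hΦ hΨ hΦΨ using h1
  set e : ∀ M : ℝ, C(Icc (t₀ - |M|) (t₀ + |M|), ℂ) → ℝ → ℂ := fun M f t =>
    f (projIcc _ _ ((h0 M).1.trans (h0 M).2) t) with he
  have hec : ∀ M f, Continuous (e M f) := fun M f => by rw [he]; fun_prop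
  have eqM : ∀ M lam, ∀ t ∈ Icc (t₀ - |M|) (t₀ + |M|),
      e M (Φ M lam) t = u₀ lam + (∫ s in t₀..t, w s * e M (Ψ M lam) s) ∧
      e M (Ψ M lam) t = v₀ lam + ∫ s in t₀..t, (z s - lam ^ 2 * w s) * e M (Φ M lam) s := by
    intro M lam t ht
    have := hΦΨ M lam ⟨t, ht⟩
    simp only [he, projIcc_of_mem _ ht]
    exact this
  have hzw : ∀ lam : ℂ, LocallyIntegrable (fun s => z s - lam ^ 2 * w s) volume := fun lam =>
    hz.sub (hw.smul (lam ^ 2))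
  -- Uniqueness for the Volterra system makes the solutions on nested intervals agree, so they glue
  -- to a solution on the line.
  have cons : ∀ M N lam, |M| ≤ |N| → ∀ t ∈ Icc (t₀ - |M|) (t₀ + |M|),
      e M (Φ M lam) t = e N (Φ N lam) t ∧ e M (Ψ M lam) t = e N (Ψ N lam) t := by
    intro M N lam hMN t ht
    have hsub : Icc (t₀ - |M|) (t₀ + |M|) ⊆ Icc (t₀ - |N|) (t₀ + |N|) :=
      Icc_subset_Icc (by linarith) (by linarith)
    obtain ⟨C, hC, hwC, hzC⟩ := hb (t₀ - |M|) (t₀ + |M|)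
    have hC' : 0 ≤ ‖lam ^ 2‖ * C := by positivity
    have := volterra_unique (w := w) (z := fun s => z s - lam ^ 2 * w s)
      (u := fun t => e M (Φ M lam) t - e N (Φ N lam) t)
      (v := fun t => e M (Ψ M lam) t - e N (Ψ N lam) t) (C := C + ‖lam ^ 2‖ * C) (by positivity)
      (by
        filter_upwards [hwC] with s hs hmem
        linarith [hs hmem])
      (by
        filter_upwards [hwC, hzC] with s hs hs' hmem
        refine (norm_sub_le _ _).trans (add_le_add (hs' hmem) ?_)
        rw [norm_mul]
        exact mul_le_mul_of_nonneg_left (hs hmem) (norm_nonneg _))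
      (h0 M) ((hec _ _).sub (hec _ _)).continuousOn ((hec _ _).sub (hec _ _)).continuousOn
      (fun t ht => by
        rw [(eqM M lam t ht).1, (eqM N lam t (hsub ht)).1, add_sub_add_left_eq_sub,
          ← intervalIntegral.integral_sub]
        · simp only [mul_sub]
        · exact (hw.intervalIntegrable' _ _).mul_continuousOn (hec _ _).continuousOn
        · exact (hw.intervalIntegrable' _ _).mul_continuousOn (hec _ _).continuousOn)
      (fun t ht => by
        rw [(eqM M lam t ht).2, (eqM N lam t (hsub ht)).2, add_sub_add_left_eq_sub,
          ← intervalIntegral.integral_sub]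
        · simp only [mul_sub]
        · exact ((hzw lam).intervalIntegrable' _ _).mul_continuousOn (hec _ _).continuousOn
        · exact ((hzw lam).intervalIntegrable' _ _).mul_continuousOn (hec _ _).continuousOn) t ht
    exact ⟨sub_eq_zero.1 this.1, sub_eq_zero.1 this.2⟩
  have hmem : ∀ t, t ∈ Icc (t₀ - |t - t₀|) (t₀ + |t - t₀|) := fun t => by
    constructor <;> linarith [le_abs_self (t - t₀), neg_abs_le (t - t₀)]
  have habs : ∀ N t, t ∈ Icc (t₀ - |N|) (t₀ + |N|) → |t - t₀| ≤ |N| := fun N t ht => by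
    rw [abs_le]
    constructor <;> linarith [ht.1, ht.2]
  -- The value at `t` is read off on the smallest interval of the exhaustion that contains `t`; by
  -- `cons` any larger one gives the same.
  let u : ℂ → ℝ → ℂ := fun lam t => e (t - t₀) (Φ (t - t₀) lam) t
  let v : ℂ → ℝ → ℂ := fun lam t => e (t - t₀) (Ψ (t - t₀) lam) t
  have huv : ∀ N lam, ∀ t ∈ Icc (t₀ - |N|) (t₀ + |N|),
      u lam t = e N (Φ N lam) t ∧ v lam t = e N (Ψ N lam) t := fun N lam t ht =>
    cons _ _ lam (habs N t ht) t (hmem t)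
  have hol : ∀ (f : ℂ → ℝ → ℂ) (Θ : ∀ M, ℂ → C(Icc (t₀ - |M|) (t₀ + |M|), ℂ)),
      (∀ M, Differentiable ℂ (Θ M)) →
      (∀ N lam, ∀ t ∈ Icc (t₀ - |N|) (t₀ + |N|), f lam t = e N (Θ N lam) t) →
      HolFamOn univ f := by
    intro f Θ hΘ hf A B
    set N := |A - t₀| + |B - t₀| with hN
    have hN' : |N| = N := abs_of_nonneg (by positivity)
    have hsub : Icc A B ⊆ Icc (t₀ - |N|) (t₀ + |N|) := by
      rw [hN']
      exact Icc_subset_Icc (by linarith [neg_abs_le (A - t₀), abs_nonneg (B - t₀)])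
        (by linarith [le_abs_self (B - t₀), abs_nonneg (A - t₀)])
    let ι : C(Icc A B, Icc (t₀ - |N|) (t₀ + |N|)) := ⟨Set.inclusion hsub, continuous_inclusion _⟩
    refine ⟨fun lam => ContinuousMap.compCLM ℂ ℂ ι (Θ N lam),
      ((ContinuousLinearMap.differentiable _).comp (hΘ N)).differentiableOn, fun lam _ t => ?_⟩
    rw [hf N lam t (hsub t.2)]
    simp only [he, projIcc_of_mem _ (hsub t.2)]
    rfl
  refine ⟨u, v, hol u Φ hΦ fun N lam t ht => (huv N lam t ht).1,
    hol v Ψ hΨ fun N lam t ht => (huv N lam t ht).2, fun lam => ?_⟩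
  have hcu := (hol u Φ hΦ fun N lam t ht => (huv N lam t ht).1).continuous (mem_univ lam)
  have hcv := (hol v Ψ hΨ fun N lam t ht => (huv N lam t ht).2).continuous (mem_univ lam)
  have hu0 : u lam t₀ = u₀ lam := by
    have := (eqM 0 lam t₀ (h0 0)).1
    rw [(huv 0 lam t₀ (h0 0)).1, this]
    simp
  have hv0 : v lam t₀ = v₀ lam := by
    have := (eqM 0 lam t₀ (h0 0)).2
    rw [(huv 0 lam t₀ (h0 0)).2, this]
    simp
  have hl : ∀ {f g : ℝ → ℂ}, LocallyIntegrable f volume → Continuous g →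
      LocallyIntegrable (fun t => f t * g t) volume := fun hf hg => by
    have := hf.smul_continuous hg
    simpa [mul_comm] using this
  have hsub : ∀ t, uIcc t₀ t ⊆ Icc (t₀ - |t - t₀|) (t₀ + |t - t₀|) := fun t =>
    uIcc_subset_Icc (h0 _) (hmem t)
  refine ⟨HasPrim.of_sub_eq (hl hw hcv) t₀ fun t => ?_,
    HasPrim.of_sub_eq (hl (hzw lam) hcu) t₀ fun t => ?_, hu0, hv0⟩
  · rw [hu0]
    refine ((eqM (t - t₀) lam t (hmem t)).1).trans ?_
    congr 1
    refine intervalIntegral.integral_congr fun s hs => ?_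
    rw [(huv (t - t₀) lam s (hsub t hs)).2]
  · rw [hv0]
    refine ((eqM (t - t₀) lam t (hmem t)).2).trans ?_
    congr 1
    refine intervalIntegral.integral_congr fun s hs => ?_
    rw [(huv (t - t₀) lam s (hsub t hs)).1]

/-! ### Solutions of the stationary equation along a curve -/

/-- A bounded potential, as a function of the parameter, which vanishes outside `[a, b]`. -/
structure IsCompPotential (q : ℝ → ℂ) (a b : ℝ) : Prop where
  meas : AEStronglyMeasurable q volume
  bdd : ∃ Q, ∀ᵐ t, ‖q t‖ ≤ Q
  zero : ∀ t ∉ Icc a b, q t = 0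
  le : a ≤ b

namespace SimpleCurve

variable {Γ : SimpleCurve} {q : ℝ → ℂ} {a b : ℝ}

theorem continuous_deriv (Γ : SimpleCurve) : Continuous (deriv Γ.γ) :=
  Γ.contDiff.continuous_deriv le_rfl

theorem continuous_γ (Γ : SimpleCurve) : Continuous Γ.γ := Γ.contDiff.continuous

theorem hasDerivAt (Γ : SimpleCurve) (t : ℝ) : HasDerivAt Γ.γ (deriv Γ.γ t) t :=
  ((Γ.contDiff.differentiable one_ne_zero) t).hasDerivAt

theorem _root_.IsCompPotential.locallyIntegrable (hq : IsCompPotential q a b) :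
    LocallyIntegrable q volume := by
  obtain ⟨Q, hQ⟩ := hq.bdd
  rw [locallyIntegrable_iff]
  intro K hK
  exact Measure.integrableOn_of_bounded (M := Q) hK.measure_lt_top.ne hq.meas
    (ae_restrict_of_ae hQ)

/-- `-u'' + q u = λ² u` along `Γ`, with `v = u'`. -/
def IsSolution (Γ : SimpleCurve) (q : ℝ → ℂ) (lam : ℂ) (u v : ℝ → ℂ) : Prop :=
  HasPrim u (fun t => deriv Γ.γ t * v t) ∧
    HasPrim v (fun t => (deriv Γ.γ t * q t - lam ^ 2 * deriv Γ.γ t) * u t)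

namespace IsSolution

variable {lam : ℂ} {u v u' v' : ℝ → ℂ}

/-- In the derivative of the Wronskian the terms cancel in pairs, because both solutions belong to
the same potential and the same `λ`. -/
theorem wronskian_eq (h : Γ.IsSolution q lam u v) (h' : Γ.IsSolution q lam u' v') (s t : ℝ) :
    u t * v' t - v t * u' t = u s * v' s - v s * u' s := by
  refine ((h.1.mul h'.2).sub (h.2.mul h'.1)).eq_of_ae_eq_zero (ae_of_all _ fun x => ?_) s t
  simp only [Pi.zero_apply]
  ring

theorem const_mul (k : ℂ) (h : Γ.IsSolution q lam u v) :
    Γ.IsSolution q lam (fun t => k * u t) (fun t => k * v t) := by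
  refine ⟨(h.1.const_mul k).congr (ae_of_all _ fun x => ?_),
    (h.2.const_mul k).congr (ae_of_all _ fun x => ?_)⟩ <;> ring

/-- Where the potential vanishes, `k² = -λ²` gives `(v + k u)' = k γ' (v + k u)`, so `(v + k u)
e^{-kγ}` is constant. The two choices `k = ±iλ` together determine `u` and `v` when `λ ≠ 0`. -/
theorem exterior (h : Γ.IsSolution q lam u v) {k : ℂ} (hk : k ^ 2 = -lam ^ 2) {s t : ℝ}
    (hq : ∀ᵐ x, x ∈ uIoc s t → q x = 0) :
    v t + k * u t = (v s + k * u s) * Complex.exp (k * (Γ.γ t - Γ.γ s)) := by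
  have he : HasPrim (fun x => Complex.exp (-(k * Γ.γ x)))
      (fun x => Complex.exp (-(k * Γ.γ x)) * (-(k * deriv Γ.γ x))) := by
    refine HasPrim.of_hasDerivAt (fun x => ?_) ?_
    · exact (((Γ.hasDerivAt x).const_mul k).neg).cexp
    · have := Γ.continuous_deriv
      have := Γ.continuous_γ
      fun_prop
  have h1 := ((h.2.add (h.1.const_mul k)).mul he).eq_of_ae_zero (a := s) (b := t) (by
    filter_upwards [hq] with x hx hmem
    rw [hx hmem]
    linear_combination (-deriv Γ.γ x * u x * Complex.exp (-(k * Γ.γ x))) * hk)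
  have h2 : Complex.exp (-(k * Γ.γ t)) * Complex.exp (k * Γ.γ t) = 1 := by
    rw [← Complex.exp_add]
    simp
  calc v t + k * u t
      = (v t + k * u t) * Complex.exp (-(k * Γ.γ t)) * Complex.exp (k * Γ.γ t) := by
        rw [mul_assoc, h2, mul_one]
    _ = (v s + k * u s) * (Complex.exp (-(k * Γ.γ s)) * Complex.exp (k * Γ.γ t)) := by
        rw [h1, mul_assoc]
    _ = _ := by
        rw [← Complex.exp_add]
        congr 2
        ring

end IsSolution

/-- A holomorphic family of solutions. -/
structure SolFamily (Γ : SimpleCurve) (q : ℝ → ℂ) where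
  u : ℂ → ℝ → ℂ
  v : ℂ → ℝ → ℂ
  hol_u : HolFamOn univ u
  hol_v : HolFamOn univ v
  sol : ∀ lam, Γ.IsSolution q lam (u lam) (v lam)

theorem exists_solFamily (Γ : SimpleCurve) (hq : IsCompPotential q a b) (t₀ : ℝ) {u₀ v₀ : ℂ → ℂ}
    (hu₀ : Differentiable ℂ u₀) (hv₀ : Differentiable ℂ v₀) :
    ∃ S : Γ.SolFamily q, ∀ lam, S.u lam t₀ = u₀ lam ∧ S.v lam t₀ = v₀ lam := by
  have hz : LocallyIntegrable (fun t => deriv Γ.γ t * q t) volume :=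
    hq.locallyIntegrable.continuous_smul Γ.continuous_deriv
  obtain ⟨u, v, hu, hv, h⟩ := exists_holFam_solution Γ.continuous_deriv.locallyIntegrable hz
    (fun A B => by
      obtain ⟨C, hC⟩ := isCompact_Icc.exists_bound_of_continuousOn
        (Γ.continuous_deriv.continuousOn (s := Icc A B))
      obtain ⟨Q, hQ⟩ := hq.bdd
      refine ⟨|C| + |C| * |Q|, by positivity, ae_of_all _ fun s hs => ?_, ?_⟩
      · have h1 := (hC s hs).trans (le_abs_self C)
        have h2 : 0 ≤ |C| * |Q| := by positivity
        linarith
      · filter_upwards [hQ] with s hs hmem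
        have h1 := (hC s hmem).trans (le_abs_self C)
        have h2 := hs.trans (le_abs_self Q)
        rw [norm_mul]
        have h3 := mul_le_mul h1 h2 (norm_nonneg _) (abs_nonneg _)
        linarith [abs_nonneg C]) t₀ hu₀ hv₀
  exact ⟨⟨u, v, hu, hv, fun lam => ⟨(h lam).1, (h lam).2.1⟩⟩,
    fun lam => ⟨(h lam).2.2.1, (h lam).2.2.2⟩⟩

/-- Fundamental solutions `c, s` and Jost solutions `p` (outgoing to the right) and `m` (outgoing
to the left) of the stationary equation along `Γ`. -/
structure Jost (Γ : SimpleCurve) (q : ℝ → ℂ) (a b : ℝ) where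
  c : Γ.SolFamily q
  s : Γ.SolFamily q
  p : Γ.SolFamily q
  m : Γ.SolFamily q
  c_zero : ∀ lam, c.u lam 0 = 1 ∧ c.v lam 0 = 0
  s_zero : ∀ lam, s.u lam 0 = 0 ∧ s.v lam 0 = 1
  p_b : ∀ lam, p.u lam b = Complex.exp (Complex.I * lam * Γ.γ b) ∧
    p.v lam b = Complex.I * lam * Complex.exp (Complex.I * lam * Γ.γ b)
  m_a : ∀ lam, m.u lam a = Complex.exp (-(Complex.I * lam * Γ.γ a)) ∧
    m.v lam a = -(Complex.I * lam) * Complex.exp (-(Complex.I * lam * Γ.γ a))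

theorem exists_jost (Γ : SimpleCurve) (hq : IsCompPotential q a b) : Nonempty (Γ.Jost q a b) := by
  obtain ⟨c, hc⟩ := exists_solFamily Γ hq 0 (differentiable_const (1 : ℂ))
    (differentiable_const (0 : ℂ))
  obtain ⟨s, hs⟩ := exists_solFamily Γ hq 0 (differentiable_const (0 : ℂ))
    (differentiable_const (1 : ℂ))
  obtain ⟨p, hp⟩ := exists_solFamily Γ hq b
    (u₀ := fun lam => Complex.exp (Complex.I * lam * Γ.γ b))
    (v₀ := fun lam => Complex.I * lam * Complex.exp (Complex.I * lam * Γ.γ b))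
    (by fun_prop) (by fun_prop)
  obtain ⟨m, hm⟩ := exists_solFamily Γ hq a
    (u₀ := fun lam => Complex.exp (-(Complex.I * lam * Γ.γ a)))
    (v₀ := fun lam => -(Complex.I * lam) * Complex.exp (-(Complex.I * lam * Γ.γ a)))
    (by fun_prop) (by fun_prop)
  exact ⟨⟨c, s, p, m, hc, hs, hp, hm⟩⟩

namespace Jost

variable (J : Γ.Jost q a b)

/-- The Wronskian of the Jost solutions. -/
noncomputable def W (lam : ℂ) : ℂ := J.p.u lam 0 * J.m.v lam 0 - J.p.v lam 0 * J.m.u lam 0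

theorem W_eq (lam : ℂ) (t : ℝ) :
    J.p.u lam t * J.m.v lam t - J.p.v lam t * J.m.u lam t = J.W lam :=
  (J.p.sol lam).wronskian_eq (J.m.sol lam) 0 t

theorem differentiable_W : Differentiable ℂ J.W := by
  have h := fun (F : ℂ → ℝ → ℂ) (hF : HolFamOn univ F) =>
    differentiableOn_univ.1 (hF.differentiableOn_eval 0)
  exact ((h _ J.p.hol_u).mul (h _ J.m.hol_v)).sub ((h _ J.p.hol_v).mul (h _ J.m.hol_u))

theorem c_s (lam : ℂ) (t : ℝ) :
    J.c.u lam t * J.s.v lam t - J.c.v lam t * J.s.u lam t = 1 := by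
  rw [(J.c.sol lam).wronskian_eq (J.s.sol lam) 0 t, (J.c_zero lam).1, (J.c_zero lam).2,
    (J.s_zero lam).1, (J.s_zero lam).2]
  ring

theorem expand {lam : ℂ} {u v : ℝ → ℂ} (h : Γ.IsSolution q lam u v) (t : ℝ) :
    u t = u 0 * J.c.u lam t + v 0 * J.s.u lam t ∧
    v t = u 0 * J.c.v lam t + v 0 * J.s.v lam t := by
  have h1 := h.wronskian_eq (J.s.sol lam) 0 t
  have h2 := h.wronskian_eq (J.c.sol lam) 0 t
  have h3 := J.c_s lam t
  rw [(J.s_zero lam).1, (J.s_zero lam).2] at h1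
  rw [(J.c_zero lam).1, (J.c_zero lam).2] at h2
  constructor
  · linear_combination J.c.u lam t * h1 - J.s.u lam t * h2 - u t * h3
  · linear_combination J.c.v lam t * h1 - J.s.v lam t * h2 - v t * h3

theorem sol_ext (J : Γ.Jost q a b) {lam : ℂ} {u v u' v' : ℝ → ℂ} (h : Γ.IsSolution q lam u v)
    (h' : Γ.IsSolution q lam u' v') (hu : u 0 = u' 0) (hv : v 0 = v' 0) : u = u' ∧ v = v' := by
  constructor <;> ext t
  · rw [(J.expand h t).1, (J.expand h' t).1, hu, hv]
  · rw [(J.expand h t).2, (J.expand h' t).2, hu, hv]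

/-- Expanded in the basis `c, s`, the antisymmetric kernel is a determinant whose coefficient is the
Wronskian. This cancels the factor `1/W` and is the source of the splitting of the Green operator
into an entire part and a singular part of rank one. -/
theorem kernel_eq (lam : ℂ) (t y : ℝ) :
    J.p.u lam t * J.m.u lam y - J.m.u lam t * J.p.u lam y =
      J.W lam * (J.c.u lam t * J.s.u lam y - J.s.u lam t * J.c.u lam y) := by
  rw [(J.expand (J.p.sol lam) t).1, (J.expand (J.p.sol lam) y).1, (J.expand (J.m.sol lam) t).1,
    (J.expand (J.m.sol lam) y).1, W]
  ring

/-- For `λ ≠ 0` the identities of `exterior` with `k = ±iλ` suffice. At `λ = 0` they coincide, and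
the value there is recovered by continuity in `λ`. The point `0` matters because
`linearIndependent_coeffM` needs the formula as an identity between functions of `λ` on all of `ℂ`.
-/
theorem m_left (hq : IsCompPotential q a b) (lam : ℂ) {t : ℝ} (ht : t ≤ a) :
    J.m.u lam t = Complex.exp (-(Complex.I * lam * Γ.γ t)) ∧
    J.m.v lam t = -(Complex.I * lam) * Complex.exp (-(Complex.I * lam * Γ.γ t)) := by
  have hz : ∀ᵐ x, x ∈ uIoc a t → q x = 0 := by
    -- The half-open interval from `t` to `a` contains `a`, where the potential may be nonzero, so
    -- this point is discarded as a null set. For `p` the endpoint `b` is already excluded.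
    filter_upwards [compl_mem_ae_iff.2 (measure_singleton a)] with x hx hmem
    refine hq.zero x fun h => hx ?_
    rw [uIoc_of_ge ht] at hmem
    exact le_antisymm hmem.2 h.1
  have h1 : ∀ mu, J.m.v mu t + Complex.I * mu * J.m.u mu t = 0 := fun mu => by
    rw [(J.m.sol mu).exterior (k := Complex.I * mu) (by rw [mul_pow, Complex.I_sq]; ring) hz,
      (J.m_a mu).1, (J.m_a mu).2]
    ring
  have h2 : ∀ mu, mu ≠ 0 → J.m.u mu t = Complex.exp (-(Complex.I * mu * Γ.γ t)) := fun mu hmu => by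
    have h3 := (J.m.sol mu).exterior (k := -(Complex.I * mu))
      (by rw [neg_sq, mul_pow, Complex.I_sq]; ring) hz
    rw [(J.m_a mu).1, (J.m_a mu).2] at h3
    have h4 : Complex.exp (-(Complex.I * mu * Γ.γ a)) *
        Complex.exp (-(Complex.I * mu) * (Γ.γ t - Γ.γ a)) =
        Complex.exp (-(Complex.I * mu * Γ.γ t)) := by
      rw [← Complex.exp_add]
      congr 1
      ring
    have h5 : 2 * Complex.I * mu ≠ 0 := by simp [hmu]
    apply mul_left_cancel₀ h5
    linear_combination h1 mu - h3 + 2 * Complex.I * mu * h4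
  have h3 : J.m.u lam t = Complex.exp (-(Complex.I * lam * Γ.γ t)) := by
    have hc : Continuous fun mu => J.m.u mu t :=
      (differentiableOn_univ.1 (J.m.hol_u.differentiableOn_eval t)).continuous
    have hc' : Continuous fun mu => Complex.exp (-(Complex.I * mu * Γ.γ t)) := by fun_prop
    have := hc.ext_on (dense_compl_singleton (0 : ℂ)) hc' fun mu hmu => h2 mu hmu
    exact congrFun this lam
  refine ⟨h3, ?_⟩
  rw [← h3]
  linear_combination h1 lam

theorem p_right (hq : IsCompPotential q a b) {lam : ℂ} (hlam : lam ≠ 0) {t : ℝ} (ht : b ≤ t) :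
    J.p.u lam t = Complex.exp (Complex.I * lam * Γ.γ t) ∧
    J.p.v lam t = Complex.I * lam * Complex.exp (Complex.I * lam * Γ.γ t) := by
  have hz : ∀ᵐ x, x ∈ uIoc b t → q x = 0 := by
    refine ae_of_all _ fun x hmem => hq.zero x fun h => ?_
    rw [uIoc_of_le ht] at hmem
    exact absurd h.2 (not_le.2 hmem.1)
  have h1 : J.p.v lam t + -(Complex.I * lam) * J.p.u lam t = 0 := by
    rw [(J.p.sol lam).exterior (k := -(Complex.I * lam))
      (by rw [neg_sq, mul_pow, Complex.I_sq]; ring) hz, (J.p_b lam).1, (J.p_b lam).2]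
    ring
  have h3 := (J.p.sol lam).exterior (k := Complex.I * lam)
    (by rw [mul_pow, Complex.I_sq]; ring) hz
  rw [(J.p_b lam).1, (J.p_b lam).2] at h3
  have h4 : Complex.exp (Complex.I * lam * Γ.γ b) *
      Complex.exp (Complex.I * lam * (Γ.γ t - Γ.γ b)) = Complex.exp (Complex.I * lam * Γ.γ t) := by
    rw [← Complex.exp_add]
    congr 1
    ring
  have h5 : 2 * Complex.I * lam ≠ 0 := by simp [hlam]
  have h6 : J.p.u lam t = Complex.exp (Complex.I * lam * Γ.γ t) := by
    apply mul_left_cancel₀ h5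
    linear_combination h3 - h1 + 2 * Complex.I * lam * h4
  refine ⟨h6, ?_⟩
  rw [← h6]
  linear_combination h1

theorem m_ne_zero (lam : ℂ) : J.m.u lam 0 ≠ 0 ∨ J.m.v lam 0 ≠ 0 := by
  by_contra! h
  have := (J.expand (J.m.sol lam) a).1
  rw [h.1, h.2, (J.m_a lam).1] at this
  simp at this

/-- If the Wronskian vanishes, the Jost solutions are proportional. -/
theorem exists_p_eq {lam : ℂ} (hW : J.W lam = 0) :
    ∃ k : ℂ, ∀ t, J.p.u lam t = k * J.m.u lam t ∧ J.p.v lam t = k * J.m.v lam t := by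
  have key : ∃ k : ℂ, J.p.u lam 0 = k * J.m.u lam 0 ∧ J.p.v lam 0 = k * J.m.v lam 0 := by
    rw [W] at hW
    rcases J.m_ne_zero lam with h | h
    · refine ⟨J.p.u lam 0 / J.m.u lam 0, by field_simp, ?_⟩
      field_simp
      linear_combination -hW
    · refine ⟨J.p.v lam 0 / J.m.v lam 0, ?_, by field_simp⟩
      field_simp
      linear_combination hW
  obtain ⟨k, h1, h2⟩ := key
  have := J.sol_ext (J.p.sol lam) ((J.m.sol lam).const_mul k) h1 h2
  exact ⟨k, fun t => ⟨congrFun this.1 t, congrFun this.2 t⟩⟩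

end Jost

end SimpleCurve

/-! ### Schur's test -/

/-- Cauchy–Schwarz for the factorization `k F = k^{1/2} · (k^{1/2} F)`. -/
theorem lintegral_mul_sq_le {α : Type*} [MeasurableSpace α] {μ : Measure α} {k F : α → ℝ≥0∞}
    (hk : AEMeasurable k μ) (hF : AEMeasurable F μ) :
    (∫⁻ s, k s * F s ∂μ) ^ 2 ≤ (∫⁻ s, k s ∂μ) * ∫⁻ s, k s * F s ^ 2 ∂μ := by
  have h := ENNReal.lintegral_mul_le_Lp_mul_Lq μ Real.HolderConjugate.two_two
    (hk.pow_const (1 / 2 : ℝ)) ((hk.pow_const (1 / 2 : ℝ)).mul hF)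
  have e1 : ∀ x : ℝ≥0∞, x ^ (1 / 2 : ℝ) * x ^ (1 / 2 : ℝ) = x := fun x => by
    rw [← ENNReal.rpow_add_of_nonneg _ _ (by norm_num) (by norm_num)]
    norm_num
  have e2 : ∀ x : ℝ≥0∞, (x ^ (1 / 2 : ℝ)) ^ (2 : ℝ) = x := fun x => by
    rw [← ENNReal.rpow_mul]
    norm_num
  have e3 : ∀ x : ℝ≥0∞, (x ^ (1 / 2 : ℝ)) ^ 2 = x := fun x => by rw [sq, e1]
  simp only [Pi.mul_apply, ← mul_assoc, e1, ENNReal.mul_rpow_of_nonneg _ _ (zero_le_two (α := ℝ)),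
    e2] at h
  have h2 := pow_le_pow_left₀ (zero_le (a := ∫⁻ s, k s * F s ∂μ)) h 2
  rw [mul_pow, e3, e3] at h2
  simpa only [ENNReal.rpow_ofNat] using h2

/-- The weighted Cauchy–Schwarz inequality followed by Tonelli; symmetry of the kernel lets one
bound serve for both rows and columns. -/
theorem lintegral_schur {α : Type*} [MeasurableSpace α] {μ : Measure α} [SFinite μ]
    {k : α → α → ℝ≥0∞} (hk : Measurable (Function.uncurry k)) (hsymm : ∀ s t, k s t = k t s)
    {A : ℝ≥0∞} (hA : ∀ t, ∫⁻ s, k t s ∂μ ≤ A) {F : α → ℝ≥0∞} (hF : AEMeasurable F μ) :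
    ∫⁻ t, (∫⁻ s, k t s * F s ∂μ) ^ 2 ∂μ ≤ A ^ 2 * ∫⁻ s, F s ^ 2 ∂μ := by
  have hk' : ∀ t, Measurable (k t) := fun t => hk.comp measurable_prodMk_left
  calc ∫⁻ t, (∫⁻ s, k t s * F s ∂μ) ^ 2 ∂μ
      ≤ ∫⁻ t, A * ∫⁻ s, k t s * F s ^ 2 ∂μ ∂μ := by
        refine lintegral_mono fun t => (lintegral_mul_sq_le (hk' t).aemeasurable hF).trans ?_
        gcongr
        exact hA t
    _ = A * ∫⁻ t, ∫⁻ s, k t s * F s ^ 2 ∂μ ∂μ := by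
        refine lintegral_const_mul'' _ ?_
        exact (hk.aemeasurable.mul (hF.pow_const 2).comp_snd).lintegral_prod_right'
    _ = A * ∫⁻ s, ∫⁻ t, k t s * F s ^ 2 ∂μ ∂μ := by
        rw [lintegral_lintegral_swap]
        exact hk.aemeasurable.mul (hF.pow_const 2).comp_snd
    _ ≤ A * ∫⁻ s, A * F s ^ 2 ∂μ := by
        gcongr with s
        rw [lintegral_mul_const _ (show Measurable fun t => k t s from hk.comp measurable_prodMk_right)]
        gcongr
        simpa only [hsymm s] using hA s
    _ = A ^ 2 * ∫⁻ s, F s ^ 2 ∂μ := by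
        rw [lintegral_const_mul'' _ (hF.pow_const 2), ← mul_assoc, sq]

/-! ### Arc length -/

namespace SimpleCurve

variable {Γ : SimpleCurve} {q : ℝ → ℂ} {a b : ℝ}

/-- The signed arc length from the point with parameter `0`. -/
noncomputable def len (Γ : SimpleCurve) (t : ℝ) : ℝ := ∫ s in (0 : ℝ)..t, ‖deriv Γ.γ s‖

theorem hasDerivAt_len (Γ : SimpleCurve) (t : ℝ) : HasDerivAt Γ.len ‖deriv Γ.γ t‖ t :=
  Γ.continuous_deriv.norm.integral_hasStrictDerivAt 0 t |>.hasDerivAt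

theorem continuous_len (Γ : SimpleCurve) : Continuous Γ.len :=
  continuous_iff_continuousAt.2 fun t => (Γ.hasDerivAt_len t).continuousAt

theorem strictMono_len (Γ : SimpleCurve) : StrictMono Γ.len :=
  strictMono_of_deriv_pos fun t => by
    rw [(Γ.hasDerivAt_len t).deriv]
    exact norm_pos_iff.2 (Γ.deriv_ne_zero t)

instance (Γ : SimpleCurve) : SFinite Γ.arcLength := by
  unfold arcLength
  infer_instance

theorem lintegral_arcLength (Γ : SimpleCurve) (F : ℝ → ℝ≥0∞) :
    ∫⁻ t, F t ∂Γ.arcLength = ∫⁻ t, ‖deriv Γ.γ t‖ₑ * F t := by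
  rw [arcLength, lintegral_withDensity_eq_lintegral_mul_non_measurable _
    (measurable_deriv Γ.γ).enorm (ae_of_all _ fun t => enorm_lt_top)]
  rfl

theorem setLIntegral_arcLength (Γ : SimpleCurve) (F : ℝ → ℝ≥0∞) {S : Set ℝ}
    (hS : MeasurableSet S) :
    ∫⁻ t in S, F t ∂Γ.arcLength = ∫⁻ t in S, ‖deriv Γ.γ t‖ₑ * F t := by
  rw [arcLength, setLIntegral_withDensity_eq_setLIntegral_mul_non_measurable _
    (measurable_deriv Γ.γ).enorm _ hS (ae_of_all _ fun t => enorm_lt_top)]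
  rfl

/-- `len` carries arc length to Lebesgue measure on its image. The inequality avoids having to know
that the image is the whole line. -/
theorem lintegral_comp_len_le (Γ : SimpleCurve) (F : ℝ → ℝ≥0∞) :
    ∫⁻ t, F (Γ.len t) ∂Γ.arcLength ≤ ∫⁻ x, F x := by
  have h := lintegral_image_eq_lintegral_abs_deriv_mul MeasurableSet.univ
    (fun x _ => (Γ.hasDerivAt_len x).hasDerivWithinAt) Γ.strictMono_len.injective.injOn F
  rw [setLIntegral_univ] at h
  rw [lintegral_arcLength]
  calc ∫⁻ t, ‖deriv Γ.γ t‖ₑ * F (Γ.len t) = ∫⁻ x in Γ.len '' univ, F x := by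
        rw [h]
        simp only [abs_norm, ofReal_norm]
    _ ≤ ∫⁻ x, F x := setLIntegral_le_lintegral _ _

theorem arcLength_Ioc (Γ : SimpleCurve) {s t : ℝ} (hst : s ≤ t) :
    Γ.arcLength (Ioc s t) = ENNReal.ofReal (Γ.len t - Γ.len s) := by
  rw [arcLength, withDensity_apply _ measurableSet_Ioc]
  have h1 : Γ.len t - Γ.len s = ∫ x in Ioc s t, ‖deriv Γ.γ x‖ := by
    rw [len, len, intervalIntegral.integral_interval_sub_left, intervalIntegral.integral_of_le hst]
    · exact Γ.continuous_deriv.norm.intervalIntegrable _ _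
    · exact Γ.continuous_deriv.norm.intervalIntegrable _ _
  rw [h1, ofReal_integral_eq_lintegral_ofReal]
  · simp only [ofReal_norm]
  · exact (Γ.continuous_deriv.norm.integrableOn_Icc (a := s) (b := t)).mono_set Ioc_subset_Icc_self
  · exact ae_of_all _ fun x => norm_nonneg _

instance (Γ : SimpleCurve) : IsFiniteMeasureOnCompacts Γ.arcLength := by
  constructor
  intro K hK
  obtain ⟨r, hr, hr'⟩ := hK.isBounded.subset_ball_lt 0 0
  refine (measure_mono (hr'.trans ?_)).trans_lt
    ((Γ.arcLength_Ioc (show -r ≤ r by linarith)).trans_lt ENNReal.ofReal_lt_top)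
  rw [Real.ball_eq_Ioo, zero_sub, zero_add]
  exact Ioo_subset_Ioc_self

theorem volume_absolutelyContinuous (Γ : SimpleCurve) : (volume : Measure ℝ) ≪ Γ.arcLength :=
  Measure.ae_le_iff_absolutelyContinuous.1 Γ.ae_arcLength.ge

/-- Square integrability implies local integrability for arc length, whose density `|γ'|` is the
modulus of the extra factor. -/
theorem memLp_locallyIntegrable {f : ℝ → ℂ} (hf : MemLp f 2 Γ.arcLength) :
    LocallyIntegrable (fun t => deriv Γ.γ t * f t) volume := by
  rw [locallyIntegrable_iff]
  intro K hK
  have h1 : Integrable f (Γ.arcLength.restrict K) := by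
    have : IsFiniteMeasure (Γ.arcLength.restrict K) := ⟨by
      rw [Measure.restrict_apply_univ]
      exact hK.measure_lt_top⟩
    exact (hf.restrict K).integrable one_le_two
  rw [arcLength, restrict_withDensity hK.measurableSet,
    integrable_withDensity_iff_integrable_smul' (measurable_deriv Γ.γ).enorm
      (ae_of_all _ fun t => enorm_lt_top)] at h1
  have hfm : AEStronglyMeasurable f volume := by
    exact hf.aestronglyMeasurable.mono_ac Γ.volume_absolutelyContinuous
  refine h1.congr' ?_ (ae_of_all _ fun t => ?_)
  · exact (Γ.continuous_deriv.aestronglyMeasurable.mul hfm).restrict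
  · simp

/-- The curve is straight near its ends, with direction `e^{iθ}`, and unbounded. -/
structure HasStraightEnds (Γ : SimpleCurve) (θ : ℝ) : Prop where
  deriv_eq : ∃ T, ∀ t, T ≤ |t| →
    deriv Γ.γ t = ‖deriv Γ.γ t‖ * Complex.exp (θ * Complex.I)
  top : Tendsto (fun t => ‖Γ.γ t‖) atTop atTop
  bot : Tendsto (fun t => ‖Γ.γ t‖) atBot atTop

namespace HasStraightEnds

variable {θ : ℝ}

/-- The difference has zero derivative near both ends, so it is constant there, and it is bounded on
the compact piece in between by continuity. -/
theorem exists_bound (h : Γ.HasStraightEnds θ) :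
    ∃ D, ∀ t, ‖Γ.γ t - Complex.exp (θ * Complex.I) * Γ.len t‖ ≤ D := by
  obtain ⟨T, hT⟩ := h.deriv_eq
  set d : ℝ → ℂ := fun t => Γ.γ t - Complex.exp (θ * Complex.I) * Γ.len t with hd
  have hp : HasPrim d
      (fun t => deriv Γ.γ t - Complex.exp (θ * Complex.I) * (‖deriv Γ.γ t‖ : ℂ)) := by
    refine HasPrim.of_hasDerivAt (fun t => ?_) ?_
    · exact (Γ.hasDerivAt t).sub ((Γ.hasDerivAt_len t).ofReal_comp.const_mul _)
    · have := Γ.continuous_deriv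
      fun_prop
  obtain ⟨D, hD⟩ := isCompact_Icc.exists_bound_of_continuousOn
    (hp.continuous.continuousOn (s := Icc (-|T|) |T|))
  have hz : ∀ x, |T| ≤ |x| →
      deriv Γ.γ x - Complex.exp (θ * Complex.I) * (‖deriv Γ.γ x‖ : ℂ) = 0 := fun x hx => by
    rw [sub_eq_zero, mul_comm]
    exact hT x ((le_abs_self T).trans hx)
  have hT0 := abs_nonneg T
  refine ⟨D, fun t => ?_⟩
  rcases le_total t (-|T|) with h1 | h1
  · rw [show Γ.γ t - Complex.exp (θ * Complex.I) * Γ.len t = d (-|T|) from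
      hp.eq_of_ae_zero (ae_of_all _ fun x hx => hz x ?_)]
    · exact hD _ ⟨le_rfl, by linarith⟩
    · rw [uIoc_of_ge h1] at hx
      linarith [hx.2, neg_le_abs x]
  · rcases le_total t |T| with h2 | h2
    · exact hD t ⟨h1, h2⟩
    · rw [show Γ.γ t - Complex.exp (θ * Complex.I) * Γ.len t = d |T| from
        hp.eq_of_ae_zero (ae_of_all _ fun x hx => hz x ?_)]
      · exact hD _ ⟨by linarith, le_rfl⟩
      · rw [uIoc_of_le h2] at hx
        exact hx.1.le.trans (le_abs_self x)

theorem tendsto_abs_len (h : Γ.HasStraightEnds θ) {l : Filter ℝ}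
    (hl : Tendsto (fun t => ‖Γ.γ t‖) l atTop) : Tendsto (fun t => |Γ.len t|) l atTop := by
  obtain ⟨D, hD⟩ := h.exists_bound
  refine tendsto_atTop_mono (fun t => ?_) (tendsto_atTop_add_const_right _ (-D) hl)
  have h1 := norm_le_norm_add_norm_sub' (Γ.γ t) (Complex.exp (θ * Complex.I) * Γ.len t)
  rw [norm_mul, Complex.norm_exp_ofReal_mul_I, one_mul, Complex.norm_real, Real.norm_eq_abs] at h1
  linarith [hD t]

theorem len_atTop (h : Γ.HasStraightEnds θ) : Tendsto Γ.len atTop atTop := by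
  refine (h.tendsto_abs_len h.top).congr' ?_
  filter_upwards [eventually_ge_atTop 0] with t ht
  refine abs_of_nonneg ?_
  have := Γ.strictMono_len.monotone ht
  simpa [len] using this

theorem len_atBot (h : Γ.HasStraightEnds θ) : Tendsto Γ.len atBot atBot := by
  refine (tendsto_neg_atTop_atBot.comp (h.tendsto_abs_len h.bot)).congr' ?_
  filter_upwards [eventually_le_atBot 0] with t ht
  have := Γ.strictMono_len.monotone ht
  have h0 : Γ.len t ≤ 0 := by simpa [len] using this
  simp [abs_of_nonpos h0]

theorem arcLength_Ioi (h : Γ.HasStraightEnds θ) (s : ℝ) : Γ.arcLength (Ioi s) = ∞ := by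
  refine ENNReal.eq_top_of_forall_nnreal_le fun r => ?_
  obtain ⟨t, ht, ht'⟩ := ((h.len_atTop.eventually_ge_atTop (Γ.len s + r)).and
    (eventually_ge_atTop s)).exists
  calc (r : ℝ≥0∞) ≤ ENNReal.ofReal (Γ.len t - Γ.len s) := by
        rw [← ENNReal.ofReal_coe_nnreal]
        exact ENNReal.ofReal_le_ofReal (by linarith)
    _ = Γ.arcLength (Ioc s t) := (Γ.arcLength_Ioc ht').symm
    _ ≤ Γ.arcLength (Ioi s) := measure_mono Ioc_subset_Ioi_self

theorem arcLength_Iic (h : Γ.HasStraightEnds θ) (s : ℝ) : Γ.arcLength (Iic s) = ∞ := by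
  refine ENNReal.eq_top_of_forall_nnreal_le fun r => ?_
  obtain ⟨t, ht, ht'⟩ := ((h.len_atBot.eventually_le_atBot (Γ.len s - r)).and
    (eventually_le_atBot s)).exists
  calc (r : ℝ≥0∞) ≤ ENNReal.ofReal (Γ.len s - Γ.len t) := by
        rw [← ENNReal.ofReal_coe_nnreal]
        exact ENNReal.ofReal_le_ofReal (by linarith)
    _ = Γ.arcLength (Ioc t s) := (Γ.arcLength_Ioc ht').symm
    _ ≤ Γ.arcLength (Iic s) := measure_mono Ioc_subset_Iic_self

end HasStraightEnds

/-- The kernel `e^{-κ|ℓ(t) - ℓ(s)|}`. -/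
noncomputable def expKernel (Γ : SimpleCurve) (κ t s : ℝ) : ℝ≥0∞ :=
  ENNReal.ofReal (Real.exp (-(κ * |Γ.len t - Γ.len s|)))

/-- In the arc length variable the integral is at most that of a translate of `e^{-κ|x|}`, which
does not depend on `t`. -/
theorem exists_expKernel_bound (Γ : SimpleCurve) {κ : ℝ} (hκ : 0 < κ) :
    ∃ A : ℝ≥0∞, A ≠ ∞ ∧ ∀ t, ∫⁻ s, Γ.expKernel κ t s ∂Γ.arcLength ≤ A := by
  set F : ℝ → ℝ≥0∞ := fun x => ENNReal.ofReal (Real.exp (-(κ * |x|))) with hF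
  have hint : Integrable (fun x : ℝ => Real.exp (-(κ * |x|))) volume := by
    rw [← integrableOn_univ, ← Iic_union_Ioi (a := (0 : ℝ))]
    refine IntegrableOn.union ?_ ?_
    · refine (integrableOn_exp_mul_Iic hκ 0).congr_fun (fun x hx => ?_) measurableSet_Iic
      simp [abs_of_nonpos (show x ≤ 0 from hx)]
    · refine (integrableOn_exp_mul_Ioi (neg_neg_of_pos hκ) 0).congr_fun (fun x hx => ?_)
        measurableSet_Ioi
      simp [abs_of_nonneg (show 0 ≤ x from (le_of_lt hx))]
  refine ⟨∫⁻ x, F x, ?_, fun t => ?_⟩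
  · exact hint.lintegral_lt_top.ne
  · calc ∫⁻ s, Γ.expKernel κ t s ∂Γ.arcLength = ∫⁻ s, F (Γ.len t - Γ.len s) ∂Γ.arcLength := rfl
      _ ≤ ∫⁻ x, F (Γ.len t - x) := Γ.lintegral_comp_len_le fun x => F (Γ.len t - x)
      _ = ∫⁻ x, F x := lintegral_sub_left_eq_self F (Γ.len t)

theorem measurable_expKernel (Γ : SimpleCurve) (κ : ℝ) :
    Measurable (Function.uncurry (Γ.expKernel κ)) := by
  have := Γ.continuous_len
  unfold expKernel Function.uncurry
  exact Measurable.ennreal_ofReal (by fun_prop)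

theorem expKernel_symm (Γ : SimpleCurve) (κ t s : ℝ) : Γ.expKernel κ t s = Γ.expKernel κ s t := by
  rw [expKernel, expKernel, abs_sub_comm]

end SimpleCurve

/-! ### Exponential bounds for the Jost solutions -/

namespace SimpleCurve

variable {Γ : SimpleCurve} {q : ℝ → ℂ} {a b θ : ℝ}

/-- Because `γ = e^{iθ} ℓ + O(1)`, the real part of `iλγ` is `-Im (λ e^{iθ}) ℓ` up to a bounded
error. This is where the slope of the ends enters. -/
theorem HasStraightEnds.exists_exp_bound (h : Γ.HasStraightEnds θ) (lam : ℂ) :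
    ∃ C, 0 ≤ C ∧ ∀ t, ‖Complex.exp (Complex.I * lam * Γ.γ t)‖ ≤
        C * Real.exp (-((lam * Complex.exp (θ * Complex.I)).im * Γ.len t)) ∧
      ‖Complex.exp (-(Complex.I * lam * Γ.γ t))‖ ≤
        C * Real.exp ((lam * Complex.exp (θ * Complex.I)).im * Γ.len t) := by
  obtain ⟨D, hD⟩ := h.exists_bound
  refine ⟨Real.exp (‖lam‖ * D), (Real.exp_pos _).le, fun t => ?_⟩
  set d := Γ.γ t - Complex.exp (θ * Complex.I) * Γ.len t with hd
  have h1 : |(lam * d).im| ≤ ‖lam‖ * D := by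
    refine (Complex.abs_im_le_norm _).trans ?_
    rw [norm_mul]
    exact mul_le_mul_of_nonneg_left (hD t) (norm_nonneg _)
  have h2 : (Complex.I * lam * Γ.γ t).re =
      -((lam * Complex.exp (θ * Complex.I)).im * Γ.len t) - (lam * d).im := by
    have e : Complex.I * lam * Γ.γ t =
        Complex.I * (lam * Complex.exp (θ * Complex.I) * Γ.len t) + Complex.I * (lam * d) := by
      rw [hd]
      ring
    rw [e, Complex.add_re, Complex.I_mul_re, Complex.I_mul_re, Complex.im_mul_ofReal]
    ring
  rw [Complex.norm_exp, Complex.norm_exp, Complex.neg_re, h2, ← Real.exp_add, ← Real.exp_add]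
  constructor <;> rw [Real.exp_le_exp] <;> linarith [abs_le.1 h1 |>.1, abs_le.1 h1 |>.2]

namespace IsSolution

variable {lam : ℂ} {u v : ℝ → ℂ}

/-- Growth of a solution away from the support of the potential. -/
theorem exists_exterior_bound (h : Γ.IsSolution q lam u v) (hΓ : Γ.HasStraightEnds θ)
    (hlam : lam ≠ 0) (s : ℝ) :
    ∃ C, 0 ≤ C ∧ ∀ t, (∀ᵐ x, x ∈ uIoc s t → q x = 0) →
      ‖u t‖ ≤ C * Real.exp (|(lam * Complex.exp (θ * Complex.I)).im * (Γ.len t - Γ.len s)|) ∧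
      ‖v t‖ ≤ C * Real.exp (|(lam * Complex.exp (θ * Complex.I)).im * (Γ.len t - Γ.len s)|) := by
  obtain ⟨C, hC, hexp⟩ := hΓ.exists_exp_bound lam
  set κ := (lam * Complex.exp (θ * Complex.I)).im
  set N := ‖v s + Complex.I * lam * u s‖ + ‖v s + -(Complex.I * lam) * u s‖ with hN
  have hN0 : 0 ≤ N := by positivity
  have hl : 0 < ‖lam‖ := norm_pos_iff.2 hlam
  refine ⟨N * C ^ 2 * (1 + ‖lam‖⁻¹), by positivity, fun t ht => ?_⟩
  set X := Real.exp (|κ * (Γ.len t - Γ.len s)|) with hX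
  have hX0 : 0 < X := Real.exp_pos _
  have e1 : ‖Complex.exp (Complex.I * lam * (Γ.γ t - Γ.γ s))‖ ≤ C ^ 2 * X := by
    rw [show Complex.I * lam * (Γ.γ t - Γ.γ s) = Complex.I * lam * Γ.γ t +
      -(Complex.I * lam * Γ.γ s) by ring, Complex.exp_add, norm_mul]
    refine (mul_le_mul (hexp t).1 (hexp s).2 (norm_nonneg _) (by positivity)).trans ?_
    rw [mul_mul_mul_comm, ← Real.exp_add, ← sq]
    refine mul_le_mul_of_nonneg_left (Real.exp_le_exp.2 ?_) (by positivity)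
    have := neg_le_abs (κ * (Γ.len t - Γ.len s))
    linarith
  have e2 : ‖Complex.exp (-(Complex.I * lam) * (Γ.γ t - Γ.γ s))‖ ≤ C ^ 2 * X := by
    rw [show -(Complex.I * lam) * (Γ.γ t - Γ.γ s) = -(Complex.I * lam * Γ.γ t) +
      Complex.I * lam * Γ.γ s by ring, Complex.exp_add, norm_mul]
    refine (mul_le_mul (hexp t).2 (hexp s).1 (norm_nonneg _) (by positivity)).trans ?_
    rw [mul_mul_mul_comm, ← Real.exp_add, ← sq]
    refine mul_le_mul_of_nonneg_left (Real.exp_le_exp.2 ?_) (by positivity)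
    have := le_abs_self (κ * (Γ.len t - Γ.len s))
    linarith
  have h1 := h.exterior (k := Complex.I * lam) (by rw [mul_pow, Complex.I_sq]; ring) ht
  have h2 := h.exterior (k := -(Complex.I * lam))
    (by rw [neg_sq, mul_pow, Complex.I_sq]; ring) ht
  have b1 : ‖v t + Complex.I * lam * u t‖ ≤
      ‖v s + Complex.I * lam * u s‖ * (C ^ 2 * X) := by
    rw [h1, norm_mul]
    exact mul_le_mul_of_nonneg_left e1 (norm_nonneg _)
  have b2 : ‖v t + -(Complex.I * lam) * u t‖ ≤
      ‖v s + -(Complex.I * lam) * u s‖ * (C ^ 2 * X) := by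
    rw [h2, norm_mul]
    exact mul_le_mul_of_nonneg_left e2 (norm_nonneg _)
  have hsum : ‖v t + Complex.I * lam * u t‖ + ‖v t + -(Complex.I * lam) * u t‖ ≤
      N * (C ^ 2 * X) := by
    rw [hN, add_mul]
    exact add_le_add b1 b2
  have hB : 0 ≤ N * (C ^ 2 * X) := by positivity
  constructor
  · have e3 : 2 * ‖lam‖ * ‖u t‖ ≤ N * (C ^ 2 * X) := by
      refine le_trans ?_ ((norm_sub_le _ _).trans hsum)
      rw [show v t + Complex.I * lam * u t - (v t + -(Complex.I * lam) * u t) =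
        2 * (Complex.I * lam * u t) by ring]
      simp [mul_assoc]
    have e4 : ‖u t‖ ≤ ‖lam‖⁻¹ * (N * (C ^ 2 * X)) := by
      rw [inv_mul_eq_div, le_div_iff₀ hl]
      nlinarith [norm_nonneg (u t)]
    calc ‖u t‖ ≤ ‖lam‖⁻¹ * (N * (C ^ 2 * X)) := e4
      _ ≤ N * (C ^ 2 * X) + ‖lam‖⁻¹ * (N * (C ^ 2 * X)) := by linarith
      _ = _ := by ring
  · have e3 : 2 * ‖v t‖ ≤ N * (C ^ 2 * X) := by
      refine le_trans ?_ ((norm_add_le _ _).trans hsum)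
      rw [show v t + Complex.I * lam * u t + (v t + -(Complex.I * lam) * u t) =
        2 * v t by ring]
      simp
    have e5 : 0 ≤ ‖lam‖⁻¹ * (N * (C ^ 2 * X)) := by positivity
    calc ‖v t‖ ≤ N * (C ^ 2 * X) + ‖lam‖⁻¹ * (N * (C ^ 2 * X)) := by linarith [norm_nonneg (v t)]
      _ = _ := by ring

end IsSolution

theorem exists_bound_on_Icc (Γ : SimpleCurve) {u : ℝ → ℂ} (hu : Continuous u) (κ a b : ℝ) :
    ∃ C, 0 ≤ C ∧ ∀ t ∈ Icc a b, ‖u t‖ ≤ C * Real.exp (κ * Γ.len t) := by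
  have hc : Continuous fun t => ‖u t‖ * Real.exp (-(κ * Γ.len t)) := by
    have := Γ.continuous_len
    fun_prop
  obtain ⟨C, hC⟩ := isCompact_Icc.exists_bound_of_continuousOn (hc.continuousOn (s := Icc a b))
  refine ⟨|C|, abs_nonneg _, fun t ht => ?_⟩
  have h1 := (hC t ht).trans (le_abs_self C)
  rw [norm_mul, norm_norm, Real.norm_of_nonneg (Real.exp_pos _).le, Real.exp_neg] at h1
  rwa [← div_eq_mul_inv, div_le_iff₀ (Real.exp_pos _)] at h1

namespace Jost

variable (J : Γ.Jost q a b) {lam : ℂ}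

/-- The one weight `e^{-κℓ}` works on the whole curve: to the right `p` is an explicit exponential,
the middle is compact, and to the left any solution grows at most like `e^{κ|ℓ(t) - ℓ(a)|}`, which
there is a multiple of `e^{-κℓ(t)}`. -/
theorem exists_p_bound (hq : IsCompPotential q a b) (hΓ : Γ.HasStraightEnds θ) (hlam : lam ≠ 0)
    (hκ : 0 < (lam * Complex.exp (θ * Complex.I)).im) :
    ∃ C, 0 ≤ C ∧ ∀ t,
      ‖J.p.u lam t‖ ≤ C * Real.exp (-((lam * Complex.exp (θ * Complex.I)).im * Γ.len t)) ∧
      ‖J.p.v lam t‖ ≤ C * Real.exp (-((lam * Complex.exp (θ * Complex.I)).im * Γ.len t)) := by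
  set κ := (lam * Complex.exp (θ * Complex.I)).im
  obtain ⟨C₁, hC₁, h1⟩ := (J.p.sol lam).exists_exterior_bound hΓ hlam a
  obtain ⟨C₂, hC₂, h2⟩ := Γ.exists_bound_on_Icc (J.p.sol lam).1.continuous (-κ) a b
  obtain ⟨C₃, hC₃, h3⟩ := Γ.exists_bound_on_Icc (J.p.sol lam).2.continuous (-κ) a b
  obtain ⟨C₄, hC₄, h4⟩ := hΓ.exists_exp_bound lam
  set C₁' := C₁ * Real.exp (κ * Γ.len a)
  have hC₁' : 0 ≤ C₁' := by positivity
  refine ⟨C₁' + C₂ + C₃ + (1 + ‖lam‖) * C₄, by positivity, fun t => ?_⟩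
  set X := Real.exp (-(κ * Γ.len t)) with hX
  have hX0 : 0 < X := Real.exp_pos _
  have p1 : 0 ≤ C₁' * X := by positivity
  have p2 : 0 ≤ C₂ * X := by positivity
  have p3 : 0 ≤ C₃ * X := by positivity
  have p4 : 0 ≤ C₄ * X := by positivity
  have p5 : 0 ≤ ‖lam‖ * C₄ * X := by positivity
  have e : (C₁' + C₂ + C₃ + (1 + ‖lam‖) * C₄) * X =
      C₁' * X + C₂ * X + C₃ * X + C₄ * X + ‖lam‖ * C₄ * X := by ring
  rw [e]
  rcases le_total t a with ht | ht
  · have hz : ∀ᵐ x, x ∈ uIoc a t → q x = 0 := by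
      filter_upwards [compl_mem_ae_iff.2 (measure_singleton a)] with x hx hmem
      refine hq.zero x fun h => hx ?_
      rw [uIoc_of_ge ht] at hmem
      exact le_antisymm hmem.2 h.1
    have h5 := h1 t hz
    have hlen := Γ.strictMono_len.monotone ht
    have e2 : C₁ * Real.exp |κ * (Γ.len t - Γ.len a)| = C₁' * X := by
      rw [abs_of_nonpos (mul_nonpos_of_nonneg_of_nonpos hκ.le (by linarith)), mul_assoc,
        ← Real.exp_add]
      congr 2
      ring
    rw [e2] at h5
    constructor <;> linarith [h5.1, h5.2]
  · rcases le_total t b with ht' | ht'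
    · have h5 := h2 t ⟨ht, ht'⟩
      have h6 := h3 t ⟨ht, ht'⟩
      rw [neg_mul] at h5 h6
      constructor <;> linarith
    · have h5 := J.p_right hq hlam ht'
      have h6 := (h4 t).1
      rw [h5.1, h5.2, norm_mul, norm_mul, Complex.norm_I, one_mul]
      have h7 := mul_le_mul_of_nonneg_left h6 (norm_nonneg lam)
      constructor <;> linarith

theorem exists_m_bound (hq : IsCompPotential q a b) (hΓ : Γ.HasStraightEnds θ) (hlam : lam ≠ 0)
    (hκ : 0 < (lam * Complex.exp (θ * Complex.I)).im) :
    ∃ C, 0 ≤ C ∧ ∀ t,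
      ‖J.m.u lam t‖ ≤ C * Real.exp ((lam * Complex.exp (θ * Complex.I)).im * Γ.len t) ∧
      ‖J.m.v lam t‖ ≤ C * Real.exp ((lam * Complex.exp (θ * Complex.I)).im * Γ.len t) := by
  set κ := (lam * Complex.exp (θ * Complex.I)).im
  obtain ⟨C₁, hC₁, h1⟩ := (J.m.sol lam).exists_exterior_bound hΓ hlam b
  obtain ⟨C₂, hC₂, h2⟩ := Γ.exists_bound_on_Icc (J.m.sol lam).1.continuous κ a b
  obtain ⟨C₃, hC₃, h3⟩ := Γ.exists_bound_on_Icc (J.m.sol lam).2.continuous κ a b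
  obtain ⟨C₄, hC₄, h4⟩ := hΓ.exists_exp_bound lam
  set C₁' := C₁ * Real.exp (-(κ * Γ.len b))
  have hC₁' : 0 ≤ C₁' := by positivity
  refine ⟨C₁' + C₂ + C₃ + (1 + ‖lam‖) * C₄, by positivity, fun t => ?_⟩
  set X := Real.exp (κ * Γ.len t) with hX
  have hX0 : 0 < X := Real.exp_pos _
  have p1 : 0 ≤ C₁' * X := by positivity
  have p2 : 0 ≤ C₂ * X := by positivity
  have p3 : 0 ≤ C₃ * X := by positivity
  have p4 : 0 ≤ C₄ * X := by positivity
  have p5 : 0 ≤ ‖lam‖ * C₄ * X := by positivity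
  have e : (C₁' + C₂ + C₃ + (1 + ‖lam‖) * C₄) * X =
      C₁' * X + C₂ * X + C₃ * X + C₄ * X + ‖lam‖ * C₄ * X := by ring
  rw [e]
  rcases le_total b t with ht | ht
  · have hz : ∀ᵐ x, x ∈ uIoc b t → q x = 0 := by
      refine ae_of_all _ fun x hmem => hq.zero x fun h => ?_
      rw [uIoc_of_le ht] at hmem
      exact absurd h.2 (not_le.2 hmem.1)
    have h5 := h1 t hz
    have hlen := Γ.strictMono_len.monotone ht
    have e2 : C₁ * Real.exp |κ * (Γ.len t - Γ.len b)| = C₁' * X := by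
      rw [abs_of_nonneg (mul_nonneg hκ.le (by linarith)), mul_assoc, ← Real.exp_add]
      congr 2
      ring
    rw [e2] at h5
    constructor <;> linarith [h5.1, h5.2]
  · rcases le_total a t with ht' | ht'
    · have h5 := h2 t ⟨ht', ht⟩
      have h6 := h3 t ⟨ht', ht⟩
      constructor <;> linarith
    · have h5 := J.m_left hq lam ht'
      have h6 := (h4 t).2
      rw [h5.1, h5.2, norm_mul, norm_neg, norm_mul, Complex.norm_I, one_mul]
      have h7 := mul_le_mul_of_nonneg_left h6 (norm_nonneg lam)
      constructor <;> linarith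

end Jost

/-! ### Weighted integrals of square integrable functions -/

theorem _root_.MeasureTheory.eLpNorm_two_sq_eq_lintegral (f : ℝ → ℂ) (μ : Measure ℝ) :
    eLpNorm f 2 μ ^ 2 = ∫⁻ s, ‖f s‖ₑ ^ 2 ∂μ := by
  have h3 := eLpNorm_nnreal_pow_eq_lintegral (f := f) (μ := μ) (p := 2) two_ne_zero
  simpa using h3

theorem measurable_expKernel_apply (Γ : SimpleCurve) (κ t : ℝ) : Measurable (Γ.expKernel κ t) := by
  have := Γ.continuous_len
  unfold expKernel
  exact Measurable.ennreal_ofReal (by fun_prop)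

/-- Cauchy–Schwarz with the kernel as weight, using that the kernel is at most `1` and has bounded
integral. -/
theorem lintegral_expKernel_mul_lt_top {κ : ℝ} (hκ : 0 < κ) {f : ℝ → ℂ}
    (hf : MemLp f 2 Γ.arcLength) (t : ℝ) :
    ∫⁻ s, Γ.expKernel κ t s * ‖f s‖ₑ ∂Γ.arcLength < ∞ := by
  obtain ⟨A, hA, hA'⟩ := Γ.exists_expKernel_bound hκ
  have h1 := lintegral_mul_sq_le (Γ.measurable_expKernel_apply κ t).aemeasurable hf.aestronglyMeasurable.enorm
  have h2 : ∫⁻ s, Γ.expKernel κ t s * ‖f s‖ₑ ^ 2 ∂Γ.arcLength ≤ eLpNorm f 2 Γ.arcLength ^ 2 := by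
    rw [eLpNorm_two_sq_eq_lintegral]
    refine lintegral_mono fun s => ?_
    refine mul_le_of_le_one_left zero_le ?_
    rw [expKernel, ENNReal.ofReal_le_one, Real.exp_le_one_iff]
    have : 0 ≤ κ * |Γ.len t - Γ.len s| := by positivity
    linarith
  have h5 : (∫⁻ s, Γ.expKernel κ t s * ‖f s‖ₑ ∂Γ.arcLength) ^ 2 < ∞ :=
    h1.trans_lt (ENNReal.mul_lt_top ((hA' t).trans_lt hA.lt_top)
      (h2.trans_lt (ENNReal.pow_lt_top hf.2)))
  exact lt_top_iff_ne_top.2 fun h => by rw [h] at h5; simp at h5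

/-- For `s ≤ t` the weight `e^{κℓ(s)}` is exactly `e^{κℓ(t)}` times the exponential kernel. -/
theorem lintegral_Iic_le {κ C : ℝ} (hC : 0 ≤ C) {φ f : ℝ → ℂ}
    (hφ : ∀ s, ‖φ s‖ ≤ C * Real.exp (κ * Γ.len s)) (t : ℝ) :
    ∫⁻ s in Iic t, ‖φ s * (deriv Γ.γ s * f s)‖ₑ ≤ ENNReal.ofReal (C * Real.exp (κ * Γ.len t)) *
      ∫⁻ s in Iic t, Γ.expKernel κ t s * ‖f s‖ₑ ∂Γ.arcLength := by
  rw [setLIntegral_arcLength _ _ measurableSet_Iic, ← lintegral_const_mul' _ _ ENNReal.ofReal_ne_top]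
  refine setLIntegral_mono' measurableSet_Iic fun s hs => ?_
  have h1 : ‖φ s‖ₑ ≤ ENNReal.ofReal (C * Real.exp (κ * Γ.len t)) * Γ.expKernel κ t s := by
    rw [expKernel, ← ENNReal.ofReal_mul (by positivity), ← ofReal_norm]
    refine ENNReal.ofReal_le_ofReal ((hφ s).trans_eq ?_)
    rw [abs_of_nonneg (sub_nonneg.2 (Γ.strictMono_len.monotone hs)), mul_assoc, ← Real.exp_add]
    congr 2
    ring
  rw [enorm_mul, enorm_mul]
  calc ‖φ s‖ₑ * (‖deriv Γ.γ s‖ₑ * ‖f s‖ₑ)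
      ≤ ENNReal.ofReal (C * Real.exp (κ * Γ.len t)) * Γ.expKernel κ t s *
        (‖deriv Γ.γ s‖ₑ * ‖f s‖ₑ) := by gcongr
    _ = _ := by ring

theorem lintegral_Ioi_le {κ C : ℝ} (hC : 0 ≤ C) {φ f : ℝ → ℂ}
    (hφ : ∀ s, ‖φ s‖ ≤ C * Real.exp (-(κ * Γ.len s))) (t : ℝ) :
    ∫⁻ s in Ioi t, ‖φ s * (deriv Γ.γ s * f s)‖ₑ ≤ ENNReal.ofReal (C * Real.exp (-(κ * Γ.len t))) *
      ∫⁻ s in Ioi t, Γ.expKernel κ t s * ‖f s‖ₑ ∂Γ.arcLength := by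
  rw [setLIntegral_arcLength _ _ measurableSet_Ioi, ← lintegral_const_mul' _ _ ENNReal.ofReal_ne_top]
  refine setLIntegral_mono' measurableSet_Ioi fun s hs => ?_
  have h1 : ‖φ s‖ₑ ≤ ENNReal.ofReal (C * Real.exp (-(κ * Γ.len t))) * Γ.expKernel κ t s := by
    rw [expKernel, ← ENNReal.ofReal_mul (by positivity), ← ofReal_norm]
    refine ENNReal.ofReal_le_ofReal ((hφ s).trans_eq ?_)
    rw [abs_of_nonpos (sub_nonpos.2 (Γ.strictMono_len.monotone (le_of_lt hs))), mul_assoc,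
      ← Real.exp_add]
    congr 2
    ring
  rw [enorm_mul, enorm_mul]
  calc ‖φ s‖ₑ * (‖deriv Γ.γ s‖ₑ * ‖f s‖ₑ)
      ≤ ENNReal.ofReal (C * Real.exp (-(κ * Γ.len t))) * Γ.expKernel κ t s *
        (‖deriv Γ.γ s‖ₑ * ‖f s‖ₑ) := by gcongr
    _ = _ := by ring

end SimpleCurve

/-! ### The Green operator -/

namespace SimpleCurve

variable {Γ : SimpleCurve} {q : ℝ → ℂ} {a b θ : ℝ}

/-- `(-∂² + q - λ²) u = f` and `v = ∂ u`. -/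
def IsSolutionOf (Γ : SimpleCurve) (q : ℝ → ℂ) (lam : ℂ) (f u v : ℝ → ℂ) : Prop :=
  HasPrim u (fun t => deriv Γ.γ t * v t) ∧
  HasPrim v (fun t => (deriv Γ.γ t * q t - lam ^ 2 * deriv Γ.γ t) * u t - deriv Γ.γ t * f t)

theorem _root_.HasPrim.of_integral_Iic {g : ℝ → ℂ} (hl : LocallyIntegrable g volume)
    (hg : ∀ t, IntegrableOn g (Iic t) volume) : HasPrim (fun t => ∫ s in Iic t, g s) g :=
  ⟨hl, fun t => by rw [← intervalIntegral.integral_Iic_sub_Iic (hg 0) (hg t)]; ring⟩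

theorem _root_.HasPrim.of_integral_Ioi {g : ℝ → ℂ} (hl : LocallyIntegrable g volume)
    (hg : ∀ t, IntegrableOn g (Ioi t) volume) :
    HasPrim (fun t => ∫ s in Ioi t, g s) (fun t => -g t) :=
  ⟨hl.neg, fun t => by
    rw [intervalIntegral.integral_neg, ← intervalIntegral.integral_Ioi_sub_Ioi' (hg 0) (hg t)]
    ring⟩

/-- The outer factors `α, β` are kept separate from the integrated functions `ψ, φ` so that the
estimate covers both the Green solution and its derivative. The growing and decaying exponentials at
`t` cancel, and the two half-lines add up to the full kernel. -/
theorem enorm_green_le {κ C D : ℝ} (hC : 0 ≤ C) (hD : 0 ≤ D) {α β ψ φ f : ℝ → ℂ} {t : ℝ}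
    (hα : ‖α t‖ ≤ C * Real.exp (-(κ * Γ.len t))) (hβ : ‖β t‖ ≤ D * Real.exp (κ * Γ.len t))
    (hψ : ∀ s, ‖ψ s‖ ≤ C * Real.exp (-(κ * Γ.len s)))
    (hφ : ∀ s, ‖φ s‖ ≤ D * Real.exp (κ * Γ.len s)) :
    ‖α t * (∫ s in Iic t, φ s * (deriv Γ.γ s * f s)) +
        β t * ∫ s in Ioi t, ψ s * (deriv Γ.γ s * f s)‖ₑ ≤
      ENNReal.ofReal (C * D) * ∫⁻ s, Γ.expKernel κ t s * ‖f s‖ₑ ∂Γ.arcLength := by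
  have e1 : ‖α t‖ₑ ≤ ENNReal.ofReal (C * Real.exp (-(κ * Γ.len t))) := by
    rw [← ofReal_norm]; exact ENNReal.ofReal_le_ofReal hα
  have e2 : ‖β t‖ₑ ≤ ENNReal.ofReal (D * Real.exp (κ * Γ.len t)) := by
    rw [← ofReal_norm]; exact ENNReal.ofReal_le_ofReal hβ
  have hexp : Real.exp (-(κ * Γ.len t)) * Real.exp (κ * Γ.len t) = 1 := by
    rw [← Real.exp_add, neg_add_cancel, Real.exp_zero]
  have h1 := (enorm_integral_le_lintegral_enorm _).trans (lintegral_Iic_le (f := f) hD hφ t)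
  have h2 := (enorm_integral_le_lintegral_enorm _).trans (lintegral_Ioi_le (f := f) hC hψ t)
  have m1 := mul_le_mul' e1 h1
  have m2 := mul_le_mul' e2 h2
  rw [← mul_assoc, ← ENNReal.ofReal_mul (by positivity)] at m1 m2
  rw [show C * Real.exp (-(κ * Γ.len t)) * (D * Real.exp (κ * Γ.len t)) = C * D by
    linear_combination C * D * hexp] at m1
  rw [show D * Real.exp (κ * Γ.len t) * (C * Real.exp (-(κ * Γ.len t))) = C * D by
    linear_combination C * D * hexp] at m2
  refine (enorm_add_le _ _).trans ?_
  rw [enorm_mul, enorm_mul]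
  refine (add_le_add m1 m2).trans_eq ?_
  rw [← mul_add, ← compl_Iic, lintegral_add_compl _ measurableSet_Iic]

/-- The exponential kernel is bounded on `L²(Γ)`. -/
theorem exists_eLpNorm_expKernel_bound (Γ : SimpleCurve) {κ : ℝ} (hκ : 0 < κ) :
    ∃ A : ℝ≥0∞, A ≠ ∞ ∧ ∀ (c : ℝ≥0∞) (f g : ℝ → ℂ), AEStronglyMeasurable f Γ.arcLength →
      (∀ t, ‖g t‖ₑ ≤ c * ∫⁻ s, Γ.expKernel κ t s * ‖f s‖ₑ ∂Γ.arcLength) →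
      eLpNorm g 2 Γ.arcLength ≤ c * A * eLpNorm f 2 Γ.arcLength := by
  obtain ⟨A, hA, hA'⟩ := Γ.exists_expKernel_bound hκ
  refine ⟨A, hA, fun c f g hf hg => ?_⟩
  have h1 := lintegral_schur (Γ.measurable_expKernel κ)
    (fun s t => Γ.expKernel_symm κ s t) hA' hf.enorm
  have h2 : eLpNorm g 2 Γ.arcLength ^ 2 ≤ (c * A * eLpNorm f 2 Γ.arcLength) ^ 2 := by
    rw [mul_pow, mul_pow, eLpNorm_two_sq_eq_lintegral, eLpNorm_two_sq_eq_lintegral, mul_assoc]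
    refine le_trans ?_ (mul_le_mul_right h1 (c ^ 2))
    have hm : Measurable fun t => ∫⁻ s, Γ.expKernel κ t s * ‖f s‖ₑ ∂Γ.arcLength := by
      obtain ⟨f', hf', hff'⟩ := hf
      have e : (fun t => ∫⁻ s, Γ.expKernel κ t s * ‖f s‖ₑ ∂Γ.arcLength) =
          fun t => ∫⁻ s, Γ.expKernel κ t s * ‖f' s‖ₑ ∂Γ.arcLength := by
        funext t
        exact lintegral_congr_ae (hff'.mono fun s hs => by simp only [hs])
      rw [e]
      exact Measurable.lintegral_prod_right
        ((Γ.measurable_expKernel κ).mul (hf'.measurable.enorm.comp measurable_snd))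
    rw [← lintegral_const_mul _ (hm.pow_const 2)]
    refine lintegral_mono fun t => ?_
    rw [← mul_pow]
    exact pow_le_pow_left' (hg t) 2
  exact (ENNReal.pow_le_pow_left_iff two_ne_zero).1 h2

theorem expKernel_le_one (Γ : SimpleCurve) {κ : ℝ} (hκ : 0 < κ) (t s : ℝ) :
    Γ.expKernel κ t s ≤ 1 := by
  rw [expKernel, ENNReal.ofReal_le_one, Real.exp_le_one_iff]
  have : 0 ≤ κ * |Γ.len t - Γ.len s| := by positivity
  linarith

namespace Jost

variable (J : Γ.Jost q a b) {lam : ℂ}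

/-- The solution of `(-∂² + q - λ²) u = f` given by the Green kernel. -/
noncomputable def greenU (lam : ℂ) (f : ℝ → ℂ) (t : ℝ) : ℂ :=
  (J.W lam)⁻¹ * (J.p.u lam t * (∫ s in Iic t, J.m.u lam s * (deriv Γ.γ s * f s)) +
    J.m.u lam t * ∫ s in Ioi t, J.p.u lam s * (deriv Γ.γ s * f s))

/-- The derivative of `greenU`. -/
noncomputable def greenV (lam : ℂ) (f : ℝ → ℂ) (t : ℝ) : ℂ :=
  (J.W lam)⁻¹ * (J.p.v lam t * (∫ s in Iic t, J.m.u lam s * (deriv Γ.γ s * f s)) +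
    J.m.v lam t * ∫ s in Ioi t, J.p.u lam s * (deriv Γ.γ s * f s))

theorem locallyIntegrable_mul {u f : ℝ → ℂ} (hu : Continuous u) (hf : MemLp f 2 Γ.arcLength) :
    LocallyIntegrable (fun s => u s * (deriv Γ.γ s * f s)) volume := by
  rw [← locallyIntegrableOn_univ]
  exact ((locallyIntegrableOn_univ.2 (memLp_locallyIntegrable hf)).continuousOn_mul
    hu.continuousOn isOpen_univ.isLocallyClosed)

theorem integrableOn_m (hq : IsCompPotential q a b) (hΓ : Γ.HasStraightEnds θ)
    (hlam : lam ≠ 0) (hκ : 0 < (lam * Complex.exp (θ * Complex.I)).im) {f : ℝ → ℂ}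
    (hf : MemLp f 2 Γ.arcLength) (t : ℝ) :
    IntegrableOn (fun s => J.m.u lam s * (deriv Γ.γ s * f s)) (Iic t) volume := by
  obtain ⟨C, hC, h⟩ := J.exists_m_bound hq hΓ hlam hκ
  refine ⟨(locallyIntegrable_mul (J.m.sol lam).1.continuous hf).aestronglyMeasurable.restrict, ?_⟩
  refine (lintegral_Iic_le hC (fun s => (h s).1) t).trans_lt (ENNReal.mul_lt_top (by simp) ?_)
  exact (lintegral_mono' Measure.restrict_le_self le_rfl).trans_lt
    (lintegral_expKernel_mul_lt_top hκ hf t)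

theorem integrableOn_p (hq : IsCompPotential q a b) (hΓ : Γ.HasStraightEnds θ)
    (hlam : lam ≠ 0) (hκ : 0 < (lam * Complex.exp (θ * Complex.I)).im) {f : ℝ → ℂ}
    (hf : MemLp f 2 Γ.arcLength) (t : ℝ) :
    IntegrableOn (fun s => J.p.u lam s * (deriv Γ.γ s * f s)) (Ioi t) volume := by
  obtain ⟨C, hC, h⟩ := J.exists_p_bound hq hΓ hlam hκ
  refine ⟨(locallyIntegrable_mul (J.p.sol lam).1.continuous hf).aestronglyMeasurable.restrict, ?_⟩
  refine (lintegral_Ioi_le hC (fun s => (h s).1) t).trans_lt (ENNReal.mul_lt_top (by simp) ?_)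
  exact (lintegral_mono' Measure.restrict_le_self le_rfl).trans_lt
    (lintegral_expKernel_mul_lt_top hκ hf t)

/-- Variation of parameters: the moving endpoints contribute nothing to the first derivative, and
contribute the Wronskian times the source to the second, which the prefactor `W⁻¹` normalizes. -/
theorem isSolutionOf_green (hq : IsCompPotential q a b) (hΓ : Γ.HasStraightEnds θ)
    (hlam : lam ≠ 0) (hκ : 0 < (lam * Complex.exp (θ * Complex.I)).im) {f : ℝ → ℂ}
    (hf : MemLp f 2 Γ.arcLength) (hW : J.W lam ≠ 0) :
    Γ.IsSolutionOf q lam f (J.greenU lam f) (J.greenV lam f) := by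
  have hm := HasPrim.of_integral_Iic (locallyIntegrable_mul (J.m.sol lam).1.continuous hf)
    (J.integrableOn_m hq hΓ hlam hκ hf)
  have hp := HasPrim.of_integral_Ioi (locallyIntegrable_mul (J.p.sol lam).1.continuous hf)
    (J.integrableOn_p hq hΓ hlam hκ hf)
  constructor
  · refine ((((J.p.sol lam).1.mul hm).add ((J.m.sol lam).1.mul hp)).const_mul (J.W lam)⁻¹).congr
      (ae_of_all _ fun t => ?_)
    simp only [greenV]
    ring
  · refine ((((J.p.sol lam).2.mul hm).add ((J.m.sol lam).2.mul hp)).const_mul (J.W lam)⁻¹).congr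
      (ae_of_all _ fun t => ?_)
    simp only [greenU]
    have h1 : (J.W lam)⁻¹ * J.W lam = 1 := inv_mul_cancel₀ hW
    linear_combination (deriv Γ.γ t * f t) * (J.W lam)⁻¹ * (-J.W_eq lam t) -
      (deriv Γ.γ t * f t) * h1

theorem exists_green_bound (hq : IsCompPotential q a b) (hΓ : Γ.HasStraightEnds θ)
    (hlam : lam ≠ 0) (hκ : 0 < (lam * Complex.exp (θ * Complex.I)).im) :
    ∃ C : ℝ≥0∞, C ≠ ∞ ∧ ∀ f : ℝ → ℂ, MemLp f 2 Γ.arcLength →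
      eLpNorm (J.greenU lam f) 2 Γ.arcLength ≤ C * eLpNorm f 2 Γ.arcLength ∧
      eLpNorm (J.greenV lam f) 2 Γ.arcLength ≤ C * eLpNorm f 2 Γ.arcLength := by
  obtain ⟨C, hC, hp⟩ := J.exists_p_bound hq hΓ hlam hκ
  obtain ⟨D, hD, hm⟩ := J.exists_m_bound hq hΓ hlam hκ
  obtain ⟨A, hA, hA'⟩ := Γ.exists_eLpNorm_expKernel_bound hκ
  refine ⟨‖(J.W lam)⁻¹‖ₑ * ENNReal.ofReal (C * D) * A,
    ENNReal.mul_ne_top (ENNReal.mul_ne_top (by simp) (by simp)) hA, fun f hf => ⟨?_, ?_⟩⟩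
  · refine hA' _ f _ hf.1 fun t => ?_
    rw [greenU, enorm_mul, mul_assoc]
    exact mul_le_mul_right (enorm_green_le hC hD (hp t).1 (hm t).1 (fun s => (hp s).1)
      (fun s => (hm s).1)) _
  · refine hA' _ f _ hf.1 fun t => ?_
    rw [greenV, enorm_mul, mul_assoc]
    exact mul_le_mul_right (enorm_green_le hC hD (hp t).2 (hm t).2 (fun s => (hp s).1)
      (fun s => (hm s).1)) _

/-- A constant which is bounded by an exponentially decaying weight times a square integrable
function on a set of infinite length vanishes. -/
theorem eq_zero_of_enorm_le {κ : ℝ} (hκ : 0 < κ) {S : Set ℝ} (hS : MeasurableSet S)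
    (hS' : Γ.arcLength S = ∞) {u v : ℝ → ℂ}
    (hu : MemLp u 2 Γ.arcLength) (hv : MemLp v 2 Γ.arcLength) {c : ℝ≥0∞} (hc : c ≠ ∞) {k : ℂ}
    (h : ∀ t ∈ S, ‖k‖ₑ ≤ c * (Γ.expKernel κ 0 t * ‖u t‖ₑ + Γ.expKernel κ 0 t * ‖v t‖ₑ)) :
    k = 0 := by
  by_contra hk
  have h1 : ∫⁻ _ in S, ‖k‖ₑ ∂Γ.arcLength = ∞ := by
    rw [setLIntegral_const, hS', ENNReal.mul_top (by simpa using hk)]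
  have h2 : ∫⁻ _ in S, ‖k‖ₑ ∂Γ.arcLength ≤
      c * ∫⁻ t, (Γ.expKernel κ 0 t * ‖u t‖ₑ + Γ.expKernel κ 0 t * ‖v t‖ₑ) ∂Γ.arcLength := by
    refine (setLIntegral_mono' hS h).trans ?_
    rw [lintegral_const_mul' _ _ hc]
    exact mul_le_mul_right (lintegral_mono' Measure.restrict_le_self le_rfl) _
  have hm : AEMeasurable (fun t => Γ.expKernel κ 0 t * ‖u t‖ₑ) Γ.arcLength :=
    (Γ.measurable_expKernel_apply κ 0).aemeasurable.mul hu.aestronglyMeasurable.enorm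
  rw [lintegral_add_left' hm] at h2
  have h3 := ENNReal.mul_lt_top hc.lt_top (ENNReal.add_lt_top.2
    ⟨lintegral_expKernel_mul_lt_top hκ hu 0, lintegral_expKernel_mul_lt_top hκ hv 0⟩)
  exact absurd (h1 ▸ h2) (not_le.2 h3)

theorem expKernel_zero_of_nonneg (κ : ℝ) {t : ℝ} (ht : 0 ≤ t) :
    ENNReal.ofReal (Real.exp (-(κ * Γ.len t))) =
      ENNReal.ofReal (Real.exp (-(κ * Γ.len 0))) * Γ.expKernel κ 0 t := by
  rw [expKernel, ← ENNReal.ofReal_mul (Real.exp_pos _).le, ← Real.exp_add,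
    abs_of_nonpos (sub_nonpos.2 (Γ.strictMono_len.monotone ht))]
  congr 2
  ring

theorem expKernel_zero_of_nonpos (κ : ℝ) {t : ℝ} (ht : t ≤ 0) :
    ENNReal.ofReal (Real.exp (κ * Γ.len t)) =
      ENNReal.ofReal (Real.exp (κ * Γ.len 0)) * Γ.expKernel κ 0 t := by
  rw [expKernel, ← ENNReal.ofReal_mul (Real.exp_pos _).le, ← Real.exp_add,
    abs_of_nonneg (sub_nonneg.2 (Γ.strictMono_len.monotone ht))]
  congr 2
  ring

/-- The Wronskian of the solution with `p` is a constant, bounded on the right half of the curve by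
`e^{-κℓ} (|u| + |v|)`. That majorant is integrable while the half has infinite length, so the
constant is zero; the same holds for `m` on the left. Since `p` and `m` are independent, the
solution vanishes. -/
theorem solution_eq_zero (hq : IsCompPotential q a b) (hΓ : Γ.HasStraightEnds θ)
    (hlam : lam ≠ 0) (hκ : 0 < (lam * Complex.exp (θ * Complex.I)).im) (hW : J.W lam ≠ 0)
    {u v : ℝ → ℂ} (h : Γ.IsSolution q lam u v) (hu : MemLp u 2 Γ.arcLength)
    (hv : MemLp v 2 Γ.arcLength) : u = 0 ∧ v = 0 := by
  obtain ⟨C, hC, hp⟩ := J.exists_p_bound hq hΓ hlam hκ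
  obtain ⟨D, hD, hm⟩ := J.exists_m_bound hq hΓ hlam hκ
  set κ := (lam * Complex.exp (θ * Complex.I)).im
  have enorm_le : ∀ {z : ℂ} {r : ℝ}, ‖z‖ ≤ r → ‖z‖ₑ ≤ ENNReal.ofReal r := fun hz => by
    rw [← ofReal_norm]; exact ENNReal.ofReal_le_ofReal hz
  have bound : ∀ {α β x y : ℂ} {E : ℝ≥0∞}, ‖α‖ₑ ≤ E → ‖β‖ₑ ≤ E →
      ‖x * β - y * α‖ₑ ≤ E * ‖x‖ₑ + E * ‖y‖ₑ := fun hα hβ => by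
    refine (enorm_sub_le).trans ?_
    rw [enorm_mul, enorm_mul]
    refine add_le_add ?_ ?_
    · rw [mul_comm]
      exact mul_le_mul_left hβ _
    · rw [mul_comm]
      exact mul_le_mul_left hα _
  have h1 : ∀ t, u t * J.p.v lam t - v t * J.p.u lam t = 0 := by
    intro t
    rw [h.wronskian_eq (J.p.sol lam) 0 t]
    refine eq_zero_of_enorm_le hκ measurableSet_Ioi (hΓ.arcLength_Ioi 0) hu hv
      (c := ENNReal.ofReal C * ENNReal.ofReal (Real.exp (-(κ * Γ.len 0))))
      (ENNReal.mul_ne_top (by simp) (by simp)) fun s hs => ?_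
    rw [h.wronskian_eq (J.p.sol lam) s 0]
    refine (bound (enorm_le (hp s).1) (enorm_le (hp s).2)).trans_eq ?_
    rw [ENNReal.ofReal_mul hC, expKernel_zero_of_nonneg κ (le_of_lt hs)]
    ring
  have h2 : ∀ t, u t * J.m.v lam t - v t * J.m.u lam t = 0 := by
    intro t
    rw [h.wronskian_eq (J.m.sol lam) 0 t]
    refine eq_zero_of_enorm_le hκ measurableSet_Iic (hΓ.arcLength_Iic 0) hu hv
      (c := ENNReal.ofReal D * ENNReal.ofReal (Real.exp (κ * Γ.len 0)))
      (ENNReal.mul_ne_top (by simp) (by simp)) fun s hs => ?_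
    rw [h.wronskian_eq (J.m.sol lam) s 0]
    refine (bound (enorm_le (hm s).1) (enorm_le (hm s).2)).trans_eq ?_
    rw [ENNReal.ofReal_mul hD, expKernel_zero_of_nonpos κ hs]
    ring
  constructor <;> funext t <;> refine (mul_eq_zero.1 ?_).resolve_right hW <;>
    rw [← J.W_eq lam t]
  · linear_combination J.p.u lam t * h2 t - J.m.u lam t * h1 t
  · linear_combination J.p.v lam t * h2 t - J.m.v lam t * h1 t

/-- At a zero of the Wronskian the Jost solution is square integrable. -/
theorem memLp_m (hq : IsCompPotential q a b) (hΓ : Γ.HasStraightEnds θ)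
    (hlam : lam ≠ 0) (hκ : 0 < (lam * Complex.exp (θ * Complex.I)).im) (hW : J.W lam = 0) :
    MemLp (J.m.u lam) 2 Γ.arcLength ∧ MemLp (J.m.v lam) 2 Γ.arcLength := by
  obtain ⟨C, hC, hp⟩ := J.exists_p_bound hq hΓ hlam hκ
  obtain ⟨D, hD, hm⟩ := J.exists_m_bound hq hΓ hlam hκ
  obtain ⟨k, hk⟩ := J.exists_p_eq hW
  set κ := (lam * Complex.exp (θ * Complex.I)).im
  have hk0 : k ≠ 0 := fun h0 => Complex.exp_ne_zero (Complex.I * lam * Γ.γ b) <| by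
    rw [← (J.p_right hq hlam le_rfl).1, (hk b).1, h0, zero_mul]
  obtain ⟨A, hA, hA'⟩ := Γ.exists_expKernel_bound hκ
  set E := ‖k‖⁻¹ * C * Real.exp (-(κ * Γ.len 0)) + D * Real.exp (κ * Γ.len 0) with hE
  have key : ∀ g h : ℝ → ℂ, Continuous g → (∀ t, h t = k * g t) →
      (∀ t, ‖h t‖ ≤ C * Real.exp (-(κ * Γ.len t))) → (∀ t, ‖g t‖ ≤ D * Real.exp (κ * Γ.len t)) →
      MemLp g 2 Γ.arcLength := by
    intro g h hg hkg hh hgD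
    have hb : ∀ t, ‖g t‖ₑ ≤ ENNReal.ofReal E * Γ.expKernel κ 0 t := by
      intro t
      rw [← ofReal_norm, expKernel, ← ENNReal.ofReal_mul (by positivity)]
      refine ENNReal.ofReal_le_ofReal ?_
      have n1 : 0 ≤ ‖k‖⁻¹ * C * Real.exp (-(κ * Γ.len 0)) *
        Real.exp (-(κ * |Γ.len 0 - Γ.len t|)) := by positivity
      have n2 : 0 ≤ D * Real.exp (κ * Γ.len 0) *
        Real.exp (-(κ * |Γ.len 0 - Γ.len t|)) := by positivity
      rw [hE, add_mul]
      -- On the right `g = k⁻¹ h` inherits the decay of `p`; on the left it has the decay of `m`.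
      rcases le_total 0 t with ht | ht
      · have e1 : ‖g t‖ = ‖k‖⁻¹ * ‖h t‖ := by
          rw [hkg, norm_mul, inv_mul_cancel_left₀ (norm_ne_zero_iff.2 hk0)]
        have e2 : ‖g t‖ ≤ ‖k‖⁻¹ * C * Real.exp (-(κ * Γ.len 0)) *
            Real.exp (-(κ * |Γ.len 0 - Γ.len t|)) := by
          rw [e1, abs_of_nonpos (sub_nonpos.2 (Γ.strictMono_len.monotone ht)), mul_assoc,
            mul_assoc, ← Real.exp_add]
          refine mul_le_mul_of_nonneg_left ((hh t).trans_eq ?_) (by positivity)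
          congr 2
          ring
        linarith
      · have e2 : ‖g t‖ ≤ D * Real.exp (κ * Γ.len 0) *
            Real.exp (-(κ * |Γ.len 0 - Γ.len t|)) := by
          rw [abs_of_nonneg (sub_nonneg.2 (Γ.strictMono_len.monotone ht)), mul_assoc,
            ← Real.exp_add]
          refine (hgD t).trans_eq ?_
          congr 2
          ring
        linarith
    refine ⟨hg.aestronglyMeasurable, ?_⟩
    have h2 : eLpNorm g 2 Γ.arcLength ^ 2 ≤ ENNReal.ofReal E ^ 2 * A := by
      rw [eLpNorm_two_sq_eq_lintegral]
      calc ∫⁻ t, ‖g t‖ₑ ^ 2 ∂Γ.arcLength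
          ≤ ∫⁻ t, ENNReal.ofReal E ^ 2 * Γ.expKernel κ 0 t ∂Γ.arcLength := by
            refine lintegral_mono fun t => (pow_le_pow_left' (hb t) 2).trans ?_
            rw [mul_pow]
            exact mul_le_mul_right (pow_le_of_le_one zero_le (Γ.expKernel_le_one hκ 0 t)
              two_ne_zero) _
        _ = ENNReal.ofReal E ^ 2 * ∫⁻ t, Γ.expKernel κ 0 t ∂Γ.arcLength :=
            lintegral_const_mul _ (Γ.measurable_expKernel_apply κ 0)
        _ ≤ _ := mul_le_mul_right (hA' 0) _
    by_contra htop
    rw [not_lt, top_le_iff] at htop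
    rw [htop] at h2
    rw [ENNReal.top_pow two_ne_zero] at h2
    exact absurd h2 (not_le.2 (ENNReal.mul_lt_top (ENNReal.pow_lt_top ENNReal.ofReal_lt_top)
      hA.lt_top))
  exact ⟨key _ _ (J.m.sol lam).1.continuous (fun t => (hk t).1) (fun t => (hp t).1)
    (fun t => (hm t).1), key _ _ (J.m.sol lam).2.continuous (fun t => (hk t).2)
    (fun t => (hp t).2) (fun t => (hm t).2)⟩

end Jost

end SimpleCurve

/-! ### The operator `P_{V,Γ} - λ²` -/

namespace SimpleCurve

variable {Γ : SimpleCurve} {V : ℝ → ℂ} {a b θ : ℝ}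

theorem ae_volume_of_ae (Γ : SimpleCurve) {p : ℝ → Prop} (h : ∀ᵐ t ∂Γ.arcLength, p t) :
    ∀ᵐ t, p t := by
  rwa [Γ.ae_arcLength] at h

theorem ae_of_ae_volume (Γ : SimpleCurve) {p : ℝ → Prop} (h : ∀ᵐ t, p t) :
    ∀ᵐ t ∂Γ.arcLength, p t := by
  rwa [Γ.ae_arcLength]

theorem P_sub_apply (hV : MemLp V ∞ volume) (lam : ℂ) (U : Γ.H2) :
    ∀ᵐ t ∂Γ.arcLength, ((Γ.P hV - lam ^ 2 • Γ.incl) U : ℝ → ℂ) t =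
      -(U.1.2.2 : ℝ → ℂ) t + (Γ.restrict V t - lam ^ 2) * (Γ.incl U : ℝ → ℂ) t := by
  have e : (Γ.P hV - lam ^ 2 • Γ.incl) U =
      -U.1.2.2 + Γ.mulPotential hV (Γ.incl U) - lam ^ 2 • Γ.incl U := rfl
  rw [e]
  have h1 : (Γ.mulPotential hV (Γ.incl U) : ℝ → ℂ) =ᵐ[Γ.arcLength]
      fun t => Γ.restrict V t * (Γ.incl U : ℝ → ℂ) t := by
    have h2 := ContinuousLinearMap.coeFn_holder (ContinuousLinearMap.mul ℂ ℂ) (r := 2)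
      ((Γ.memLp_restrict hV).toLp (Γ.restrict V)) (Γ.incl U)
    filter_upwards [h2, (Γ.memLp_restrict hV).coeFn_toLp] with t h3 h4
    rw [← h4]
    exact h3
  filter_upwards [h1, Lp.coeFn_sub (-U.1.2.2 + Γ.mulPotential hV (Γ.incl U)) (lam ^ 2 • Γ.incl U),
    Lp.coeFn_add (-U.1.2.2) (Γ.mulPotential hV (Γ.incl U)), Lp.coeFn_neg U.1.2.2,
    Lp.coeFn_smul (lam ^ 2) (Γ.incl U)] with t h1 h2 h3 h4 h5
  rw [h2, Pi.sub_apply, h3, Pi.add_apply, h4, Pi.neg_apply, h5, h1, Pi.smul_apply, smul_eq_mul]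
  ring

/-- Passing to continuous representatives makes the pointwise Wronskian arguments available for
elements of `H²`. -/
theorem exists_isSolutionOf (hV : MemLp V ∞ volume) (lam : ℂ) (U : Γ.H2) :
    ∃ u v, (Γ.incl U : ℝ → ℂ) =ᵐ[Γ.arcLength] u ∧ (U.1.2.1 : ℝ → ℂ) =ᵐ[Γ.arcLength] v ∧
      Γ.IsSolutionOf (Γ.restrict V) lam ((Γ.P hV - lam ^ 2 • Γ.incl) U) u v := by
  obtain ⟨u, hu, hu'⟩ := U.2.1.exists_hasPrim
  obtain ⟨v, hv, hv'⟩ := U.2.2.exists_hasPrim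
  refine ⟨u, v, Γ.ae_of_ae_volume hu, Γ.ae_of_ae_volume hv, hu'.congr ?_, hv'.congr ?_⟩
  · filter_upwards [hv] with t ht
    rw [ht]
  · filter_upwards [hu, Γ.ae_volume_of_ae (P_sub_apply hV lam U)] with t h1 h2
    have h3 : (Γ.incl U : ℝ → ℂ) t = u t := h1
    rw [h2, h3]
    ring

/-- The second derivative is read off from the equation; it is square integrable because the
potential is bounded. -/
theorem exists_H2 (hV : MemLp V ∞ volume) {lam : ℂ} {f u v : ℝ → ℂ}
    (hf : MemLp f 2 Γ.arcLength) (hu : MemLp u 2 Γ.arcLength) (hv : MemLp v 2 Γ.arcLength)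
    (h : Γ.IsSolutionOf (Γ.restrict V) lam f u v) :
    ∃ U : Γ.H2, Γ.incl U = hu.toLp u ∧ (Γ.P hV - lam ^ 2 • Γ.incl) U = hf.toLp f := by
  have hw : MemLp (fun t => Γ.restrict V t * u t - lam ^ 2 * u t - f t) 2 Γ.arcLength :=
    ((hu.mul (Γ.memLp_restrict hV)).sub (hu.const_mul (lam ^ 2))).sub hf
  have key1 : Γ.HasDerivAlong (hu.toLp u) (hv.toLp v) := by
    refine h.1.hasWeakDeriv.congr (EventuallyEq.symm (Γ.ae_volume_of_ae hu.coeFn_toLp)) ?_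
    filter_upwards [Γ.ae_volume_of_ae hv.coeFn_toLp] with t ht
    rw [ht]
  have key2 : Γ.HasDerivAlong (hv.toLp v) (hw.toLp _) := by
    refine h.2.hasWeakDeriv.congr (EventuallyEq.symm (Γ.ae_volume_of_ae hv.coeFn_toLp)) ?_
    filter_upwards [Γ.ae_volume_of_ae hw.coeFn_toLp] with t ht
    rw [ht]
    ring
  set U : Γ.H2 := ⟨(hu.toLp u, hv.toLp v, hw.toLp _), key1, key2⟩
  have hU : Γ.incl U = hu.toLp u := rfl
  refine ⟨U, hU, Lp.ext ?_⟩
  filter_upwards [P_sub_apply hV lam U, hf.coeFn_toLp, hw.coeFn_toLp, hu.coeFn_toLp]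
    with t h1 h2 h3 h4
  have h5 : (U.1.2.2 : ℝ → ℂ) t = _ := h3
  rw [h1, h2, h5, hU, h4]
  ring

theorem norm_H2_le (U : Γ.H2) {C : ℝ} (h1 : ‖Γ.incl U‖ ≤ C) (h2 : ‖U.1.2.1‖ ≤ C)
    (h3 : ‖U.1.2.2‖ ≤ C) : ‖U‖ ≤ C :=
  max_le h1 (max_le h2 h3)

theorem IsInvertible.neg' {E F : Type*} [NormedAddCommGroup E] [NormedSpace ℂ E]
    [NormedAddCommGroup F] [NormedSpace ℂ F] {A : E →L[ℂ] F} (h : A.IsInvertible) :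
    (-A).IsInvertible := by
  obtain ⟨e, rfl⟩ := h
  exact ⟨e.trans (ContinuousLinearEquiv.neg ℂ), by ext; rfl⟩

/-- The components of the triple are determined by the first, since `γ'` never vanishes. -/
theorem incl_injective (Γ : SimpleCurve) : Function.Injective Γ.incl := by
  rw [injective_iff_map_eq_zero]
  intro U hU
  have aux : ∀ x y : Γ.L2, Γ.HasDerivAlong x y → x = 0 → y = 0 := by
    rintro x y h rfl
    obtain ⟨u, hu, hu'⟩ := h.exists_hasPrim
    have hu0 : u = 0 := by
      refine Continuous.ext_of_ae_eq hu'.continuous continuous_zero ?_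
      filter_upwards [hu, Γ.ae_volume_of_ae (Lp.coeFn_zero ℂ 2 Γ.arcLength)] with t h1 h2
      rw [← h1, h2]
    refine Lp.ext (Γ.ae_of_ae_volume ?_)
    filter_upwards [hu'.ae_hasDerivAt, Γ.ae_volume_of_ae (Lp.coeFn_zero ℂ 2 Γ.arcLength)]
      with t h1 h2
    rw [h2]
    rw [hu0] at h1
    have h3 := h1.unique (hasDerivAt_const t (0 : ℂ))
    exact (mul_eq_zero.1 h3).resolve_left (Γ.deriv_ne_zero t)
  have h1 := aux _ _ U.2.1 hU
  have h2 := aux _ _ U.2.2 h1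
  exact Subtype.ext (Prod.ext hU (Prod.ext h1 h2))

namespace Jost

variable (J : Γ.Jost (Γ.restrict V) a b) {lam : ℂ}

/-- The difference from the Green solution is a square integrable solution of the homogeneous
equation, with square integrable derivative. -/
theorem incl_eq_green (hV : MemLp V ∞ volume) (hq : IsCompPotential (Γ.restrict V) a b)
    (hΓ : Γ.HasStraightEnds θ) (hκ : 0 < (lam * Complex.exp (θ * Complex.I)).im)
    (hW : J.W lam ≠ 0) (U : Γ.H2) :
    Γ.incl U =ᵐ[Γ.arcLength] J.greenU lam ((Γ.P hV - lam ^ 2 • Γ.incl) U) ∧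
    U.1.2.1 =ᵐ[Γ.arcLength] J.greenV lam ((Γ.P hV - lam ^ 2 • Γ.incl) U) := by
  have hlam : lam ≠ 0 := by rintro rfl; simp at hκ
  obtain ⟨u, v, hu, hv, h1, h2⟩ := exists_isSolutionOf hV lam U
  set F := (Γ.P hV - lam ^ 2 • Γ.incl) U
  have hF : MemLp F 2 Γ.arcLength := Lp.memLp F
  obtain ⟨g1, g2⟩ := J.isSolutionOf_green hq hΓ hlam hκ hF hW
  obtain ⟨C, hC, hb⟩ := J.exists_green_bound hq hΓ hlam hκ
  have hU : MemLp (J.greenU lam F) 2 Γ.arcLength :=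
    ⟨g1.continuous.aestronglyMeasurable,
      (hb F hF).1.trans_lt (ENNReal.mul_lt_top hC.lt_top hF.2)⟩
  have hV' : MemLp (J.greenV lam F) 2 Γ.arcLength :=
    ⟨g2.continuous.aestronglyMeasurable,
      (hb F hF).2.trans_lt (ENNReal.mul_lt_top hC.lt_top hF.2)⟩
  have hsol : Γ.IsSolution (Γ.restrict V) lam (fun t => u t - J.greenU lam F t)
      (fun t => v t - J.greenV lam F t) :=
    ⟨(h1.sub g1).congr (ae_of_all _ fun t => by ring),
      (h2.sub g2).congr (ae_of_all _ fun t => by ring)⟩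
  obtain ⟨e1, e2⟩ := J.solution_eq_zero hq hΓ hlam hκ hW hsol
    (((memLp_congr_ae hu).1 (Lp.memLp _)).sub hU) (((memLp_congr_ae hv).1 (Lp.memLp _)).sub hV')
  exact ⟨hu.trans (ae_of_all _ fun t => sub_eq_zero.1 (congrFun e1 t)),
    hv.trans (ae_of_all _ fun t => sub_eq_zero.1 (congrFun e2 t))⟩

/-- The Green bounds control `u` and its first derivative by the right-hand side, and the equation
itself controls the second derivative. An explicit two-sided bound replaces the open mapping
theorem, so completeness of `H²` is not presupposed. -/
theorem isInvertible (hV : MemLp V ∞ volume) (hq : IsCompPotential (Γ.restrict V) a b)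
    (hΓ : Γ.HasStraightEnds θ) (hκ : 0 < (lam * Complex.exp (θ * Complex.I)).im)
    (hW : J.W lam ≠ 0) : (Γ.P hV - lam ^ 2 • Γ.incl).IsInvertible := by
  have hlam : lam ≠ 0 := by rintro rfl; simp at hκ
  set T := Γ.P hV - lam ^ 2 • Γ.incl with hT
  obtain ⟨C, hC, hb⟩ := J.exists_green_bound hq hΓ hlam hκ
  have hbU : ∀ U : Γ.H2, ‖Γ.incl U‖ ≤ C.toReal * ‖T U‖ ∧ ‖U.1.2.1‖ ≤ C.toReal * ‖T U‖ := by
    intro U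
    obtain ⟨e1, e2⟩ := J.incl_eq_green hV hq hΓ hκ hW U
    have h1 := hb _ (Lp.memLp (T U))
    have hfin : C * eLpNorm (T U) 2 Γ.arcLength ≠ ∞ := ENNReal.mul_ne_top hC (Lp.memLp (T U)).2.ne
    rw [Lp.norm_def, Lp.norm_def, Lp.norm_def, ← ENNReal.toReal_mul, eLpNorm_congr_ae e1,
      eLpNorm_congr_ae e2]
    exact ⟨ENNReal.toReal_mono hfin h1.1, ENNReal.toReal_mono hfin h1.2⟩
  set M := Γ.mulPotential hV with hM
  have hw : ∀ U : Γ.H2, ‖U.1.2.2‖ ≤ ((‖M‖ + ‖lam ^ 2‖) * C.toReal + 1) * ‖T U‖ := by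
    intro U
    have e : U.1.2.2 = M (Γ.incl U) - lam ^ 2 • Γ.incl U - T U := by
      have : T U = -U.1.2.2 + M (Γ.incl U) - lam ^ 2 • Γ.incl U := rfl
      rw [this]
      abel
    have h1 := (hbU U).1
    have h2 : ‖M (Γ.incl U)‖ ≤ ‖M‖ * (C.toReal * ‖T U‖) :=
      (M.le_opNorm _).trans (mul_le_mul_of_nonneg_left h1 (norm_nonneg _))
    have h3 : ‖lam ^ 2 • Γ.incl U‖ ≤ ‖lam ^ 2‖ * (C.toReal * ‖T U‖) := by
      rw [norm_smul]
      exact mul_le_mul_of_nonneg_left h1 (norm_nonneg _)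
    rw [e]
    refine (norm_sub_le _ _).trans ((add_le_add_left (norm_sub_le _ _) _).trans ?_)
    linarith
  set D := C.toReal + ((‖M‖ + ‖lam ^ 2‖) * C.toReal + 1)
  have hD : ∀ U : Γ.H2, ‖U‖ ≤ D * ‖T U‖ := by
    intro U
    have p1 : 0 ≤ C.toReal * ‖T U‖ := by positivity
    have p2 : 0 ≤ ((‖M‖ + ‖lam ^ 2‖) * C.toReal + 1) * ‖T U‖ := by positivity
    have e : D * ‖T U‖ = C.toReal * ‖T U‖ + ((‖M‖ + ‖lam ^ 2‖) * C.toReal + 1) * ‖T U‖ :=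
      add_mul _ _ _
    refine norm_H2_le U ?_ ?_ ?_ <;> linarith [(hbU U).1, (hbU U).2, hw U]
  have hinj : Function.Injective T := by
    rw [injective_iff_map_eq_zero]
    intro U hU
    have := hD U
    rw [hU, norm_zero, mul_zero] at this
    exact norm_le_zero_iff.1 this
  have hsurj : Function.Surjective T := by
    intro f
    have hf := Lp.memLp f
    obtain ⟨g1, g2⟩ := J.isSolutionOf_green hq hΓ hlam hκ hf hW
    obtain ⟨U, -, hU⟩ := exists_H2 hV hf
      ⟨g1.continuous.aestronglyMeasurable, (hb f hf).1.trans_lt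
        (ENNReal.mul_lt_top hC.lt_top hf.2)⟩
      ⟨g2.continuous.aestronglyMeasurable, (hb f hf).2.trans_lt
        (ENNReal.mul_lt_top hC.lt_top hf.2)⟩ ⟨g1, g2⟩
    exact ⟨U, hU.trans (Lp.toLp_coeFn f hf)⟩
  let e := LinearEquiv.ofBijective (T : Γ.H2 →ₗ[ℂ] Γ.L2) ⟨hinj, hsurj⟩
  refine ⟨e.toContinuousLinearEquivOfBounds ‖T‖ D (fun U => T.le_opNorm U) (fun f => ?_), ?_⟩
  · have h1 := hD (e.symm f)
    have h2 : T (e.symm f) = f := e.apply_symm_apply f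
    rwa [h2] at h1
  · ext U
    rfl

theorem isEigen (hV : MemLp V ∞ volume) (hq : IsCompPotential (Γ.restrict V) a b)
    (hΓ : Γ.HasStraightEnds θ) (hκ : 0 < (lam * Complex.exp (θ * Complex.I)).im)
    (hW : J.W lam = 0) : Γ.IsEigen hV lam := by
  have hlam : lam ≠ 0 := by rintro rfl; simp at hκ
  obtain ⟨hu, hv⟩ := J.memLp_m hq hΓ hlam hκ hW
  obtain ⟨U, hU, hPU⟩ := exists_H2 (lam := lam) (f := fun _ => 0) hV MemLp.zero hu hv
    ⟨(J.m.sol lam).1, (J.m.sol lam).2.congr (ae_of_all _ fun t => by simp)⟩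
  refine ⟨U, fun h0 => ?_, ?_⟩
  · have h1 : J.m.u lam =ᵐ[volume] 0 := by
      have h2 := hu.coeFn_toLp
      rw [← hU, h0] at h2
      filter_upwards [Γ.ae_volume_of_ae h2,
        Γ.ae_volume_of_ae (Lp.coeFn_zero ℂ 2 Γ.arcLength)] with t h3 h4
      rw [← h3, h4]
    have h3 := Continuous.ext_of_ae_eq (J.m.sol lam).1.continuous continuous_zero h1
    have h4 := congrFun h3 a
    rw [(J.m_left hq lam le_rfl).1] at h4
    exact Complex.exp_ne_zero _ h4
  · have h1 : (Γ.P hV - lam ^ 2 • Γ.incl) U = 0 := hPU.trans (MemLp.toLp_zero _)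
    exact sub_eq_zero.1 h1

theorem isSpectral_iff (hV : MemLp V ∞ volume) (hq : IsCompPotential (Γ.restrict V) a b)
    (hΓ : Γ.HasStraightEnds θ) (hκ : 0 < (lam * Complex.exp (θ * Complex.I)).im) :
    Γ.IsSpectral hV lam ↔ J.W lam = 0 :=
  ⟨fun h => by_contra fun hW => h (J.isInvertible hV hq hΓ hκ hW), fun hW hinv => by
    obtain ⟨U, h1, h2⟩ := J.isEigen hV hq hΓ hκ hW
    obtain ⟨e, he⟩ := hinv
    have h3 : e U = 0 := by
      have : (e : Γ.H2 →L[ℂ] Γ.L2) U = 0 := by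
        rw [he]
        exact sub_eq_zero.2 h2
      exact this
    exact h1 (by rw [e.map_eq_zero_iff.1 h3, map_zero])⟩

theorem isEigen_iff (hV : MemLp V ∞ volume) (hq : IsCompPotential (Γ.restrict V) a b)
    (hΓ : Γ.HasStraightEnds θ) (hκ : 0 < (lam * Complex.exp (θ * Complex.I)).im) :
    Γ.IsEigen hV lam ↔ J.W lam = 0 := by
  refine ⟨fun h => (J.isSpectral_iff hV hq hΓ hκ).1 fun hinv => ?_, J.isEigen hV hq hΓ hκ⟩
  obtain ⟨U, h1, h2⟩ := h
  obtain ⟨e, he⟩ := hinv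
  have h3 : e U = 0 := by
    have : (e : Γ.H2 →L[ℂ] Γ.L2) U = 0 := by
      rw [he]
      exact sub_eq_zero.2 h2
    exact this
  exact h1 (by rw [e.map_eq_zero_iff.1 h3, map_zero])

end Jost

end SimpleCurve

/-! ### Traces of finite rank projections -/

/-- With an orthonormal basis `e_j` of the range, `T = ∑ e_j ⟨T* e_j, ·⟩`. Parseval turns the trace
in any Hilbert basis into `∑ ⟨T* e_j, e_j⟩ = ∑ ⟨e_j, T e_j⟩`, and each term is `1` because `T` fixes
its range. -/
theorem hasFiniteRankTrace_of_isIdempotent {H : Type} [NormedAddCommGroup H]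
    [InnerProductSpace ℂ H] [CompleteSpace H] (T : H →L[ℂ] H) (hT : ∀ x, T (T x) = T x)
    (hfin : FiniteDimensional ℂ T.range) :
    HasFiniteRankTrace T (Module.finrank ℂ T.range : ℂ) := by
  refine ⟨hfin, fun ι b => ?_⟩
  set e := stdOrthonormalBasis ℂ T.range
  have key : ∀ i, inner ℂ (b i) (T (b i)) =
      ∑ j, inner ℂ (ContinuousLinearMap.adjoint T (e j : H)) (b i) * inner ℂ (b i) (e j : H) := by
    intro i
    have h1 : T (b i) = ∑ j, inner ℂ (e j : H) (T (b i)) • (e j : H) := by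
      have h2 := e.sum_repr' ⟨T (b i), LinearMap.mem_range_self _ _⟩
      have h3 := congrArg Subtype.val h2
      rw [Submodule.coe_sum] at h3
      exact h3.symm
    conv_lhs => rw [h1]
    rw [inner_sum]
    refine Finset.sum_congr rfl fun j _ => ?_
    rw [inner_smul_right, ContinuousLinearMap.adjoint_inner_left]
  simp_rw [key]
  have h4 := hasSum_sum (s := Finset.univ) fun j _ =>
    b.hasSum_inner_mul_inner (ContinuousLinearMap.adjoint T (e j : H)) (e j : H)
  have h5 : ∀ j, inner ℂ (ContinuousLinearMap.adjoint T (e j : H)) (e j : H) = 1 := by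
    intro j
    obtain ⟨x, hx⟩ := (e j).2
    have h6 : T (e j : H) = (e j : H) := by
      rw [← hx]
      exact hT x
    rw [ContinuousLinearMap.adjoint_inner_left, h6, inner_self_eq_norm_sq_to_K]
    have : ‖(e j : H)‖ = 1 := e.orthonormal.1 j
    rw [this]
    simp
  simpa [h5] using h4

/-- Applying the power `n - 1 - i` of the shift sends `v i` to the last nonzero vector and kills
everything after it, so the coefficients vanish one by one, starting with the lowest index. -/
theorem linearIndependent_iterate_of_nilpotent {E : Type*} [AddCommGroup E] [Module ℂ E]
    (v : ℕ → E) (D : E →ₗ[ℂ] E) (hD : ∀ k, D (v k) = v (k + 1)) {n : ℕ}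
    (hn : ∀ k, n ≤ k → v k = 0) (hv : ∀ k, k + 1 = n → v k ≠ 0) :
    LinearIndependent ℂ (fun k : Fin n => v k) := by
  have hDi : ∀ i k, (D ^ i) (v k) = v (k + i) := by
    intro i
    induction i with
    | zero => simp
    | succ i ih =>
      intro k
      rw [pow_succ, Module.End.mul_apply, hD, ih, add_assoc, add_comm 1]
  rw [Fintype.linearIndependent_iff]
  intro c hc i
  obtain ⟨i, hi⟩ := i
  induction i using Nat.strong_induction_on with
  | _ i ih =>
    have h1 := congrArg (D ^ (n - 1 - i)) hc
    rw [map_sum, map_zero, Finset.sum_eq_single ⟨i, hi⟩] at h1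
    · rw [map_smul, hDi] at h1
      have h2 : v (i + (n - 1 - i)) ≠ 0 := hv _ (by omega)
      exact (smul_eq_zero.1 h1).resolve_right h2
    · rintro ⟨j, hj⟩ - hji
      rcases lt_or_ge j i with h | h
      · rw [ih j h hj, zero_smul, map_zero]
      · have : i < j := lt_of_le_of_ne h fun h' => hji (by simp [h'])
        rw [map_smul, hDi, hn _ (by simp only; omega), smul_zero]
    · simp

/-! ### Contour integrals -/

theorem ContinuousLinearMap.circleIntegral_comp_comm {E F : Type*} [NormedAddCommGroup E]
    [NormedSpace ℂ E] [CompleteSpace E] [NormedAddCommGroup F] [NormedSpace ℂ F] [CompleteSpace F]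
    (L : E →L[ℂ] F) {f : ℂ → E} {c : ℂ} {R : ℝ} (hf : CircleIntegrable f c R) :
    ∮ ζ in C(c, R), L (f ζ) = L (∮ ζ in C(c, R), f ζ) := by
  rw [circleIntegral, circleIntegral, ← L.intervalIntegral_comp_comm hf.out]
  simp

/-- In the variable `w = ζ²` this is the integral of `(w - z₀²)^k dw`. For `k ≠ -1` there is a
primitive; for `k = -1` Cauchy's formula applies, since `2ζ/(ζ + z₀)` is holomorphic in the disc
with value `1` at the centre. -/
theorem circleIntegral_two_mul_mul_zpow {z₀ : ℂ} {ε : ℝ} (hε : 0 < ε)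
    (hne : ∀ ζ ∈ Metric.closedBall z₀ ε, ζ + z₀ ≠ 0) (k : ℤ) :
    (2 * (Real.pi : ℂ) * Complex.I)⁻¹ * ∮ ζ in C(z₀, ε), 2 * ζ * (ζ ^ 2 - z₀ ^ 2) ^ k =
      if k = -1 then 1 else 0 := by
  have hsph : ∀ ζ ∈ Metric.sphere z₀ ε, ζ ^ 2 - z₀ ^ 2 ≠ 0 := fun ζ hζ => by
    rw [sq_sub_sq]
    refine mul_ne_zero (hne ζ (Metric.sphere_subset_closedBall hζ)) (sub_ne_zero.2 ?_)
    rintro rfl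
    simp at hζ
    exact hε.ne hζ
  split_ifs with hk
  · subst hk
    have h1 : EqOn (fun ζ => 2 * ζ * (ζ ^ 2 - z₀ ^ 2) ^ (-1 : ℤ))
        (fun ζ => (ζ - z₀)⁻¹ • (2 * ζ * (ζ + z₀)⁻¹)) (Metric.sphere z₀ ε) := fun ζ hζ => by
      simp only [zpow_neg_one, smul_eq_mul, sq_sub_sq, mul_inv]
      ring
    have hd : DifferentiableOn ℂ (fun ζ => 2 * ζ * (ζ + z₀)⁻¹) (Metric.closedBall z₀ ε) := by
      refine DifferentiableOn.mul (by fun_prop) (DifferentiableOn.inv (by fun_prop) hne)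
    have h2 := hd.circleIntegral_sub_inv_smul (w := z₀) (Metric.mem_ball_self hε)
    rw [circleIntegral.integral_congr hε.le h1, h2, smul_eq_mul, ← mul_assoc,
      inv_mul_cancel₀ Complex.two_pi_I_ne_zero, one_mul]
    have h3 := hne z₀ (Metric.mem_closedBall_self hε.le)
    rw [← two_mul] at h3 ⊢
    exact mul_inv_cancel₀ h3
  · have hk' : ((k + 1 : ℤ) : ℂ) ≠ 0 := by
      rw [Int.cast_ne_zero]
      omega
    rw [circleIntegral.integral_eq_zero_of_hasDerivWithinAt
      (f := fun ζ => ((k + 1 : ℤ) : ℂ)⁻¹ * (ζ ^ 2 - z₀ ^ 2) ^ (k + 1)) hε.le, mul_zero]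
    intro ζ hζ
    have h1 : HasDerivAt (fun ζ => ζ ^ 2 - z₀ ^ 2) (2 * ζ) ζ := by
      simpa using (hasDerivAt_pow 2 ζ).sub_const (z₀ ^ 2)
    have h2 := ((hasDerivAt_zpow (k + 1) (ζ ^ 2 - z₀ ^ 2) (Or.inl (hsph ζ hζ))).comp ζ h1).const_mul
      (((k + 1 : ℤ) : ℂ)⁻¹)
    refine (h2.congr_deriv ?_).hasDerivWithinAt
    rw [add_sub_cancel_right, mul_assoc, inv_mul_cancel_left₀ hk']
    ring

/-! ### Moments of the inverse of a quadratic pencil -/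

section Pencil

variable {X Y : Type*} [NormedAddCommGroup X] [NormedSpace ℂ X]
  [NormedAddCommGroup Y] [NormedSpace ℂ Y]

/-- `(2πi)⁻¹ ∮ 2ζ (ζ² - z₀²)ᵏ (ζ² A - B)⁻¹ dζ`. -/
noncomputable def pencilMoment (A B : X →L[ℂ] Y) (z₀ : ℂ) (ε : ℝ) (k : ℤ) : Y →L[ℂ] X :=
  (2 * (Real.pi : ℂ) * Complex.I)⁻¹ •
    ∮ ζ in C(z₀, ε), (2 * ζ * (ζ ^ 2 - z₀ ^ 2) ^ k) • (ζ ^ 2 • A - B).inverse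

/-- The pencil `ζ² A - B` is invertible on the circle of centre `z₀` and radius `ε`, and `-z₀` lies
outside. -/
structure IsAdmissibleCircle (A B : X →L[ℂ] Y) (z₀ : ℂ) (ε : ℝ) : Prop where
  pos : 0 < ε
  ne : ∀ ζ ∈ Metric.closedBall z₀ ε, ζ + z₀ ≠ 0
  inv : ∀ ζ ∈ Metric.sphere z₀ ε, (ζ ^ 2 • A - B).IsInvertible

namespace IsAdmissibleCircle

variable {A B : X →L[ℂ] Y} {z₀ : ℂ} {ε : ℝ}

theorem sq_sub_ne_zero (h : IsAdmissibleCircle A B z₀ ε) {ζ : ℂ}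
    (hζ : ζ ∈ Metric.sphere z₀ ε) : ζ ^ 2 - z₀ ^ 2 ≠ 0 := by
  rw [sq_sub_sq]
  refine mul_ne_zero (h.ne ζ (Metric.sphere_subset_closedBall hζ)) (sub_ne_zero.2 ?_)
  rintro rfl
  have := h.pos
  simp at hζ
  linarith

theorem continuousOn_inverse [CompleteSpace X] (h : IsAdmissibleCircle A B z₀ ε) :
    ContinuousOn (fun ζ => (ζ ^ 2 • A - B).inverse) (Metric.sphere z₀ ε) := by
  intro ζ hζ
  have h1 : ContinuousAt ContinuousLinearMap.inverse (ζ ^ 2 • A - B) :=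
    (ContinuousLinearMap.IsInvertible.contDiffAt_map_inverse (n := 0) (𝕜 := ℂ)
      (h.inv ζ hζ)).continuousAt
  have h2 : ContinuousAt (fun ζ : ℂ => ζ ^ 2 • A - B) ζ := by fun_prop
  exact (ContinuousAt.comp (f := fun ζ : ℂ => ζ ^ 2 • A - B) h1 h2).continuousWithinAt

theorem continuousOn_weight (h : IsAdmissibleCircle A B z₀ ε) (k : ℤ) :
    ContinuousOn (fun ζ : ℂ => 2 * ζ * (ζ ^ 2 - z₀ ^ 2) ^ k) (Metric.sphere z₀ ε) :=
  ContinuousOn.mul (by fun_prop)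
    (ContinuousOn.zpow₀ (by fun_prop) k fun ζ hζ => Or.inl (h.sq_sub_ne_zero hζ))

theorem circleIntegrable [CompleteSpace X] (h : IsAdmissibleCircle A B z₀ ε) (k : ℤ) :
    CircleIntegrable (fun ζ => (2 * ζ * (ζ ^ 2 - z₀ ^ 2) ^ k) • (ζ ^ 2 • A - B).inverse) z₀ ε :=
  ((h.continuousOn_weight k).smul h.continuousOn_inverse).circleIntegrable h.pos.le

theorem smul_integral_const (h : IsAdmissibleCircle A B z₀ ε) {Z : Type*} [NormedAddCommGroup Z]
    [NormedSpace ℂ Z] [CompleteSpace Z] (k : ℤ) (z : Z) :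
    (2 * (Real.pi : ℂ) * Complex.I)⁻¹ •
      ∮ ζ in C(z₀, ε), (2 * ζ * (ζ ^ 2 - z₀ ^ 2) ^ k) • z = if k = -1 then z else 0 := by
  rw [circleIntegral.integral_smul_const, smul_smul,
    circleIntegral_two_mul_mul_zpow h.pos h.ne]
  split_ifs <;> simp

variable [CompleteSpace X]

theorem map_pencilMoment (h : IsAdmissibleCircle A B z₀ ε) {Z : Type*} [NormedAddCommGroup Z]
    [NormedSpace ℂ Z] [CompleteSpace Z] (L : (Y →L[ℂ] X) →L[ℂ] Z) (k : ℤ) :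
    L (pencilMoment A B z₀ ε k) = (2 * (Real.pi : ℂ) * Complex.I)⁻¹ •
      ∮ ζ in C(z₀, ε), (2 * ζ * (ζ ^ 2 - z₀ ^ 2) ^ k) • L (ζ ^ 2 • A - B).inverse := by
  rw [pencilMoment, map_smul, ← L.circleIntegral_comp_comm (h.circleIntegrable k)]
  simp only [map_smul]

/-- If `L (ζ² A - B)⁻¹` and `L' (ζ² A - B)⁻¹` differ by a constant after multiplication by
`ζ² - z₀²`, so do consecutive moments. -/
theorem map_pencilMoment_succ (h : IsAdmissibleCircle A B z₀ ε) {Z : Type*} [NormedAddCommGroup Z]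
    [NormedSpace ℂ Z] [CompleteSpace Z] (L L' : (Y →L[ℂ] X) →L[ℂ] Z) (z : Z)
    (hL : ∀ ζ ∈ Metric.sphere z₀ ε, L (ζ ^ 2 • A - B).inverse =
      (ζ ^ 2 - z₀ ^ 2) • L' (ζ ^ 2 • A - B).inverse - z) (k : ℤ) :
    L (pencilMoment A B z₀ ε k) =
      L' (pencilMoment A B z₀ ε (k + 1)) - if k = -1 then z else 0 := by
  rw [h.map_pencilMoment, h.map_pencilMoment, ← h.smul_integral_const k z, ← smul_sub,
    ← circleIntegral.integral_sub]
  · congr 1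
    refine circleIntegral.integral_congr h.pos.le fun ζ hζ => ?_
    rw [hL ζ hζ, smul_sub, smul_smul, zpow_add_one₀ (h.sq_sub_ne_zero hζ), mul_assoc]
  · exact ((h.continuousOn_weight _).smul
      (L'.continuous.comp_continuousOn h.continuousOn_inverse)).circleIntegrable h.pos.le
  · exact ((h.continuousOn_weight _).smul continuousOn_const).circleIntegrable h.pos.le

/-- Writing `B - z₀² A = (ζ² - z₀²) A - (ζ² A - B)` and multiplying by the inverse leaves a
constant, which survives integration only as the residue at `k = -1`. -/
theorem pencilMoment_comp (h : IsAdmissibleCircle A B z₀ ε) (k : ℤ) :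
    pencilMoment A B z₀ ε k ∘L (B - z₀ ^ 2 • A) =
      pencilMoment A B z₀ ε (k + 1) ∘L A - if k = -1 then ContinuousLinearMap.id ℂ X else 0 := by
  refine h.map_pencilMoment_succ ((ContinuousLinearMap.compL ℂ X Y X).flip (B - z₀ ^ 2 • A))
    ((ContinuousLinearMap.compL ℂ X Y X).flip A) _ (fun ζ hζ => ?_) k
  have h1 := (h.inv ζ hζ).inverse_comp_self
  rw [ContinuousLinearMap.flip_apply, ContinuousLinearMap.flip_apply,
    ContinuousLinearMap.compL_apply, ContinuousLinearMap.compL_apply, ← h1,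
    ← ContinuousLinearMap.comp_smul, ← ContinuousLinearMap.comp_sub]
  congr 1
  module

variable [CompleteSpace Y]

theorem comp_pencilMoment (h : IsAdmissibleCircle A B z₀ ε) (k : ℤ) :
    (B - z₀ ^ 2 • A) ∘L pencilMoment A B z₀ ε k =
      A ∘L pencilMoment A B z₀ ε (k + 1) - if k = -1 then ContinuousLinearMap.id ℂ Y else 0 := by
  refine h.map_pencilMoment_succ (ContinuousLinearMap.compL ℂ Y X Y (B - z₀ ^ 2 • A))
    (ContinuousLinearMap.compL ℂ Y X Y A) _ (fun ζ hζ => ?_) k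
  have h1 := (h.inv ζ hζ).self_comp_inverse
  rw [ContinuousLinearMap.compL_apply, ContinuousLinearMap.compL_apply, ← h1,
    ← ContinuousLinearMap.smul_comp, ← ContinuousLinearMap.sub_comp]
  congr 1
  module

/-- If the moments vanish from some order on, then `(ζ² A - B)⁻¹ A` acts on them by a finite
principal part. -/
theorem inverse_comp_pencilMoment (h : IsAdmissibleCircle A B z₀ ε) {n : ℕ}
    (hn : ∀ k : ℕ, n ≤ k → A ∘L pencilMoment A B z₀ ε k = 0) {ζ : ℂ}
    (hζ : ζ ∈ Metric.sphere z₀ ε) (N k : ℕ) (hN : n ≤ k + N) (y : Y) :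
    (ζ ^ 2 • A - B).inverse (A (pencilMoment A B z₀ ε k y)) =
      ∑ i ∈ Finset.range N, (ζ ^ 2 - z₀ ^ 2) ^ (-(i : ℤ) - 1) •
        pencilMoment A B z₀ ε (k + i : ℕ) y := by
  induction N generalizing k with
  | zero =>
    have h1 : A (pencilMoment A B z₀ ε k y) = 0 := DFunLike.congr_fun (hn k hN) y
    rw [h1]
    simp
  | succ N ih =>
    have h1 := DFunLike.congr_fun (h.comp_pencilMoment k) y
    rw [if_neg (by omega), sub_zero] at h1
    have h2 : (B - z₀ ^ 2 • A) (pencilMoment A B z₀ ε k y) =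
      A (pencilMoment A B z₀ ε (k + 1 : ℕ) y) := h1
    have hz := h.sq_sub_ne_zero hζ
    -- The moment recursion expresses `A M_k` through `(ζ² A - B) M_k` and `A M_{k+1}`. Applying the
    -- inverse peels off one term of the principal part and passes to the next moment.
    have h3 : A (pencilMoment A B z₀ ε k y) = (ζ ^ 2 - z₀ ^ 2)⁻¹ •
        ((ζ ^ 2 • A - B) (pencilMoment A B z₀ ε k y) +
          A (pencilMoment A B z₀ ε (k + 1 : ℕ) y)) := by
      rw [← h2, ← add_apply,
        show ζ ^ 2 • A - B + (B - z₀ ^ 2 • A) = (ζ ^ 2 - z₀ ^ 2) • A by module]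
      rw [smul_apply, inv_smul_smul₀ hz]
    rw [h3, map_smul, map_add, ih (k + 1) (by omega), Finset.sum_range_succ',
      (h.inv ζ hζ).inverse_apply_self, smul_add, Finset.smul_sum, add_comm]
    congr 1
    · refine Finset.sum_congr rfl fun i _ => ?_
      rw [smul_smul, show k + 1 + i = k + (i + 1) by ring]
      congr 1
      rw [← zpow_neg_one, ← zpow_add₀ hz]
      congr 1
      push_cast
      ring
    · simp

/-- A single contour suffices: on the range of a moment the resolvent is a finite sum of negative
powers of `ζ² - z₀²`, and integrating against the `j`-th weight selects the term of index `j`. -/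
theorem pencilMoment_comp_pencilMoment (h : IsAdmissibleCircle A B z₀ ε) {n : ℕ}
    (hn : ∀ k : ℕ, n ≤ k → A ∘L pencilMoment A B z₀ ε k = 0) (j k : ℕ) (y : Y) :
    pencilMoment A B z₀ ε j (A (pencilMoment A B z₀ ε k y)) =
      pencilMoment A B z₀ ε (k + j : ℕ) y := by
  have h1 := h.map_pencilMoment
    (ContinuousLinearMap.apply ℂ X (A (pencilMoment A B z₀ ε k y))) j
  rw [ContinuousLinearMap.apply_apply] at h1
  rw [h1]
  have h2 : EqOn (fun ζ : ℂ => (2 * ζ * (ζ ^ 2 - z₀ ^ 2) ^ (j : ℤ)) •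
      (ζ ^ 2 • A - B).inverse (A (pencilMoment A B z₀ ε k y)))
      (fun ζ => ∑ i ∈ Finset.range (n + j + 1), (2 * ζ * (ζ ^ 2 - z₀ ^ 2) ^ ((j : ℤ) - i - 1)) •
        pencilMoment A B z₀ ε (k + i : ℕ) y) (Metric.sphere z₀ ε) := by
    intro ζ hζ
    simp only
    rw [h.inverse_comp_pencilMoment hn hζ (n + j + 1) k (by omega), Finset.smul_sum]
    refine Finset.sum_congr rfl fun i _ => ?_
    rw [smul_smul, mul_assoc, ← zpow_add₀ (h.sq_sub_ne_zero hζ)]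
    congr 3
    ring
  simp only [ContinuousLinearMap.apply_apply]
  rw [circleIntegral.integral_congr h.pos.le h2, circleIntegral.integral_fun_sum, Finset.smul_sum,
    Finset.sum_eq_single j]
  · rw [h.smul_integral_const, if_pos (by ring)]
  · intro i _ hij
    rw [h.smul_integral_const, if_neg]
    omega
  · intro hj
    exact absurd (Finset.mem_range.2 (by omega)) hj
  · intro i _
    exact ((h.continuousOn_weight _).smul continuousOn_const).circleIntegrable h.pos.le

/-- The moment of order `-1`, with sign reversed, is a two-sided parametrix: the recursion at `k =
-1` gives errors built from the moment of order `0`. Injectivity of `A` transfers finite rank from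
`A M_0` to `M_0`. -/
theorem isFredholm (h : IsAdmissibleCircle A B z₀ ε) (hA : Function.Injective A)
    (hfin : FiniteDimensional ℂ (A ∘L pencilMoment A B z₀ ε 0).range) :
    (B - z₀ ^ 2 • A).IsFredholm := by
  have hfin' : FiniteDimensional ℂ (pencilMoment A B z₀ ε 0 : Y →ₗ[ℂ] X).range := by
    have h1 : (A ∘L pencilMoment A B z₀ ε 0).range =
        (pencilMoment A B z₀ ε 0 : Y →ₗ[ℂ] X).range.map (A : X →ₗ[ℂ] Y) :=
      LinearMap.range_comp _ _
    rw [h1] at hfin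
    exact Module.Finite.equiv
      (Submodule.equivMapOfInjective (A : X →ₗ[ℂ] Y) hA _).symm
  have e1 := h.comp_pencilMoment (-1)
  have e2 := h.pencilMoment_comp (-1)
  rw [if_pos rfl, neg_add_cancel] at e1 e2
  refine ContinuousLinearMap.IsFredholm.of_isQuasiInverse (v := -pencilMoment A B z₀ ε (-1))
    ⟨LinearMap.FiniteRangeSetoid.equiv_iff_hasFiniteRange.2 ?_,
      LinearMap.FiniteRangeSetoid.equiv_iff_hasFiniteRange.2 ?_⟩
  · have e3 : (((-pencilMoment A B z₀ ε (-1)) ∘L (B - z₀ ^ 2 • A) -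
        ContinuousLinearMap.id ℂ X : X →L[ℂ] X) : X →ₗ[ℂ] X) =
        -((pencilMoment A B z₀ ε 0 : Y →ₗ[ℂ] X) ∘ₗ (A : X →ₗ[ℂ] Y)) := by
      rw [ContinuousLinearMap.neg_comp, e2]
      ext x
      simp
    have e4 : LinearMap.HasFiniteRange (-((pencilMoment A B z₀ ε 0 : Y →ₗ[ℂ] X) ∘ₗ
        (A : X →ₗ[ℂ] Y))) := by
      rw [LinearMap.HasFiniteRange, LinearMap.range_neg]
      exact Submodule.FG.of_le (Module.Finite.iff_fg.1 hfin') (LinearMap.range_comp_le_range _ _)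
    rw [← e3] at e4
    exact e4
  · have e3 : (((B - z₀ ^ 2 • A) ∘L (-pencilMoment A B z₀ ε (-1)) -
        ContinuousLinearMap.id ℂ Y : Y →L[ℂ] Y) : Y →ₗ[ℂ] Y) =
        -((A ∘L pencilMoment A B z₀ ε 0 : Y →L[ℂ] Y) : Y →ₗ[ℂ] Y) := by
      rw [ContinuousLinearMap.comp_neg, e1]
      ext x
      simp
    have e4 : LinearMap.HasFiniteRange (-((A ∘L pencilMoment A B z₀ ε 0 : Y →L[ℂ] Y) :
        Y →ₗ[ℂ] Y)) := by
      rw [LinearMap.HasFiniteRange, LinearMap.range_neg]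
      exact Module.Finite.iff_fg.1 hfin
    rw [← e3] at e4
    exact e4

end IsAdmissibleCircle

end Pencil

/-! ### Extension by zero, truncation and density in `L²` -/

section L2Tools

variable {μ : Measure ℝ}

/-- Truncation to a measurable set, as an operator on `L²`. -/
noncomputable def truncL2 (μ : Measure ℝ) {S : Set ℝ} (hS : MeasurableSet S) :
    Lp ℂ 2 μ →L[ℂ] Lp ℂ 2 μ :=
  LinearMap.mkContinuous
    { toFun := fun f => ((Lp.memLp f).indicator hS).toLp (S.indicator f)
      map_add' := fun f g => by
        refine Lp.ext ?_
        filter_upwards [((Lp.memLp (f + g)).indicator hS).coeFn_toLp,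
          ((Lp.memLp f).indicator hS).coeFn_toLp, ((Lp.memLp g).indicator hS).coeFn_toLp,
          Lp.coeFn_add (((Lp.memLp f).indicator hS).toLp (S.indicator f))
            (((Lp.memLp g).indicator hS).toLp (S.indicator g)), Lp.coeFn_add f g]
          with t h1 h2 h3 h4 h5
        rw [h1, h4, Pi.add_apply, h2, h3]
        by_cases ht : t ∈ S
        · simp only [indicator_of_mem ht]
          exact h5
        · simp only [indicator_of_notMem ht, add_zero]
      map_smul' := fun c f => by
        refine Lp.ext ?_
        filter_upwards [((Lp.memLp (c • f)).indicator hS).coeFn_toLp,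
          ((Lp.memLp f).indicator hS).coeFn_toLp,
          Lp.coeFn_smul c (((Lp.memLp f).indicator hS).toLp (S.indicator f)),
          Lp.coeFn_smul c f] with t h1 h2 h4 h5
        rw [RingHom.id_apply, h1, h4, Pi.smul_apply, h2]
        by_cases ht : t ∈ S
        · simp only [indicator_of_mem ht]
          exact h5
        · simp only [indicator_of_notMem ht, smul_zero] }
    1 fun f => by
      rw [one_mul]
      change ‖((Lp.memLp f).indicator hS).toLp (S.indicator f)‖ ≤ ‖f‖
      rw [Lp.norm_toLp, Lp.norm_def]
      exact ENNReal.toReal_mono (Lp.memLp f).2.ne (eLpNorm_indicator_le f)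

theorem truncL2_ae {S : Set ℝ} (hS : MeasurableSet S) (f : Lp ℂ 2 μ) :
    truncL2 μ hS f =ᵐ[μ] S.indicator f :=
  ((Lp.memLp f).indicator hS).coeFn_toLp

variable [IsFiniteMeasureOnCompacts μ]

theorem memLp_indicator_Icc {F : ℝ → ℂ} (hF : Continuous F) (A B : ℝ) :
    MemLp ((Icc A B).indicator F) 2 μ := by
  rw [memLp_indicator_iff_restrict measurableSet_Icc]
  obtain ⟨C, hC⟩ := isCompact_Icc.exists_bound_of_continuousOn (hF.continuousOn (s := Icc A B))
  have : IsFiniteMeasure (μ.restrict (Icc A B)) :=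
    ⟨by simpa using isCompact_Icc.measure_lt_top⟩
  exact MemLp.of_bound hF.aestronglyMeasurable C
    ((ae_restrict_iff' measurableSet_Icc).2 (ae_of_all _ hC))

/-- Extension by zero of continuous functions on a compact interval. -/
noncomputable def extendL2 (μ : Measure ℝ) [IsFiniteMeasureOnCompacts μ] {A B : ℝ} (h : A ≤ B) :
    C(Icc A B, ℂ) →L[ℂ] Lp ℂ 2 μ :=
  LinearMap.mkContinuous
    { toFun := fun F => (memLp_indicator_Icc (F.continuous.Icc_extend' (h := h)) A B).toLp
        ((Icc A B).indicator (IccExtend h F))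
      map_add' := fun F G => by
        rw [← MemLp.toLp_add]
        congr 1
        ext t
        by_cases ht : t ∈ Icc A B <;> simp [ht, IccExtend]
      map_smul' := fun c F => by
        rw [RingHom.id_apply, ← MemLp.toLp_const_smul]
        congr 1
        ext t
        by_cases ht : t ∈ Icc A B <;> simp [ht, IccExtend] }
    (μ (Icc A B) ^ (1 / 2 : ℝ)).toReal fun F => by
      change ‖(memLp_indicator_Icc (F.continuous.Icc_extend' (h := h)) A B).toLp _‖ ≤ _
      have hfin : μ (Icc A B) ^ (1 / 2 : ℝ) ≠ ∞ :=
        (ENNReal.rpow_lt_top_of_nonneg (by norm_num) isCompact_Icc.measure_lt_top.ne).ne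
      rw [Lp.norm_toLp, eLpNorm_indicator_eq_eLpNorm_restrict measurableSet_Icc]
      have h1 := eLpNorm_le_of_ae_bound (p := 2) (μ := μ.restrict (Icc A B))
        (f := IccExtend h F) (C := ‖F‖) (ae_of_all _ fun t => F.norm_coe_le_norm _)
      refine (ENNReal.toReal_mono (ENNReal.mul_ne_top (by simpa using hfin) (by simp)) h1).trans ?_
      rw [ENNReal.toReal_mul, ENNReal.toReal_ofReal (norm_nonneg _)]
      simp

theorem extendL2_ae {A B : ℝ} (h : A ≤ B) (F : C(Icc A B, ℂ)) :
    extendL2 μ h F =ᵐ[μ] (Icc A B).indicator (IccExtend h F) :=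
  (memLp_indicator_Icc (F.continuous.Icc_extend' (h := h)) A B).coeFn_toLp

/-- The explicit contour calculations are carried out for compactly supported functions, for which
the pairing with `p` is entire in `λ`; density extends their consequences to `L²`. -/
theorem dense_compactlySupported :
    Dense {f : Lp ℂ 2 μ | ∃ A B, A ≤ B ∧ ∀ᵐ t ∂μ, t ∉ Icc A B → f t = 0} := by
  intro f
  rw [EMetric.mem_closure_iff]
  intro ε hε
  obtain ⟨δ, hδ, hδε⟩ := exists_between hε
  obtain ⟨g, hg, hfg, -, hgm⟩ := (Lp.memLp f).exists_hasCompactSupport_eLpNorm_sub_le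
    (by simp) hδ.ne'
  obtain ⟨R, hR⟩ := hg.isCompact.isBounded.subset_closedBall 0
  refine ⟨hgm.toLp g, ⟨-|R|, |R|, by linarith [abs_nonneg R], ?_⟩, ?_⟩
  · filter_upwards [hgm.coeFn_toLp] with t ht h0
    rw [ht]
    refine image_eq_zero_of_notMem_tsupport fun h1 => h0 ?_
    have h2 := hR h1
    rw [mem_closedBall_zero_iff, Real.norm_eq_abs] at h2
    exact abs_le.1 (h2.trans (le_abs_self R))
  · rw [Lp.edist_def]
    refine lt_of_le_of_lt (le_of_eq (eLpNorm_congr_ae ?_)) (hfg.trans_lt hδε)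
    filter_upwards [hgm.coeFn_toLp] with t ht
    simp [ht]

end L2Tools

/-! ### Taylor expansion of holomorphic families -/

/-- The `n`-th Taylor remainder of `f` at `z₀`, divided by `(z - z₀)ⁿ`. Its value at `z₀` is the
`n`-th Taylor coefficient. -/
noncomputable def taylorRem (f : ℂ → ℂ) (z₀ : ℂ) (n : ℕ) : ℂ → ℂ :=
  (Function.swap dslope z₀)^[n] f

theorem taylorRem_succ (f : ℂ → ℂ) (z₀ : ℂ) (n : ℕ) :
    taylorRem f z₀ (n + 1) = dslope (taylorRem f z₀ n) z₀ :=
  Function.iterate_succ_apply' _ _ _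

theorem eq_sum_taylorRem (f : ℂ → ℂ) (z₀ : ℂ) (n : ℕ) (z : ℂ) :
    f z = ∑ l ∈ Finset.range n, (z - z₀) ^ l * taylorRem f z₀ l z₀ +
      (z - z₀) ^ n * taylorRem f z₀ n z := by
  induction n with
  | zero => simp [taylorRem]
  | succ n ih =>
    have h := sub_smul_dslope (taylorRem f z₀ n) z₀ z
    rw [← taylorRem_succ, smul_eq_mul] at h
    rw [ih, Finset.sum_range_succ, add_assoc]
    congr 1
    linear_combination (-(z - z₀) ^ n) * h

theorem HolFamOn.taylorRem {U : Set ℂ} {F : ℂ → ℝ → ℂ} {z₀ : ℂ} (hU : U ∈ 𝓝 z₀)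
    (h : HolFamOn U F) (n : ℕ) :
    HolFamOn U (fun z t => _root_.taylorRem (fun w => F w t) z₀ n z) := by
  induction n with
  | zero => exact h
  | succ n ih =>
    simp only [taylorRem_succ]
    exact ih.dslope hU

theorem differentiableOn_taylorRem {U : Set ℂ} {f : ℂ → ℂ} {z₀ : ℂ} (hU : U ∈ 𝓝 z₀)
    (h : DifferentiableOn ℂ f U) (n : ℕ) : DifferentiableOn ℂ (taylorRem f z₀ n) U := by
  induction n with
  | zero => exact h
  | succ n ih =>
    rw [taylorRem_succ]
    exact (Complex.differentiableOn_dslope hU).2 ih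

/-! ### The Green operator on compactly supported functions -/

theorem integral_Iic_of_ae_eq_zero {g : ℝ → ℂ} {A B : ℝ} (hg : LocallyIntegrable g volume)
    (h0 : ∀ᵐ t, t ∉ Icc A B → g t = 0) (t : ℝ) :
    ∫ s in Iic t, g s = ∫ s in A..t, g s := by
  have hi : Integrable g volume :=
    (hg.integrableOn_isCompact isCompact_Icc).integrable_of_ae_notMem_eq_zero h0
  have h1 : ∫ s in Iic A, g s = 0 := by
    refine setIntegral_eq_zero_of_ae_eq_zero ?_
    filter_upwards [h0, compl_mem_ae_iff.2 (measure_singleton A)] with s hs hsA hsm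
    exact hs fun h => hsA (le_antisymm hsm h.1)
  rw [← intervalIntegral.integral_Iic_sub_Iic hi.integrableOn hi.integrableOn, h1, sub_zero]

theorem integral_Ioi_of_ae_eq_zero {g : ℝ → ℂ} {A B : ℝ} (hg : LocallyIntegrable g volume)
    (h0 : ∀ᵐ t, t ∉ Icc A B → g t = 0) (t : ℝ) :
    ∫ s in Ioi t, g s = (∫ s in A..B, g s) - ∫ s in A..t, g s := by
  have hi : Integrable g volume :=
    (hg.integrableOn_isCompact isCompact_Icc).integrable_of_ae_notMem_eq_zero h0
  have h1 : ∫ s in Ioi B, g s = 0 := by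
    refine setIntegral_eq_zero_of_ae_eq_zero ?_
    filter_upwards [h0] with s hs hsm
    exact hs fun h => absurd h.2 (not_le.2 hsm)
  have h2 := intervalIntegral.integral_Ioi_sub_Ioi' (a := t) (b := B) hi.integrableOn
    hi.integrableOn
  rw [h1, sub_zero] at h2
  rw [h2, intervalIntegral.integral_interval_sub_left]
  · exact hg.intervalIntegrable' _ _
  · exact hg.intervalIntegrable' _ _

namespace SimpleCurve

namespace Jost

variable {Γ : SimpleCurve} {q : ℝ → ℂ} {a b : ℝ} (J : Γ.Jost q a b)

/-- The part of the Green operator which is entire in `lam`, applied to a function with support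
in `[A, ∞)`. -/
noncomputable def volterraPart (A : ℝ) (f : ℝ → ℂ) (lam : ℂ) (t : ℝ) : ℂ :=
  J.c.u lam t * (∫ y in A..t, J.s.u lam y * (deriv Γ.γ y * f y)) -
    J.s.u lam t * ∫ y in A..t, J.c.u lam y * (deriv Γ.γ y * f y)

/-- The pairing of `p` with a function with support in `[A, B]`. -/
noncomputable def pairing (A B : ℝ) (f : ℝ → ℂ) (lam : ℂ) : ℂ :=
  ∫ y in A..B, J.p.u lam y * (deriv Γ.γ y * f y)

theorem holFam_volterraPart (A : ℝ) {f : ℝ → ℂ}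
    (hf : LocallyIntegrable (fun t => deriv Γ.γ t * f t) volume) :
    HolFamOn univ (J.volterraPart A f) :=
  (J.c.hol_u.mul (J.s.hol_u.integral hf A)).sub (J.s.hol_u.mul (J.c.hol_u.integral hf A))

theorem differentiable_pairing (A B : ℝ) {f : ℝ → ℂ}
    (hf : LocallyIntegrable (fun t => deriv Γ.γ t * f t) volume) :
    Differentiable ℂ (J.pairing A B f) :=
  differentiableOn_univ.1 ((J.p.hol_u.integral hf A).differentiableOn_eval B)

/-- For supported data the integral over `s > t` is the full integral minus the one up to `t`. The
two integrals up to `t` combine by `kernel_eq` into `W` times the Volterra part, leaving the full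
pairing with `p`. -/
theorem greenU_eq {lam : ℂ} (hW : J.W lam ≠ 0) {A B : ℝ} {f : ℝ → ℂ}
    (hf : MemLp f 2 Γ.arcLength) (h0 : ∀ᵐ t, t ∉ Icc A B → f t = 0) (t : ℝ) :
    J.greenU lam f t = J.volterraPart A f lam t +
      (J.W lam)⁻¹ * J.pairing A B f lam * J.m.u lam t := by
  have hz : ∀ u : ℝ → ℂ, ∀ᵐ t, t ∉ Icc A B → u t * (deriv Γ.γ t * f t) = 0 := fun u => by
    filter_upwards [h0] with t ht h
    rw [ht h, mul_zero, mul_zero]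
  have hl : ∀ u : ℝ → ℂ, Continuous u → LocallyIntegrable (fun t => u t * (deriv Γ.γ t * f t))
    volume := fun u hu => locallyIntegrable_mul hu hf
  have hm := (J.m.sol lam).1.continuous
  have hp := (J.p.sol lam).1.continuous
  have hc := (J.c.sol lam).1.continuous
  have hs := (J.s.sol lam).1.continuous
  rw [greenU, integral_Iic_of_ae_eq_zero (hl _ hm) (hz _),
    integral_Ioi_of_ae_eq_zero (hl _ hp) (hz _)]
  have key : J.p.u lam t * (∫ y in A..t, J.m.u lam y * (deriv Γ.γ y * f y)) -
      J.m.u lam t * (∫ y in A..t, J.p.u lam y * (deriv Γ.γ y * f y)) =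
      J.W lam * J.volterraPart A f lam t := by
    rw [volterraPart, ← intervalIntegral.integral_const_mul, ← intervalIntegral.integral_const_mul,
      ← intervalIntegral.integral_const_mul, ← intervalIntegral.integral_const_mul,
      ← intervalIntegral.integral_sub, ← intervalIntegral.integral_sub,
      ← intervalIntegral.integral_const_mul]
    · refine intervalIntegral.integral_congr fun y _ => ?_
      linear_combination (deriv Γ.γ y * f y) * J.kernel_eq lam t y
    all_goals exact ((hl _ (by assumption)).intervalIntegrable' _ _).const_mul _
  have hW' : (J.W lam)⁻¹ * J.W lam = 1 := inv_mul_cancel₀ hW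
  rw [pairing]
  linear_combination (J.W lam)⁻¹ * key + J.volterraPart A f lam t * hW'

end Jost

end SimpleCurve

/-! ### The Riesz projection -/

namespace SimpleCurve

variable {Γ : SimpleCurve} {V : ℝ → ℂ} {a b θ : ℝ}

/-- Data describing a neighbourhood of a zero (of order `n`, possibly `0`) of the Wronskian. -/
structure Jost.IsZeroData {q : ℝ → ℂ} (J : Γ.Jost q a b) (θ : ℝ) (lam₀ : ℂ) (n : ℕ) (g : ℂ → ℂ)
    (ε : ℝ) : Prop where
  pos : 0 < ε
  diff : Differentiable ℂ g
  eq : ∀ ζ, J.W ζ = (ζ - lam₀) ^ n * g ζ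
  ne : ∀ ζ ∈ Metric.closedBall lam₀ ε, g ζ ≠ 0
  sector : ∀ ζ ∈ Metric.closedBall lam₀ ε, 0 < (ζ * Complex.exp (θ * Complex.I)).im

namespace Jost

namespace IsZeroData

section General

variable {q : ℝ → ℂ} {J : Γ.Jost q a b} {lam₀ : ℂ} {n : ℕ} {g : ℂ → ℂ} {ε : ℝ}

theorem W_ne_zero (h : J.IsZeroData θ lam₀ n g ε) {ζ : ℂ} (hζ : ζ ∈ Metric.closedBall lam₀ ε)
    (hne : ζ ≠ lam₀) : J.W ζ ≠ 0 := by
  rw [h.eq]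
  exact mul_ne_zero (pow_ne_zero _ (sub_ne_zero.2 hne)) (h.ne ζ hζ)

theorem sphere_ne (h : J.IsZeroData θ lam₀ n g ε) {ζ : ℂ} (hζ : ζ ∈ Metric.sphere lam₀ ε) :
    ζ ≠ lam₀ := by
  rintro rfl
  have := h.pos
  simp at hζ
  linarith

/-- Both points lie in an open half plane through the origin, which is closed under addition. Hence
`ζ² - λ₀²` vanishes in the disc only at the centre. -/
theorem add_ne_zero (h : J.IsZeroData θ lam₀ n g ε) {ζ : ℂ}
    (hζ : ζ ∈ Metric.closedBall lam₀ ε) : ζ + lam₀ ≠ 0 := by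
  intro h0
  have h1 := h.sector ζ hζ
  have h2 := h.sector lam₀ (Metric.mem_closedBall_self h.pos.le)
  have h3 := congrArg (fun z : ℂ => (z * Complex.exp (θ * Complex.I)).im) h0
  simp only [add_mul, Complex.add_im, zero_mul, Complex.zero_im] at h3
  linarith

theorem center_ne_zero (h : J.IsZeroData θ lam₀ n g ε) : lam₀ ≠ 0 := by
  rintro rfl
  have := h.sector 0 (Metric.mem_closedBall_self h.pos.le)
  simp at this

theorem mono (h : J.IsZeroData θ lam₀ n g ε) {ε' : ℝ} (h0 : 0 < ε') (hle : ε' ≤ ε) :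
    J.IsZeroData θ lam₀ n g ε' :=
  ⟨h0, h.diff, h.eq, fun ζ hζ => h.ne ζ (Metric.closedBall_subset_closedBall hle hζ),
    fun ζ hζ => h.sector ζ (Metric.closedBall_subset_closedBall hle hζ)⟩

/-- The coefficients of the principal part. -/
noncomputable def coef (J : Γ.Jost q a b) (lam₀ : ℂ) (ε : ℝ) (A B : ℝ) (f : ℝ → ℂ) (k l : ℕ) : ℂ :=
  -((2 * (Real.pi : ℂ) * Complex.I)⁻¹ * ∮ ζ in C(lam₀, ε),
    2 * ζ * (ζ ^ 2 - lam₀ ^ 2) ^ k * ((ζ - lam₀) ^ l * ((J.W ζ)⁻¹ * J.pairing A B f ζ)))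

variable {A B : ℝ} {f : ℝ → ℂ}

theorem differentiableOn_inv (h : J.IsZeroData θ lam₀ n g ε) :
    DifferentiableOn ℂ (fun ζ => (g ζ)⁻¹) (Metric.closedBall lam₀ ε) :=
  h.diff.differentiableOn.inv h.ne

/-- The factor `(ζ - λ₀)^{k + l}` cancels the zero of `W`, so the integrand is holomorphic in the
disc. -/
theorem coef_eq_zero (h : J.IsZeroData θ lam₀ n g ε)
    (hf : LocallyIntegrable (fun t => deriv Γ.γ t * f t) volume) {k l : ℕ} (hkl : n ≤ k + l) :
    coef J lam₀ ε A B f k l = 0 := by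
  have h1 : EqOn (fun ζ => 2 * ζ * (ζ ^ 2 - lam₀ ^ 2) ^ k *
      ((ζ - lam₀) ^ l * ((J.W ζ)⁻¹ * J.pairing A B f ζ)))
      (fun ζ => 2 * ζ * (ζ + lam₀) ^ k * ((ζ - lam₀) ^ (k + l - n) *
        ((g ζ)⁻¹ * J.pairing A B f ζ))) (Metric.sphere lam₀ ε) := by
    intro ζ hζ
    have h2 : ζ - lam₀ ≠ 0 := sub_ne_zero.2 (h.sphere_ne hζ)
    have h3 := h.ne ζ (Metric.sphere_subset_closedBall hζ)
    have h4 : (ζ - lam₀) ^ k * (ζ - lam₀) ^ l = (ζ - lam₀) ^ (k + l - n) * (ζ - lam₀) ^ n := by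
      rw [← pow_add, ← pow_add, Nat.sub_add_cancel hkl]
    simp only
    rw [h.eq, sq_sub_sq, mul_pow, mul_inv]
    field_simp
    linear_combination (ζ * J.pairing A B f ζ * (ζ + lam₀) ^ k) * h4
  have hd : DifferentiableOn ℂ (fun ζ => 2 * ζ * (ζ + lam₀) ^ k * ((ζ - lam₀) ^ (k + l - n) *
      ((g ζ)⁻¹ * J.pairing A B f ζ))) (Metric.closedBall lam₀ ε) := by
    refine DifferentiableOn.mul (by fun_prop) (DifferentiableOn.mul (by fun_prop)
      (h.differentiableOn_inv.mul (J.differentiable_pairing A B hf).differentiableOn))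
  rw [coef, circleIntegral.integral_congr h.pos.le h1,
    hd.diffContOnCl_ball (U := Metric.closedBall lam₀ ε) subset_rfl |>.circleIntegral_eq_zero
      h.pos.le, mul_zero, neg_zero]

/-- Here exactly one power of `ζ - λ₀` remains in the denominator, and Cauchy's formula gives the
value. -/
theorem coef_eq (h : J.IsZeroData θ lam₀ n g ε)
    (hf : LocallyIntegrable (fun t => deriv Γ.γ t * f t) volume) {k : ℕ} (hk : k + 1 = n) :
    coef J lam₀ ε A B f k 0 =
      -(2 * lam₀ * (lam₀ + lam₀) ^ k * ((g lam₀)⁻¹ * J.pairing A B f lam₀)) := by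
  have h1 : EqOn (fun ζ => 2 * ζ * (ζ ^ 2 - lam₀ ^ 2) ^ k *
      ((ζ - lam₀) ^ 0 * ((J.W ζ)⁻¹ * J.pairing A B f ζ)))
      (fun ζ => (ζ - lam₀)⁻¹ • (2 * ζ * (ζ + lam₀) ^ k *
        ((g ζ)⁻¹ * J.pairing A B f ζ))) (Metric.sphere lam₀ ε) := by
    intro ζ hζ
    have h2 : ζ - lam₀ ≠ 0 := sub_ne_zero.2 (h.sphere_ne hζ)
    have h3 := h.ne ζ (Metric.sphere_subset_closedBall hζ)
    simp only [smul_eq_mul]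
    rw [h.eq, ← hk, sq_sub_sq, mul_pow, mul_inv, pow_succ]
    field_simp
  have hd : DifferentiableOn ℂ (fun ζ => 2 * ζ * (ζ + lam₀) ^ k *
      ((g ζ)⁻¹ * J.pairing A B f ζ)) (Metric.closedBall lam₀ ε) :=
    DifferentiableOn.mul (by fun_prop)
      (h.differentiableOn_inv.mul (J.differentiable_pairing A B hf).differentiableOn)
  rw [coef, circleIntegral.integral_congr h.pos.le h1,
    hd.circleIntegral_sub_inv_smul (Metric.mem_ball_self h.pos), smul_eq_mul,
    inv_mul_cancel_left₀ Complex.two_pi_I_ne_zero]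

/-- The contour integral of the Green operator applied to a compactly supported function. -/
theorem integral_green (h : J.IsZeroData θ lam₀ n g ε)
    (hf : LocallyIntegrable (fun t => deriv Γ.γ t * f t) volume) (k : ℕ) (t : ℝ) :
    (2 * (Real.pi : ℂ) * Complex.I)⁻¹ * ∮ ζ in C(lam₀, ε), 2 * ζ * (ζ ^ 2 - lam₀ ^ 2) ^ k *
      (-(J.volterraPart A f ζ t + (J.W ζ)⁻¹ * J.pairing A B f ζ * J.m.u ζ t)) =
      ∑ l ∈ Finset.range n, coef J lam₀ ε A B f k l *
        taylorRem (fun ζ => J.m.u ζ t) lam₀ l lam₀ := by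
  set β : ℕ → ℂ := fun l => taylorRem (fun ζ => J.m.u ζ t) lam₀ l lam₀ with hβ
  set X : ℂ → ℂ := fun ζ => 2 * ζ * (ζ ^ 2 - lam₀ ^ 2) ^ k * (J.volterraPart A f ζ t +
    (g ζ)⁻¹ * J.pairing A B f ζ * taylorRem (fun ζ => J.m.u ζ t) lam₀ n ζ) with hX
  set Y : ℕ → ℂ → ℂ := fun l ζ => 2 * ζ * (ζ ^ 2 - lam₀ ^ 2) ^ k *
    ((ζ - lam₀) ^ l * ((J.W ζ)⁻¹ * J.pairing A B f ζ)) with hY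
  have hm : Differentiable ℂ fun ζ => J.m.u ζ t :=
    differentiableOn_univ.1 (J.m.hol_u.differentiableOn_eval t)
  have hr : Differentiable ℂ (taylorRem (fun ζ => J.m.u ζ t) lam₀ n) :=
    differentiableOn_univ.1 (differentiableOn_taylorRem univ_mem hm.differentiableOn n)
  have hv : Differentiable ℂ fun ζ => J.volterraPart A f ζ t :=
    differentiableOn_univ.1 ((J.holFam_volterraPart A hf).differentiableOn_eval t)
  have hpair := J.differentiable_pairing A B hf
  have hXd : DifferentiableOn ℂ X (Metric.closedBall lam₀ ε) :=
    DifferentiableOn.mul (by fun_prop) (hv.differentiableOn.add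
      ((h.differentiableOn_inv.mul hpair.differentiableOn).mul hr.differentiableOn))
  have hYc : ∀ l, ContinuousOn (Y l) (Metric.sphere lam₀ ε) := fun l => by
    refine ContinuousOn.mul (by fun_prop) (ContinuousOn.mul (by fun_prop) (ContinuousOn.mul
      (J.differentiable_W.continuous.continuousOn.inv₀ fun ζ hζ => ?_)
      hpair.continuous.continuousOn))
    exact h.W_ne_zero (Metric.sphere_subset_closedBall hζ) (h.sphere_ne hζ)
  have hYc' : ∀ l, ContinuousOn (fun ζ => (-β l) • Y l ζ) (Metric.sphere lam₀ ε) :=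
    fun l => (hYc l).const_smul (-β l)
  -- Expanding `m` to order `n`, the remainder carries a factor `(ζ - λ₀)^n` that cancels the zero
  -- of `W`. It joins the Volterra part in the holomorphic term `X`, which integrates to zero.
  have h1 : EqOn (fun ζ => 2 * ζ * (ζ ^ 2 - lam₀ ^ 2) ^ k *
      (-(J.volterraPart A f ζ t + (J.W ζ)⁻¹ * J.pairing A B f ζ * J.m.u ζ t)))
      (fun ζ => (∑ l ∈ Finset.range n, (-β l) • Y l ζ) - X ζ) (Metric.sphere lam₀ ε) := by
    intro ζ hζ
    have h2 : ζ - lam₀ ≠ 0 := sub_ne_zero.2 (h.sphere_ne hζ)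
    have h3 := h.ne ζ (Metric.sphere_subset_closedBall hζ)
    have h4 : (J.W ζ)⁻¹ * (ζ - lam₀) ^ n = (g ζ)⁻¹ := by
      rw [h.eq, mul_inv]
      field_simp
    have h5 := eq_sum_taylorRem (fun ζ => J.m.u ζ t) lam₀ n ζ
    have h6 : ∑ l ∈ Finset.range n, (-β l) • Y l ζ = -(2 * ζ * (ζ ^ 2 - lam₀ ^ 2) ^ k *
        ((J.W ζ)⁻¹ * J.pairing A B f ζ)) * ∑ l ∈ Finset.range n, (ζ - lam₀) ^ l * β l := by
      rw [Finset.mul_sum]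
      refine Finset.sum_congr rfl fun l _ => ?_
      simp only [hY, smul_eq_mul]
      ring
    simp only [h6, hX]
    rw [← h4]
    linear_combination (-(2 * ζ * (ζ ^ 2 - lam₀ ^ 2) ^ k * ((J.W ζ)⁻¹ * J.pairing A B f ζ))) * h5
  rw [circleIntegral.integral_congr h.pos.le h1, circleIntegral.integral_sub,
    hXd.diffContOnCl_ball (U := Metric.closedBall lam₀ ε) subset_rfl |>.circleIntegral_eq_zero
      h.pos.le, sub_zero, circleIntegral.integral_fun_sum, Finset.mul_sum]
  · refine Finset.sum_congr rfl fun l _ => ?_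
    rw [circleIntegral.integral_smul, smul_eq_mul, coef]
    ring
  · exact fun l _ => (hYc' l).circleIntegrable h.pos.le
  · exact ContinuousOn.circleIntegrable h.pos.le (continuousOn_finsetSum _ fun l _ => hYc' l)
  · exact (hXd.continuousOn.mono Metric.sphere_subset_closedBall).circleIntegrable h.pos.le

end General

variable {J : Γ.Jost (Γ.restrict V) a b} {lam₀ : ℂ} {n : ℕ} {g : ℂ → ℂ} {ε : ℝ}

theorem isAdmissibleCircle (h : J.IsZeroData θ lam₀ n g ε) (hV : MemLp V ∞ volume)
    (hq : IsCompPotential (Γ.restrict V) a b) (hΓ : Γ.HasStraightEnds θ) :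
    IsAdmissibleCircle Γ.incl (Γ.P hV) lam₀ ε where
  pos := h.pos
  ne _ hζ := h.add_ne_zero hζ
  inv ζ hζ := by
    rw [← neg_sub]
    exact IsInvertible.neg' (J.isInvertible hV hq hΓ
      (h.sector ζ (Metric.sphere_subset_closedBall hζ))
      (h.W_ne_zero (Metric.sphere_subset_closedBall hζ) (h.sphere_ne hζ)))

/-- The sign appears because the resolvent inverts `ζ² - P`, while the Green operator inverts `P -
ζ²`. -/
theorem incl_inverse_ae (h : J.IsZeroData θ lam₀ n g ε) (hV : MemLp V ∞ volume)
    (hq : IsCompPotential (Γ.restrict V) a b) (hΓ : Γ.HasStraightEnds θ) {A B : ℝ} {f : Γ.L2}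
    (h0 : ∀ᵐ t ∂Γ.arcLength, t ∉ Icc A B → f t = 0) {ζ : ℂ} (hζ : ζ ∈ Metric.sphere lam₀ ε) :
    (Γ.incl ((ζ ^ 2 • Γ.incl - Γ.P hV).inverse f) : ℝ → ℂ) =ᵐ[Γ.arcLength] fun t =>
      -(J.volterraPart A f ζ t + (J.W ζ)⁻¹ * J.pairing A B f ζ * J.m.u ζ t) := by
  have hW := h.W_ne_zero (Metric.sphere_subset_closedBall hζ) (h.sphere_ne hζ)
  have hκ := h.sector ζ (Metric.sphere_subset_closedBall hζ)
  set U := (ζ ^ 2 • Γ.incl - Γ.P hV).inverse f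
  have h1 : (ζ ^ 2 • Γ.incl - Γ.P hV) U = f :=
    ((h.isAdmissibleCircle hV hq hΓ).inv ζ hζ).self_apply_inverse f
  have h2 : (Γ.P hV - ζ ^ 2 • Γ.incl) (-U) = f := by
    rw [← neg_sub (ζ ^ 2 • Γ.incl) (Γ.P hV), neg_apply, map_neg, neg_neg, h1]
  obtain ⟨h3, -⟩ := J.incl_eq_green hV hq hΓ hκ hW (-U)
  rw [h2, map_neg] at h3
  filter_upwards [h3, Lp.coeFn_neg (Γ.incl U)] with t h4 h5
  rw [h5, Pi.neg_apply, J.greenU_eq hW (Lp.memLp f) (Γ.ae_volume_of_ae h0)] at h4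
  rw [← h4, neg_neg]

variable [CompleteSpace Γ.H2]

/-- The moments of the resolvent on compactly supported functions. -/
theorem incl_pencilMoment_ae (h : J.IsZeroData θ lam₀ n g ε) (hV : MemLp V ∞ volume)
    (hq : IsCompPotential (Γ.restrict V) a b) (hΓ : Γ.HasStraightEnds θ) {A B : ℝ} {f : Γ.L2}
    (h0 : ∀ᵐ t ∂Γ.arcLength, t ∉ Icc A B → f t = 0) (k : ℕ) :
    (Γ.incl (pencilMoment Γ.incl (Γ.P hV) lam₀ ε k f) : ℝ → ℂ) =ᵐ[Γ.arcLength] fun t =>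
      ∑ l ∈ Finset.range n, coef J lam₀ ε A B f k l *
        taylorRem (fun ζ => J.m.u ζ t) lam₀ l lam₀ := by
  have hf : LocallyIntegrable (fun t => deriv Γ.γ t * f t) volume :=
    memLp_locallyIntegrable (Lp.memLp f)
  have hadm := h.isAdmissibleCircle hV hq hΓ
  -- The families are holomorphic only locally uniformly in `t`. The contour integral is therefore
  -- compared with one in `C([-M, M])`, where evaluation at a point commutes with integration.
  have key : ∀ M : ℕ, ∀ᵐ t ∂Γ.arcLength, t ∈ Icc (-(M : ℝ)) M →
      (Γ.incl (pencilMoment Γ.incl (Γ.P hV) lam₀ ε k f) : ℝ → ℂ) t =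
        ∑ l ∈ Finset.range n, coef J lam₀ ε A B f k l *
          taylorRem (fun ζ => J.m.u ζ t) lam₀ l lam₀ := by
    intro M
    have hM : -(M : ℝ) ≤ M := by
      have : (0 : ℝ) ≤ M := M.cast_nonneg
      linarith
    obtain ⟨Φ, hΦ, hΦ'⟩ := J.holFam_volterraPart A hf (-(M : ℝ)) M
    obtain ⟨Ψ, hΨ, hΨ'⟩ := J.m.hol_u (-(M : ℝ)) M
    rw [differentiableOn_univ] at hΦ hΨ
    set Θ : ℂ → C(Icc (-(M : ℝ)) M, ℂ) := fun ζ =>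
      -(Φ ζ + ((J.W ζ)⁻¹ * J.pairing A B f ζ) • Ψ ζ) with hΘ
    have hΘc : ContinuousOn Θ (Metric.sphere lam₀ ε) := by
      refine (hΦ.continuous.continuousOn.add (ContinuousOn.smul (ContinuousOn.mul
        (J.differentiable_W.continuous.continuousOn.inv₀ fun ζ hζ => ?_)
        (J.differentiable_pairing A B hf).continuous.continuousOn)
        hΨ.continuous.continuousOn)).neg
      exact h.W_ne_zero (Metric.sphere_subset_closedBall hζ) (h.sphere_ne hζ)
    set L : (Γ.L2 →L[ℂ] Γ.H2) →L[ℂ] Γ.L2 :=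
      (truncL2 Γ.arcLength measurableSet_Icc ∘L Γ.incl) ∘L ContinuousLinearMap.apply ℂ Γ.H2 f
      with hL
    have h1 := hadm.map_pencilMoment L k
    have h2 : EqOn (fun ζ : ℂ => (2 * ζ * (ζ ^ 2 - lam₀ ^ 2) ^ (k : ℤ)) •
        L (ζ ^ 2 • Γ.incl - Γ.P hV).inverse)
        (fun ζ => extendL2 Γ.arcLength hM ((2 * ζ * (ζ ^ 2 - lam₀ ^ 2) ^ (k : ℤ)) • Θ ζ))
        (Metric.sphere lam₀ ε) := by
      intro ζ hζ
      simp only [map_smul]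
      congr 1
      refine Lp.ext ?_
      filter_upwards [truncL2_ae (μ := Γ.arcLength) (measurableSet_Icc (a := -(M : ℝ)) (b := M))
        (Γ.incl ((ζ ^ 2 • Γ.incl - Γ.P hV).inverse f)), extendL2_ae (μ := Γ.arcLength) hM (Θ ζ),
        h.incl_inverse_ae hV hq hΓ h0 hζ] with t h3 h4 h5
      refine h3.trans ?_
      rw [h4]
      by_cases ht : t ∈ Icc (-(M : ℝ)) M
      · rw [indicator_of_mem ht, indicator_of_mem ht, h5, IccExtend_of_mem _ _ ht]
        simp [hΘ, hΦ' ζ (mem_univ _), hΨ' ζ (mem_univ _)]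
      · rw [indicator_of_notMem ht, indicator_of_notMem ht]
    have hci : CircleIntegrable (fun ζ => (2 * ζ * (ζ ^ 2 - lam₀ ^ 2) ^ (k : ℤ)) • Θ ζ) lam₀ ε :=
      ((hadm.continuousOn_weight k).smul hΘc).circleIntegrable h.pos.le
    rw [circleIntegral.integral_congr h.pos.le h2,
      (extendL2 Γ.arcLength hM).circleIntegral_comp_comm hci, ← map_smul] at h1
    have h3 := truncL2_ae (μ := Γ.arcLength) (measurableSet_Icc (a := -(M : ℝ)) (b := M))
      (Γ.incl (pencilMoment Γ.incl (Γ.P hV) lam₀ ε k f))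
    have h4 := extendL2_ae (μ := Γ.arcLength) hM ((2 * (Real.pi : ℂ) * Complex.I)⁻¹ •
      ∮ ζ in C(lam₀, ε), (2 * ζ * (ζ ^ 2 - lam₀ ^ 2) ^ (k : ℤ)) • Θ ζ)
    rw [← h1] at h4
    filter_upwards [h3, h4] with t h5 h6 ht
    have h7 := h5.symm.trans h6
    rw [indicator_of_mem ht, indicator_of_mem ht, IccExtend_of_mem _ _ ht] at h7
    rw [h7, ← h.integral_green hf k t, ContinuousMap.smul_apply, smul_eq_mul]
    congr 1
    have h8 := (ContinuousMap.evalCLM ℂ (⟨t, ht⟩ : Icc (-(M : ℝ)) M) :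
      C(Icc (-(M : ℝ)) M, ℂ) →L[ℂ] ℂ).circleIntegral_comp_comm hci
    rw [ContinuousMap.evalCLM_apply] at h8
    rw [← h8]
    refine circleIntegral.integral_congr h.pos.le fun ζ hζ => ?_
    simp [hΘ, hΦ' ζ (mem_univ _), hΨ' ζ (mem_univ _)]
  have key' := ae_all_iff.2 key
  filter_upwards [key'] with t ht
  obtain ⟨M, hM⟩ := exists_nat_ge |t|
  exact ht M ⟨by linarith [neg_abs_le t], (le_abs_self t).trans hM⟩

end IsZeroData

end Jost

end SimpleCurve

/-! ### Rank and trace of the Riesz projection, Fredholm property -/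

namespace SimpleCurve

variable {Γ : SimpleCurve} {V : ℝ → ℂ} {a b θ : ℝ}

/-- Completeness is transported from `L²` by the isomorphism available at a regular spectral
parameter. -/
theorem completeSpace_H2 {A : Γ.H2 →L[ℂ] Γ.L2} (h : A.IsInvertible) : CompleteSpace Γ.H2 := by
  obtain ⟨e, -⟩ := h
  exact (completeSpace_congr (e := e.toEquiv) e.isUniformEmbedding).2 inferInstance

/-- The class of a square integrable function, as a linear map. -/
noncomputable def toAEEqFun (μ : Measure ℝ) : Lp ℂ 2 μ →ₗ[ℂ] (ℝ →ₘ[μ] ℂ) where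
  toFun f := f
  map_add' _ _ := rfl
  map_smul' _ _ := rfl

theorem toAEEqFun_injective (μ : Measure ℝ) : Function.Injective (toAEEqFun μ) :=
  fun _ _ h => Subtype.ext h

theorem ae_sum_smul_toAEEqFun (μ : Measure ℝ) (n : ℕ) (c : ℕ → ℂ) (β : ℕ → C(ℝ, ℂ)) :
    ((∑ l : Fin n, c l • (β l).toAEEqFun μ : ℝ →ₘ[μ] ℂ) : ℝ → ℂ) =ᵐ[μ]
      fun t => ∑ l ∈ Finset.range n, c l * β l t := by
  have h : (∑ l : Fin n, c l • (β l).toAEEqFun μ : ℝ →ₘ[μ] ℂ) =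
      (∑ l : Fin n, c l • β l : C(ℝ, ℂ)).toAEEqFun μ := by
    have h1 := map_sum (ContinuousMap.toAEEqFunLinearMap μ (𝕜 := ℂ) : C(ℝ, ℂ) →ₗ[ℂ] ℝ →ₘ[μ] ℂ)
      (fun l : Fin n => c l • β l) Finset.univ
    simp only [map_smul] at h1
    exact h1.symm
  rw [h]
  filter_upwards [ContinuousMap.coeFn_toAEEqFun μ (∑ l : Fin n, c l • β l)] with t ht
  rw [ht, ContinuousMap.sum_apply, ← Fin.sum_univ_eq_sum_range]
  rfl

namespace Jost

/-- `n` is the index of the first nonzero Taylor coefficient, which exists by the identity theorem,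
and `g` is the corresponding entire remainder. The case `n = 0` is allowed, so regular points are
treated together with zeros. -/
theorem exists_W_eq {q : ℝ → ℂ} (J : Γ.Jost q a b) (hW : ∃ ζ, J.W ζ ≠ 0) (lam : ℂ) :
    ∃ (n : ℕ) (g : ℂ → ℂ), Differentiable ℂ g ∧ (∀ ζ, J.W ζ = (ζ - lam) ^ n * g ζ) ∧
      g lam ≠ 0 := by
  obtain ⟨n, hn, hn'⟩ : ∃ n, taylorRem J.W lam n lam ≠ 0 ∧
      ∀ l < n, taylorRem J.W lam l lam = 0 := by
    have hex : ∃ n, taylorRem J.W lam n lam ≠ 0 := by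
      obtain ⟨p, hp⟩ := J.differentiable_W.analyticAt lam
      refine ⟨p.order, hp.iterate_dslope_fslope_ne_zero fun h0 => ?_⟩
      obtain ⟨ζ, hζ⟩ := hW
      refine hζ ?_
      have h1 := hp.locally_zero_iff.2 h0
      have h2 : AnalyticOnNhd ℂ J.W univ := fun z _ => J.differentiable_W.analyticAt z
      exact h2.eqOn_zero_of_preconnected_of_eventuallyEq_zero isPreconnected_univ (mem_univ lam)
        h1 (mem_univ ζ)
    classical
    exact ⟨Nat.find hex, Nat.find_spec hex, fun l hl => not_not.1 (Nat.find_min hex hl)⟩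
  refine ⟨n, taylorRem J.W lam n, differentiableOn_univ.1
    (differentiableOn_taylorRem univ_mem J.differentiable_W.differentiableOn n), fun ζ => ?_, hn⟩
  have h2 := eq_sum_taylorRem J.W lam n ζ
  rwa [Finset.sum_eq_zero fun l hl => by rw [hn' l (Finset.mem_range.1 hl), mul_zero],
    zero_add] at h2

theorem exists_isZeroData {q : ℝ → ℂ} {J : Γ.Jost q a b} {lam : ℂ} {n : ℕ} {g : ℂ → ℂ}
    (hg : Differentiable ℂ g) (hWg : ∀ ζ, J.W ζ = (ζ - lam) ^ n * g ζ) (hg0 : g lam ≠ 0)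
    (hκ : 0 < (lam * Complex.exp (θ * Complex.I)).im) : ∃ ε, J.IsZeroData θ lam n g ε := by
  have h1 : ∀ᶠ ζ in 𝓝 lam, g ζ ≠ 0 ∧ 0 < (ζ * Complex.exp (θ * Complex.I)).im := by
    refine (hg.continuous.continuousAt.eventually_ne hg0).and ?_
    have hc : Continuous fun ζ : ℂ => (ζ * Complex.exp (θ * Complex.I)).im := by fun_prop
    exact hc.continuousAt.eventually (lt_mem_nhds hκ)
  obtain ⟨ε, hε, hεs⟩ := Metric.nhds_basis_closedBall.eventually_iff.1 h1
  exact ⟨ε, hε, hg, hWg, fun ζ hζ => (hεs hζ).1, fun ζ hζ => (hεs hζ).2⟩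

/-- A test function on which `p` does not vanish. -/
theorem exists_pairing_ne_zero {q : ℝ → ℂ} (J : Γ.Jost q a b) (hq : IsCompPotential q a b)
    {lam : ℂ} (hlam : lam ≠ 0) : ∃ f : Γ.L2, (∀ᵐ t ∂Γ.arcLength, t ∉ Icc b (b + 1) → f t = 0) ∧
      J.pairing b (b + 1) f lam ≠ 0 := by
  have hp := (J.p.sol lam).1.continuous
  have hd := Γ.continuous_deriv
  set F : ℝ → ℂ := fun t => (starRingEnd ℂ) (J.p.u lam t * deriv Γ.γ t) with hF
  have hFc : Continuous F := Complex.continuous_conj.comp (hp.mul hd)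
  have hm := memLp_indicator_Icc (μ := Γ.arcLength) hFc b (b + 1)
  refine ⟨hm.toLp _, ?_, ?_⟩
  · filter_upwards [hm.coeFn_toLp] with t ht h0
    rw [ht, indicator_of_notMem h0]
  · have h1 : J.pairing b (b + 1) (hm.toLp _) lam =
        ((∫ y in b..b + 1, Complex.normSq (J.p.u lam y * deriv Γ.γ y) : ℝ) : ℂ) := by
      rw [pairing, ← intervalIntegral.integral_ofReal]
      refine intervalIntegral.integral_congr_ae ?_
      filter_upwards [Γ.ae_volume_of_ae hm.coeFn_toLp] with t ht hmem
      rw [uIoc_of_le (by linarith)] at hmem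
      rw [ht, indicator_of_mem (Ioc_subset_Icc_self hmem), ← mul_assoc, Complex.mul_conj]
    rw [h1, Complex.ofReal_ne_zero]
    refine (intervalIntegral.intervalIntegral_pos_of_pos_on ?_ (fun y hy => ?_) (by linarith)).ne'
    · exact (Complex.continuous_normSq.comp (hp.mul hd)).intervalIntegrable _ _
    · rw [Complex.normSq_pos, (J.p_right hq hlam hy.1.le).1]
      exact mul_ne_zero (Complex.exp_ne_zero _) (Γ.deriv_ne_zero y)

namespace IsZeroData

variable {J : Γ.Jost (Γ.restrict V) a b} {lam₀ : ℂ} {n : ℕ} {g : ℂ → ℂ} {ε : ℝ}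

theorem completeSpace (h : J.IsZeroData θ lam₀ n g ε) (hV : MemLp V ∞ volume)
    (hq : IsCompPotential (Γ.restrict V) a b) (hΓ : Γ.HasStraightEnds θ) :
    CompleteSpace Γ.H2 := by
  have hmem : lam₀ + ε ∈ Metric.sphere lam₀ ε := by
    simp [abs_of_pos h.pos]
  exact completeSpace_H2 ((h.isAdmissibleCircle hV hq hΓ).inv _ hmem)

variable [CompleteSpace Γ.H2]

/-- On compactly supported functions every coefficient vanishes by `coef_eq_zero`; density does the
rest. -/
theorem incl_comp_pencilMoment_eq_zero (h : J.IsZeroData θ lam₀ n g ε) (hV : MemLp V ∞ volume)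
    (hq : IsCompPotential (Γ.restrict V) a b) (hΓ : Γ.HasStraightEnds θ) (k : ℕ) (hk : n ≤ k) :
    Γ.incl ∘L pencilMoment Γ.incl (Γ.P hV) lam₀ ε k = 0 := by
  ext1 f
  refine dense_compactlySupported.induction (P := fun f =>
    (Γ.incl ∘L pencilMoment Γ.incl (Γ.P hV) lam₀ ε k) f = (0 : Γ.L2 →L[ℂ] Γ.L2) f) ?_
    (isClosed_eq (ContinuousLinearMap.continuous _) (ContinuousLinearMap.continuous _)) f
  rintro f ⟨A, B, -, h0⟩
  refine Lp.ext ?_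
  filter_upwards [h.incl_pencilMoment_ae hV hq hΓ h0 k, Lp.coeFn_zero ℂ 2 Γ.arcLength]
    with t h1 h2
  refine h1.trans ?_
  rw [zero_apply, h2]
  refine Finset.sum_eq_zero fun l _ => ?_
  rw [h.coef_eq_zero (memLp_locallyIntegrable (Lp.memLp f)) (by omega), zero_mul]

/-- The range lies in the span of the first `n` Taylor coefficients of `m`, which gives the upper
bound. For the lower bound, `M_0 f, …, M_{n-1} f` are independent in the range once `M_{n-1} f ≠ 0`,
because `M_1` shifts them. -/
theorem finrank_range (h : J.IsZeroData θ lam₀ n g ε) (hV : MemLp V ∞ volume)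
    (hq : IsCompPotential (Γ.restrict V) a b) (hΓ : Γ.HasStraightEnds θ) :
    FiniteDimensional ℂ (Γ.incl ∘L pencilMoment Γ.incl (Γ.P hV) lam₀ ε 0).range ∧
    Module.finrank ℂ (Γ.incl ∘L pencilMoment Γ.incl (Γ.P hV) lam₀ ε 0).range = n := by
  have hadm := h.isAdmissibleCircle hV hq hΓ
  have hz := h.incl_comp_pencilMoment_eq_zero hV hq hΓ
  set T : Γ.L2 →L[ℂ] Γ.L2 := Γ.incl ∘L pencilMoment Γ.incl (Γ.P hV) lam₀ ε 0 with hT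
  set β : ℕ → C(ℝ, ℂ) := fun l => ⟨fun t => taylorRem (fun ζ => J.m.u ζ t) lam₀ l lam₀,
    (J.m.hol_u.taylorRem univ_mem l).continuous (mem_univ lam₀)⟩ with hβ
  set e : Fin n → (ℝ →ₘ[Γ.arcLength] ℂ) := fun l => (β l).toAEEqFun Γ.arcLength with he
  set E := Submodule.span ℂ (range e) with hE
  set ι := toAEEqFun Γ.arcLength
  -- Individual Taylor coefficients of `m` are not known to be square integrable, so their span is
  -- formed among classes of measurable functions and pulled back to `L²`.
  let ρ : E.comap ι →ₗ[ℂ] E := ι.restrict fun x hx => hx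
  have hρ : Function.Injective ρ := fun x y hxy =>
    Subtype.ext (toAEEqFun_injective _ (congrArg (Subtype.val : E → _) hxy))
  have hfinE' : FiniteDimensional ℂ E := FiniteDimensional.span_of_finite ℂ (finite_range e)
  have hnoeth : IsNoetherian ℂ E := isNoetherian_of_isNoetherianRing_of_finite ℂ E
  have hfinE : FiniteDimensional ℂ (E.comap ι) := Module.Finite.of_injective ρ hρ
  have hcard : Module.finrank ℂ (E.comap ι) ≤ n :=
    (LinearMap.finrank_le_finrank_of_injective hρ).trans
      ((finrank_range_le_card e).trans_eq (Fintype.card_fin n))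
  have hrange : T.range ≤ E.comap ι := by
    rintro _ ⟨f, rfl⟩
    -- A finite dimensional subspace is closed, so the inclusion passes from the dense subspace to
    -- all of `L²`.
    refine dense_compactlySupported.induction (P := fun f => T f ∈ E.comap ι) ?_
      ((E.comap ι).closed_of_finiteDimensional.preimage T.continuous) f
    rintro f ⟨A, B, -, h0⟩
    have h1 := h.incl_pencilMoment_ae hV hq hΓ h0 0
    have h2 : ι (T f) = ∑ l : Fin n, coef J lam₀ ε A B f 0 l • e l := by
      refine AEEqFun.ext ?_
      exact h1.trans (ae_sum_smul_toAEEqFun Γ.arcLength n _ β).symm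
    change ι (T f) ∈ E
    rw [h2]
    exact Submodule.sum_mem _ fun l _ => E.smul_mem _ (Submodule.subset_span (mem_range_self l))
  have hfin : FiniteDimensional ℂ T.range := Submodule.finiteDimensional_of_le hrange
  refine ⟨hfin, le_antisymm ((Submodule.finrank_mono hrange).trans hcard) ?_⟩
  obtain ⟨f, h0, hf⟩ := J.exists_pairing_ne_zero hq h.center_ne_zero
  set v : ℕ → Γ.L2 := fun k => Γ.incl (pencilMoment Γ.incl (Γ.P hV) lam₀ ε k f) with hv
  have hli : LinearIndependent ℂ (fun k : Fin n => v k) := by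
    refine linearIndependent_iterate_of_nilpotent v
      ((Γ.incl ∘L pencilMoment Γ.incl (Γ.P hV) lam₀ ε (1 : ℕ) : Γ.L2 →L[ℂ] Γ.L2) :
        Γ.L2 →ₗ[ℂ] Γ.L2) (fun k => ?_) (fun k hk => DFunLike.congr_fun (hz k hk) f)
      fun k hk h1 => ?_
    · exact congrArg Γ.incl (hadm.pencilMoment_comp_pencilMoment hz 1 k f)
    · have h2 := h.incl_pencilMoment_ae hV hq hΓ h0 k
      have hloc : LocallyIntegrable (fun t => deriv Γ.γ t * f t) volume :=
        memLp_locallyIntegrable (Lp.memLp f)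
      have h3 : (fun t => coef J lam₀ ε b (b + 1) f k 0 * J.m.u lam₀ t) =ᵐ[volume] 0 := by
        have h1' : Γ.incl (pencilMoment Γ.incl (Γ.P hV) lam₀ ε k f) = 0 := h1
        rw [h1'] at h2
        filter_upwards [Γ.ae_volume_of_ae h2,
          Γ.ae_volume_of_ae (Lp.coeFn_zero ℂ 2 Γ.arcLength)] with t h4 h5
        -- For `k = n - 1` only `l = 0` satisfies `k + l < n`, so the moment is a single multiple of
        -- `m`; that multiple is nonzero by the choice of `f`.
        rw [h5, Finset.sum_eq_single 0 (fun l _ hl => by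
          rw [h.coef_eq_zero hloc (by omega), zero_mul])
          (fun hn => absurd (Finset.mem_range.2 (by omega)) hn)] at h4
        exact h4.symm
      have h6 := Continuous.ext_of_ae_eq (continuous_const.mul (J.m.sol lam₀).1.continuous)
        continuous_zero h3
      have h7 := congrFun h6 a
      simp only [Pi.zero_apply, Pi.mul_apply] at h7
      rw [(J.m_left hq lam₀ le_rfl).1, h.coef_eq hloc hk] at h7
      refine absurd h7 (mul_ne_zero (neg_ne_zero.2 (mul_ne_zero (mul_ne_zero (mul_ne_zero
        two_ne_zero h.center_ne_zero) (pow_ne_zero _ ?_)) (mul_ne_zero (inv_ne_zero ?_) hf)))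
        (Complex.exp_ne_zero _))
      · exact h.add_ne_zero (Metric.mem_closedBall_self h.pos.le)
      · exact h.ne _ (Metric.mem_closedBall_self h.pos.le)
  -- The moment of order zero fixes every `v k`, by `M_0 M_k = M_k`.
  have hmem : ∀ k : Fin n, v k ∈ T.range := fun k =>
    ⟨v k, congrArg Γ.incl (hadm.pencilMoment_comp_pencilMoment hz 0 k f)⟩
  have hli' : LinearIndependent ℂ (fun k : Fin n => (⟨v k, hmem k⟩ : T.range)) :=
    LinearIndependent.of_comp T.range.subtype hli
  simpa using hli'.fintype_card_le_finrank

theorem circleIntegrable_resolvent (h : J.IsZeroData θ lam₀ n g ε) (hV : MemLp V ∞ volume)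
    (hq : IsCompPotential (Γ.restrict V) a b) (hΓ : Γ.HasStraightEnds θ) :
    CircleIntegrable (fun ζ => (2 * ζ) • Γ.resolvent hV ζ) lam₀ ε := by
  have hadm := h.isAdmissibleCircle hV hq hΓ
  refine ContinuousOn.circleIntegrable h.pos.le
    (ContinuousOn.smul (f := fun ζ : ℂ => 2 * ζ) (by fun_prop) ?_)
  exact (ContinuousLinearMap.compL ℂ Γ.L2 Γ.H2 Γ.L2 Γ.incl).continuous.comp_continuousOn
    hadm.continuousOn_inverse

theorem riesz_eq (h : J.IsZeroData θ lam₀ n g ε) (hV : MemLp V ∞ volume)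
    (hq : IsCompPotential (Γ.restrict V) a b) (hΓ : Γ.HasStraightEnds θ) :
    Γ.riesz hV lam₀ ε = Γ.incl ∘L pencilMoment Γ.incl (Γ.P hV) lam₀ ε 0 := by
  have h1 := (h.isAdmissibleCircle hV hq hΓ).map_pencilMoment
    (ContinuousLinearMap.compL ℂ Γ.L2 Γ.H2 Γ.L2 Γ.incl) 0
  simp only [zpow_zero, mul_one] at h1
  exact h1.symm

theorem hasFiniteRankTrace_riesz (h : J.IsZeroData θ lam₀ n g ε) (hV : MemLp V ∞ volume)
    (hq : IsCompPotential (Γ.restrict V) a b) (hΓ : Γ.HasStraightEnds θ) :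
    HasFiniteRankTrace (Γ.riesz hV lam₀ ε) n := by
  obtain ⟨h1, h2⟩ := h.finrank_range hV hq hΓ
  rw [h.riesz_eq hV hq hΓ]
  have h3 := hasFiniteRankTrace_of_isIdempotent
    (Γ.incl ∘L pencilMoment Γ.incl (Γ.P hV) lam₀ ε 0) (fun f => congrArg Γ.incl
      ((h.isAdmissibleCircle hV hq hΓ).pencilMoment_comp_pencilMoment
        (h.incl_comp_pencilMoment_eq_zero hV hq hΓ) 0 0 f)) h1
  rwa [h2] at h3

theorem isFredholm (h : J.IsZeroData θ lam₀ n g ε) (hV : MemLp V ∞ volume)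
    (hq : IsCompPotential (Γ.restrict V) a b) (hΓ : Γ.HasStraightEnds θ) :
    (Γ.P hV - lam₀ ^ 2 • Γ.incl).IsFredholm :=
  (h.isAdmissibleCircle hV hq hΓ).isFredholm Γ.incl_injective (h.finrank_range hV hq hΓ).1

end IsZeroData

end Jost

end SimpleCurve

/-! ### The real line as a curve -/

theorem deriv_ofReal_eq_one (t : ℝ) : deriv (fun s : ℝ => (s : ℂ)) t = 1 :=
  (Complex.ofRealCLM.hasDerivAt (x := t)).deriv

/-- The real line. -/
noncomputable def realLine : SimpleCurve where
  γ := fun t => (t : ℂ)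
  contDiff := Complex.ofRealCLM.contDiff
  deriv_ne_zero t := by
    rw [deriv_ofReal_eq_one]
    exact one_ne_zero
  injective := Complex.ofReal_injective

namespace realLine

@[simp] theorem γ_apply (t : ℝ) : realLine.γ t = t := rfl

@[simp] theorem deriv_γ (t : ℝ) : deriv realLine.γ t = 1 := deriv_ofReal_eq_one t

theorem arcLength_eq : realLine.arcLength = volume := by
  simp [SimpleCurve.arcLength]

/-- With `θ = 0` the decay condition becomes `Im λ > 0`, so the Green operator on curves also covers
the line in the upper half plane. -/
theorem hasStraightEnds : realLine.HasStraightEnds 0 where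
  deriv_eq := ⟨0, fun t _ => by simp⟩
  top := by
    simpa using tendsto_abs_atTop_atTop
  bot := by
    simpa using tendsto_abs_atBot_atTop

end realLine

theorem isCompPotential_of_tsupport {V : ℝ → ℂ} (hV : MemLp V ∞ volume) {L : ℝ} (hL : 0 < L)
    (hsupp : tsupport V ⊆ Ioo (-L) L) : IsCompPotential V (-L) L where
  meas := hV.1
  bdd := by
    refine ⟨(eLpNorm V ∞ volume).toReal, ?_⟩
    filter_upwards [ae_le_eLpNormEssSup (f := V) (μ := volume)] with x hx
    rw [eLpNorm_exponent_top]
    have := ENNReal.toReal_mono (by simpa using hV.2.ne) hx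
    simpa using this
  zero t ht := by
    by_contra h
    exact ht (Ioo_subset_Icc_self (hsupp (subset_tsupport V h)))
  le := by linarith

theorem HasPrim.conj {u w : ℝ → ℂ} (h : HasPrim u w) :
    HasPrim (fun t => (starRingEnd ℂ) (u t)) (fun t => (starRingEnd ℂ) (w t)) := by
  refine ⟨?_, fun t => ?_⟩
  · intro x
    obtain ⟨s, hs, hi⟩ := h.1 x
    exact ⟨s, hs, (Complex.conjCLE : ℂ →L[ℝ] ℂ).integrable_comp hi⟩
  · have h0 := congrArg (starRingEnd ℂ) (h.2 t)
    rw [map_add] at h0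
    refine h0.trans (congrArg _ ?_)
    have := (Complex.conjCLE : ℂ →L[ℝ] ℂ).intervalIntegral_comp_comm (h.1.intervalIntegrable' 0 t)
    exact this.symm

namespace SimpleCurve.Jost

variable {q : ℝ → ℂ} {a b : ℝ}

/-- There are no zeros of the Wronskian far up in the upper half plane. -/
theorem W_ne_zero_of_le_im (J : realLine.Jost q a b) (hq : IsCompPotential q a b) {Q : ℝ}
    (hQ : ∀ᵐ t, ‖q t‖ ≤ Q) {lam : ℂ} (him : 0 < lam.im) (hlam : Q ≤ lam.im ^ 2) :
    J.W lam ≠ 0 := by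
  intro hW
  have hl0 : lam ≠ 0 := by
    rintro rfl
    simp at him
  have hsol := J.m.sol lam
  set u := J.m.u lam with hu
  set v := J.m.v lam with hv
  have hva : v a = -(Complex.I * lam) * u a := by
    rw [hu, hv, (J.m_left hq lam le_rfl).1, (J.m_left hq lam le_rfl).2]
  have hua : u a ≠ 0 := by
    rw [hu, (J.m_left hq lam le_rfl).1]
    exact Complex.exp_ne_zero _
  -- This is the only use of `W = 0`: `m` is proportional to `p`, hence outgoing at `b` as well as
  -- at `a`.
  have hvb : v b = Complex.I * lam * u b := by
    obtain ⟨k, hk⟩ := J.exists_p_eq hW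
    have hp := J.p_right hq hl0 le_rfl
    have h1 := hk b
    rw [hp.1, hp.2] at h1
    have hk0 : k ≠ 0 := by
      rintro rfl
      exact Complex.exp_ne_zero _ (h1.1.trans (zero_mul _))
    refine mul_left_cancel₀ hk0 ?_
    rw [← h1.2, h1.1]
    ring
  have hprim := (hsol.2.mul hsol.1.conj).sub_eq a b
  simp only [realLine.deriv_γ, one_mul, mul_one] at hprim
  set F : ℝ → ℂ := fun t => (q t - lam ^ 2) * u t * (starRingEnd ℂ) (u t) +
    v t * (starRingEnd ℂ) (v t) with hF
  have hFi : IntervalIntegrable F volume a b := by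
    have h1 := (hsol.2.mul hsol.1.conj).1.intervalIntegrable' a b
    simpa only [realLine.deriv_γ, one_mul, mul_one] using h1
  have hN : ∀ z : ℂ, z * (starRingEnd ℂ) z = (Complex.normSq z : ℂ) := Complex.mul_conj
  -- Energy identity: pairing the equation with the conjugate of `u` and multiplying by the
  -- conjugate of `λ` makes the boundary term `i` times a positive number.
  have hL : (starRingEnd ℂ) lam * (v b * (starRingEnd ℂ) (u b) - v a * (starRingEnd ℂ) (u a)) =
      Complex.I * ((Complex.normSq lam * (Complex.normSq (u b) + Complex.normSq (u a)) : ℝ) : ℂ) := by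
    rw [hva, hvb]
    push_cast
    rw [← hN, ← hN, ← hN]
    ring
  have h1 : Complex.normSq lam * (Complex.normSq (u b) + Complex.normSq (u a)) =
      ∫ t in a..b, ((starRingEnd ℂ) lam * F t).im := by
    have h2 := Complex.imCLM.intervalIntegral_comp_comm (hFi.const_mul ((starRingEnd ℂ) lam))
    rw [intervalIntegral.integral_const_mul, ← hprim, hL] at h2
    simp only [Complex.imCLM_apply, Complex.I_mul_im, Complex.ofReal_re] at h2
    exact h2.symm
  -- The imaginary part of the integrand is at most `(|λ| Q - |λ|² Im λ) |u|² - Im λ |v|²`, which is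
  -- nonpositive since `Q ≤ (Im λ)² ≤ |λ| Im λ`.
  have h3 : ∫ t in a..b, ((starRingEnd ℂ) lam * F t).im ≤ 0 := by
    rw [intervalIntegral.integral_of_le hq.le]
    refine integral_nonpos_of_ae (ae_restrict_of_ae ?_)
    filter_upwards [hQ] with t ht
    have e1 : ((starRingEnd ℂ) lam * F t) = ((starRingEnd ℂ) lam * q t) * Complex.normSq (u t) -
        (Complex.normSq lam * Complex.normSq (u t) : ℝ) * lam +
        (Complex.normSq (v t) : ℝ) * (starRingEnd ℂ) lam := by
      simp only [hF]
      push_cast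
      rw [← hN, ← hN, ← hN]
      ring
    have e2 : ((starRingEnd ℂ) lam * q t).im ≤ ‖lam‖ * Q := by
      refine (le_abs_self _).trans ((Complex.abs_im_le_norm _).trans ?_)
      rw [norm_mul, RCLike.norm_conj]
      exact mul_le_mul_of_nonneg_left ht (norm_nonneg _)
    have e3 : lam.im ≤ ‖lam‖ := (le_abs_self _).trans (Complex.abs_im_le_norm _)
    have e4 : ‖lam‖ * Q ≤ Complex.normSq lam * lam.im := by
      rw [Complex.normSq_eq_norm_sq]
      have : Q ≤ ‖lam‖ * lam.im := hlam.trans (by nlinarith)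
      nlinarith [norm_nonneg lam]
    rw [e1]
    simp only [Complex.add_im, Complex.sub_im, Complex.im_mul_ofReal, Complex.im_ofReal_mul,
      Complex.conj_im, Pi.zero_apply]
    have p1 := Complex.normSq_nonneg (u t)
    have p2 := Complex.normSq_nonneg (v t)
    nlinarith [mul_nonneg p2 him.le, mul_nonneg p1 (sub_nonneg.2 (e2.trans e4))]
  have p1 : 0 < Complex.normSq lam := Complex.normSq_pos.2 hl0
  have p2 : 0 < Complex.normSq (u a) := Complex.normSq_pos.2 hua
  have p3 := Complex.normSq_nonneg (u b)
  have : 0 < Complex.normSq lam * (Complex.normSq (u b) + Complex.normSq (u a)) := by positivity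
  linarith

theorem exists_bound_W_ne_zero (J : realLine.Jost q a b) (hq : IsCompPotential q a b) :
    ∃ C : ℝ, 0 ≤ C ∧ ∀ lam : ℂ, C < lam.im → J.W lam ≠ 0 := by
  obtain ⟨Q, hQ⟩ := hq.bdd
  refine ⟨1 + |Q|, by positivity, fun lam hlam => ?_⟩
  have h0 := abs_nonneg Q
  refine J.W_ne_zero_of_le_im hq hQ (by linarith) ?_
  nlinarith [le_abs_self Q]

end SimpleCurve.Jost

/-! ### Operators from `L²_comp(ℝ)` to `L²_loc(ℝ)` -/

/-- Continuous functions are locally square integrable. -/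
noncomputable def toL2Loc : C(ℝ, ℂ) →ₗ[ℂ] L2Loc :=
  LinearMap.codRestrict L2Loc (ContinuousMap.toAEEqFunLinearMap volume) fun F M => by
    have h1 : (ContinuousMap.toAEEqFunLinearMap volume (𝕜 := ℂ) F : ℝ →ₘ[volume] ℂ) =ᵐ[volume] F :=
      ContinuousMap.coeFn_toAEEqFun volume F
    rw [memLp_congr_ae (ae_restrict_of_ae h1), ← memLp_indicator_iff_restrict measurableSet_Icc]
    exact memLp_indicator_Icc F.continuous (-M) M

theorem toL2Loc_ae (F : C(ℝ, ℂ)) : (toL2Loc F : ℝ →ₘ[(volume : Measure ℝ)] ℂ) =ᵐ[volume] F :=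
  ContinuousMap.coeFn_toAEEqFun volume F

theorem toL2Loc_injective : Function.Injective toL2Loc := fun F G h => by
  have h1 := (toL2Loc_ae F).symm.trans (h ▸ toL2Loc_ae G)
  exact DFunLike.coe_injective (Continuous.ext_of_ae_eq F.continuous G.continuous h1)

theorem Lp_locallyIntegrable (f : Lp ℂ 2 (volume : Measure ℝ)) : LocallyIntegrable f volume :=
  (Lp.memLp f).locallyIntegrable (by norm_num)

theorem locallyIntegrable_continuous_mul {u f : ℝ → ℂ} (hu : Continuous u)
    (hf : LocallyIntegrable f volume) : LocallyIntegrable (fun s => u s * f s) volume := by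
  rw [← locallyIntegrableOn_univ] at hf ⊢
  exact hf.continuousOn_mul hu.continuousOn isOpen_univ.isLocallyClosed

theorem L2Comp.integrable_mul (f : L2Comp) {u : ℝ → ℂ} (hu : Continuous u) :
    Integrable (fun s => u s * (f : Lp ℂ 2 (volume : Measure ℝ)) s) volume := by
  obtain ⟨M, hM⟩ := f.2
  refine ((locallyIntegrable_continuous_mul hu (Lp_locallyIntegrable _)).integrableOn_isCompact
    (isCompact_Icc (a := -M) (b := M))).integrable_of_ae_notMem_eq_zero ?_
  filter_upwards [hM] with s hs h
  rw [hs h, mul_zero]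

theorem L2Comp.mul_add_ae (f g : L2Comp) (u : ℝ → ℂ) :
    (fun s => u s * ((f + g : L2Comp) : Lp ℂ 2 (volume : Measure ℝ)) s) =ᵐ[volume]
      fun s => u s * (f : Lp ℂ 2 (volume : Measure ℝ)) s +
        u s * (g : Lp ℂ 2 (volume : Measure ℝ)) s := by
  filter_upwards [Lp.coeFn_add (f : Lp ℂ 2 (volume : Measure ℝ)) g] with s hs
  have h1 : ((f + g : L2Comp) : Lp ℂ 2 (volume : Measure ℝ)) s = _ := hs
  rw [h1, Pi.add_apply, mul_add]

theorem L2Comp.mul_smul_ae (c : ℂ) (f : L2Comp) (u : ℝ → ℂ) :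
    (fun s => u s * ((c • f : L2Comp) : Lp ℂ 2 (volume : Measure ℝ)) s) =ᵐ[volume]
      fun s => c * (u s * (f : Lp ℂ 2 (volume : Measure ℝ)) s) := by
  filter_upwards [Lp.coeFn_smul c (f : Lp ℂ 2 (volume : Measure ℝ))] with s hs
  have h1 : ((c • f : L2Comp) : Lp ℂ 2 (volume : Measure ℝ)) s = _ := hs
  rw [h1, Pi.smul_apply, smul_eq_mul]
  ring

/-- Integration against a continuous function. -/
noncomputable def compPairing (u : C(ℝ, ℂ)) : L2Comp →ₗ[ℂ] ℂ where
  toFun f := ∫ s, u s * (f : Lp ℂ 2 (volume : Measure ℝ)) s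
  map_add' f g := by
    rw [integral_congr_ae (L2Comp.mul_add_ae f g u),
      integral_add (L2Comp.integrable_mul f u.continuous) (L2Comp.integrable_mul g u.continuous)]
  map_smul' c f := by
    rw [integral_congr_ae (L2Comp.mul_smul_ae c f u), integral_const_mul]
    rfl

theorem compPairing_apply (u : C(ℝ, ℂ)) (f : L2Comp) :
    compPairing u f = ∫ s, u s * (f : Lp ℂ 2 (volume : Measure ℝ)) s := rfl

/-- The primitive of the product with a continuous function which vanishes at `-∞`. -/
noncomputable def compPrimitive (u : C(ℝ, ℂ)) : L2Comp →ₗ[ℂ] C(ℝ, ℂ) where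
  toFun f := ⟨fun t => ∫ s in Iic t, u s * (f : Lp ℂ 2 (volume : Measure ℝ)) s,
    (HasPrim.of_integral_Iic (locallyIntegrable_continuous_mul u.continuous
      (Lp_locallyIntegrable _)) fun _ => (L2Comp.integrable_mul f u.continuous).integrableOn).continuous⟩
  map_add' f g := by
    ext t
    simp only [ContinuousMap.coe_mk, ContinuousMap.add_apply]
    rw [integral_congr_ae (ae_restrict_of_ae (L2Comp.mul_add_ae f g u)),
      integral_add (L2Comp.integrable_mul f u.continuous).integrableOn
        (L2Comp.integrable_mul g u.continuous).integrableOn]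
  map_smul' c f := by
    ext t
    simp only [ContinuousMap.coe_mk, ContinuousMap.smul_apply, RingHom.id_apply, smul_eq_mul]
    rw [integral_congr_ae (ae_restrict_of_ae (L2Comp.mul_smul_ae c f u)), integral_const_mul]

theorem compPrimitive_apply (u : C(ℝ, ℂ)) (f : L2Comp) (t : ℝ) :
    compPrimitive u f t = ∫ s in Iic t, u s * (f : Lp ℂ 2 (volume : Measure ℝ)) s := rfl

/-- The operator with integral kernel `F(t) G(s)`. -/
noncomputable def rankOneOp : C(ℝ, ℂ) →ₗ[ℂ] C(ℝ, ℂ) →ₗ[ℂ] (L2Comp →ₗ[ℂ] L2Loc) :=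
  LinearMap.mk₂ ℂ (fun F G => (compPairing G).smulRight (toL2Loc F))
    (fun F F' G => by ext1 f; simp)
    (fun c F G => by
      ext1 f
      simp only [LinearMap.smulRight_apply, LinearMap.smul_apply, map_smul]
      rw [smul_comm])
    (fun F G G' => by
      ext1 f
      have h : compPairing (G + G') f = compPairing G f + compPairing G' f := by
        rw [compPairing_apply, compPairing_apply, compPairing_apply,
          ← integral_add (L2Comp.integrable_mul f G.continuous) (L2Comp.integrable_mul f G'.continuous)]
        exact integral_congr_ae (ae_of_all _ fun s => by simp [add_mul])
      simp only [LinearMap.smulRight_apply, LinearMap.add_apply, h, add_smul])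
    (fun c F G => by
      ext1 f
      have h : compPairing (c • G) f = c * compPairing G f := by
        rw [compPairing_apply, compPairing_apply, ← integral_const_mul]
        exact integral_congr_ae (ae_of_all _ fun s => by simp [mul_assoc])
      simp only [LinearMap.smulRight_apply, LinearMap.smul_apply, h, mul_smul])

theorem rankOneOp_apply (F G : C(ℝ, ℂ)) (f : L2Comp) :
    rankOneOp F G f = compPairing G f • toL2Loc F := rfl

/-- The operator with integral kernel `F(t) G(s) 1_{s ≤ t}`. -/
noncomputable def volterraOp (F G : C(ℝ, ℂ)) : L2Comp →ₗ[ℂ] L2Loc :=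
  toL2Loc ∘ₗ LinearMap.mulLeft ℂ F ∘ₗ compPrimitive G

theorem volterraOp_apply (F G : C(ℝ, ℂ)) (f : L2Comp) :
    volterraOp F G f = toL2Loc (F * compPrimitive G f) := rfl

open Classical in
/-- A continuous function, bundled (`0` if it is not continuous). -/
noncomputable def mkC (F : ℝ → ℂ) : C(ℝ, ℂ) := if h : Continuous F then ⟨F, h⟩ else 0

theorem coe_mkC {F : ℝ → ℂ} (h : Continuous F) : (mkC F : ℝ → ℂ) = F := by
  rw [mkC, dif_pos h]
  rfl

/-! ### Holomorphic families of operators -/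

/-- The primitive, as an operator from `L¹(ℝ)` to continuous functions on a compact interval. -/
noncomputable def primitiveL1 {A B : ℝ} (_h : A ≤ B) :
    Lp ℂ 1 (volume : Measure ℝ) →L[ℂ] C(Icc A B, ℂ) :=
  LinearMap.mkContinuous
    { toFun := fun f => ⟨fun t => ∫ s in A..t, f s, by
        have h1 : Continuous fun t => ∫ s in A..t, f s :=
          intervalIntegral.continuous_primitive
            (fun a b => (L1.integrable_coeFn f).intervalIntegrable) A
        exact h1.comp continuous_subtype_val⟩
      map_add' := fun f g => by
        ext t
        simp only [ContinuousMap.coe_mk, ContinuousMap.add_apply]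
        rw [← intervalIntegral.integral_add (L1.integrable_coeFn f).intervalIntegrable
          (L1.integrable_coeFn g).intervalIntegrable]
        refine intervalIntegral.integral_congr_ae ?_
        filter_upwards [Lp.coeFn_add f g] with s hs _
        exact hs
      map_smul' := fun c f => by
        ext t
        simp only [ContinuousMap.coe_mk, ContinuousMap.smul_apply, RingHom.id_apply, smul_eq_mul]
        rw [← intervalIntegral.integral_const_mul]
        refine intervalIntegral.integral_congr_ae ?_
        filter_upwards [Lp.coeFn_smul c f] with s hs _
        exact hs }
    1 fun f => by
      rw [one_mul]
      refine (ContinuousMap.norm_le _ (norm_nonneg _)).2 fun t => ?_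
      change ‖∫ s in A..t, f s‖ ≤ ‖f‖
      rw [L1.norm_eq_integral_norm, intervalIntegral.integral_of_le t.2.1]
      exact (norm_integral_le_integral_norm _).trans
        (setIntegral_le_integral (L1.integrable_coeFn f).norm (ae_of_all _ fun s => norm_nonneg _))

theorem primitiveL1_apply {A B : ℝ} (h : A ≤ B) (f : Lp ℂ 1 (volume : Measure ℝ)) (t : Icc A B) :
    primitiveL1 h f t = ∫ s in A..t, f s := rfl

/-- Multiplication `L² × L² → L¹`. -/
noncomputable def mulL2L1 : Lp ℂ 2 (volume : Measure ℝ) →L[ℂ] Lp ℂ 2 (volume : Measure ℝ) →L[ℂ]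
    Lp ℂ 1 (volume : Measure ℝ) :=
  (ContinuousLinearMap.mul ℂ ℂ).holderL volume 2 2 1

theorem mulL2L1_ae (f g : Lp ℂ 2 (volume : Measure ℝ)) :
    mulL2L1 f g =ᵐ[volume] fun s => f s * g s :=
  ContinuousLinearMap.coeFn_holder (ContinuousLinearMap.mul ℂ ℂ) (r := 1) f g

/-- Multiplication of continuous functions on a compact interval. -/
noncomputable def mulIcc (A B : ℝ) :
    C(Icc A B, ℂ) →L[ℂ] C(Icc A B, ℂ) →L[ℂ] C(Icc A B, ℂ) :=
  LinearMap.mkContinuous₂ (LinearMap.mul ℂ C(Icc A B, ℂ)) 1 fun F G => by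
    rw [one_mul]
    exact norm_mul_le F G

theorem differentiable_mulIcc (A B : ℝ) : Differentiable ℂ (mulIcc A B) :=
  ContinuousLinearMap.differentiable (E := C(Icc A B, ℂ))
    (F := C(Icc A B, ℂ) →L[ℂ] C(Icc A B, ℂ)) (mulIcc A B)

namespace HolomorphicFamilyOn

variable {B B' : ℂ → L2Comp →ₗ[ℂ] L2Loc} {U : Set ℂ}

theorem add (h : HolomorphicFamilyOn B U) (h' : HolomorphicFamilyOn B' U) :
    HolomorphicFamilyOn (fun lam => B lam + B' lam) U := fun M => by
  obtain ⟨T, hT, hT'⟩ := h M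
  obtain ⟨S, hS, hS'⟩ := h' M
  refine ⟨fun lam => T lam + S lam, hT.add hS, fun lam hl f hf => ?_⟩
  filter_upwards [hT' lam hl f hf, hS' lam hl f hf, Lp.coeFn_add (T lam f) (S lam f),
    AEEqFun.coeFn_add (B lam f : ℝ →ₘ[(volume : Measure ℝ)] ℂ) (B' lam f)] with t h1 h2 h3 h4
  refine h3.trans ?_
  rw [Pi.add_apply, h1, h2]
  by_cases ht : t ∈ Icc (-M) M
  · simp only [indicator_of_mem ht]
    exact h4.symm
  · simp only [indicator_of_notMem ht, add_zero]

theorem const_smul (c : ℂ) (h : HolomorphicFamilyOn B U) :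
    HolomorphicFamilyOn (fun lam => c • B lam) U := fun M => by
  obtain ⟨T, hT, hT'⟩ := h M
  refine ⟨fun lam => c • T lam, hT.const_smul c, fun lam hl f hf => ?_⟩
  filter_upwards [hT' lam hl f hf, Lp.coeFn_smul c (T lam f),
    AEEqFun.coeFn_smul c (B lam f : ℝ →ₘ[(volume : Measure ℝ)] ℂ)] with t h1 h3 h4
  refine h3.trans ?_
  rw [Pi.smul_apply, h1]
  by_cases ht : t ∈ Icc (-M) M
  · simp only [indicator_of_mem ht]
    exact h4.symm
  · simp only [indicator_of_notMem ht, smul_zero]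

theorem zero : HolomorphicFamilyOn (fun _ => 0) U := fun M => by
  refine ⟨fun _ => 0, differentiableOn_const _, fun lam _ f _ => ?_⟩
  filter_upwards [Lp.coeFn_zero ℂ 2 (volume : Measure ℝ),
    AEEqFun.coeFn_zero (μ := (volume : Measure ℝ)) (β := ℂ)] with t h1 h2
  refine h1.trans ?_
  by_cases ht : t ∈ Icc (-M) M
  · simp only [indicator_of_mem ht]
    exact h2.symm
  · simp only [indicator_of_notMem ht, Pi.zero_apply]

theorem sum {ι : Type*} (s : Finset ι) {C : ι → ℂ → L2Comp →ₗ[ℂ] L2Loc}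
    (h : ∀ i ∈ s, HolomorphicFamilyOn (C i) U) :
    HolomorphicFamilyOn (fun lam => ∑ i ∈ s, C i lam) U := by
  classical
  induction s using Finset.induction_on with
  | empty => simpa using zero
  | insert i s hi ih =>
    simp only [Finset.sum_insert hi]
    exact (h i (Finset.mem_insert_self i s)).add
      (ih fun j hj => h j (Finset.mem_insert_of_mem hj))

/-- It suffices to consider nondegenerate intervals. -/
theorem of_nonneg (h : ∀ M : ℝ, 0 ≤ M →
    ∃ T : ℂ → Lp ℂ 2 (volume : Measure ℝ) →L[ℂ] Lp ℂ 2 (volume : Measure ℝ),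
    DifferentiableOn ℂ T U ∧
    ∀ lam ∈ U, ∀ f : L2Comp, VanishesOutside M (f : Lp ℂ 2 (volume : Measure ℝ)) →
      T lam f =ᵐ[volume] (Icc (-M) M).indicator (B lam f : ℝ →ₘ[(volume : Measure ℝ)] ℂ)) :
    HolomorphicFamilyOn B U := fun M => by
  rcases le_or_gt 0 M with hM | hM
  · exact h M hM
  · refine ⟨fun _ => 0, differentiableOn_const _, fun lam _ f _ => ?_⟩
    rw [Icc_eq_empty (by linarith), indicator_empty]
    exact Lp.coeFn_zero ℂ 2 (volume : Measure ℝ)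

/-- On `[-M, M]` the operator factors into multiplication by `G`, the primitive from `L¹` to
continuous functions, multiplication by `F`, and extension by zero. Only the two multiplications
depend on `λ`, and they do so holomorphically in norm. -/
theorem volterraOp {F G : ℂ → ℝ → ℂ} (hF : HolFamOn U F) (hG : HolFamOn U G) :
    HolomorphicFamilyOn (fun lam => _root_.volterraOp (mkC (F lam)) (mkC (G lam))) U := by
  refine of_nonneg fun M hM => ?_
  have hM' : -M ≤ M := by linarith
  obtain ⟨Φ, hΦ, hΦ'⟩ := hF (-M) M
  obtain ⟨Ψ, hΨ, hΨ'⟩ := hG (-M) M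
  refine ⟨fun lam => extendL2 volume hM' ∘L
    (mulIcc (-M) M (Φ lam) ∘L
      (primitiveL1 hM' ∘L mulL2L1 (extendL2 volume hM' (Ψ lam)))), ?_, fun lam hl f hf => ?_⟩
  · have h1 : DifferentiableOn ℂ (fun lam => mulIcc (-M) M (Φ lam)) U :=
      Differentiable.comp_differentiableOn (F := C(Icc (-M) M, ℂ))
        (G := C(Icc (-M) M, ℂ) →L[ℂ] C(Icc (-M) M, ℂ)) (differentiable_mulIcc (-M) M) hΦ
    have h2 : DifferentiableOn ℂ (fun lam => mulL2L1 (extendL2 volume hM' (Ψ lam))) U :=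
      (mulL2L1.differentiable.comp (extendL2 volume hM').differentiable).comp_differentiableOn hΨ
    exact (differentiableOn_const _).clm_comp (h1.clm_comp ((differentiableOn_const _).clm_comp h2))
  · have hFc := hF.continuous hl
    have hGc := hG.continuous hl
    set X := primitiveL1 hM' (mulL2L1 (extendL2 volume hM' (Ψ lam)) f) with hX
    have hv : ∀ᵐ s, s ∉ Icc (-M) M → G lam s * (f : Lp ℂ 2 (volume : Measure ℝ)) s = 0 := by
      filter_upwards [hf] with s hs h
      rw [hs h, mul_zero]
    have hXt : ∀ t : Icc (-M) M, X t = ∫ s in Iic (t : ℝ),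
        G lam s * (f : Lp ℂ 2 (volume : Measure ℝ)) s := by
      intro t
      rw [hX, primitiveL1_apply, integral_Iic_of_ae_eq_zero
        (locallyIntegrable_continuous_mul hGc (Lp_locallyIntegrable _)) hv]
      refine intervalIntegral.integral_congr_ae ?_
      filter_upwards [mulL2L1_ae (extendL2 volume hM' (Ψ lam)) f,
        extendL2_ae (μ := volume) hM' (Ψ lam)] with s h1 h2 h3
      rw [uIoc_of_le t.2.1] at h3
      have h4 : s ∈ Icc (-M) M := ⟨h3.1.le, h3.2.trans t.2.2⟩
      rw [h1, h2, indicator_of_mem h4, IccExtend_of_mem _ _ h4, hΨ' lam hl]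
    filter_upwards [extendL2_ae (μ := volume) hM' (Φ lam * X),
      toL2Loc_ae (mkC (F lam) * compPrimitive (mkC (G lam)) f)] with t h1 h2
    refine h1.trans ?_
    by_cases ht : t ∈ Icc (-M) M
    · rw [indicator_of_mem ht, indicator_of_mem ht, volterraOp_apply, h2, IccExtend_of_mem _ _ ht,
        ContinuousMap.mul_apply, ContinuousMap.mul_apply, hΦ' lam hl, hXt, compPrimitive_apply,
        coe_mkC hFc, coe_mkC hGc]
    · rw [indicator_of_notMem ht, indicator_of_notMem ht]

theorem rankOneOp {F G : ℂ → ℝ → ℂ} (hF : HolFamOn U F) (hG : HolFamOn U G) :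
    HolomorphicFamilyOn (fun lam => _root_.rankOneOp (mkC (F lam)) (mkC (G lam))) U := by
  refine of_nonneg fun M hM => ?_
  have hM' : -M ≤ M := by linarith
  obtain ⟨Φ, hΦ, hΦ'⟩ := hF (-M) M
  obtain ⟨Ψ, hΨ, hΨ'⟩ := hG (-M) M
  -- The full integral is the value of the primitive at the right endpoint.
  set e : C(Icc (-M) M, ℂ) →L[ℂ] ℂ := ContinuousMap.evalCLM ℂ (⟨M, right_mem_Icc.2 hM'⟩ : Icc (-M) M)
  refine ⟨fun lam => ContinuousLinearMap.smulRightL ℂ (Lp ℂ 2 (volume : Measure ℝ))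
    (Lp ℂ 2 (volume : Measure ℝ))
    (e ∘L (primitiveL1 hM' ∘L mulL2L1 (extendL2 volume hM' (Ψ lam))))
    (extendL2 volume hM' (Φ lam)), ?_, fun lam hl f hf => ?_⟩
  · have h1 : DifferentiableOn ℂ (fun lam => extendL2 volume hM' (Φ lam)) U :=
      (extendL2 volume hM').differentiable.comp_differentiableOn hΦ
    have h2 : DifferentiableOn ℂ (fun lam => mulL2L1 (extendL2 volume hM' (Ψ lam))) U :=
      (mulL2L1.differentiable.comp (extendL2 volume hM').differentiable).comp_differentiableOn hΨ
    have h3 := (differentiableOn_const e (s := U)).clm_comp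
      ((differentiableOn_const (primitiveL1 hM') (s := U)).clm_comp h2)
    exact DifferentiableOn.clm_apply
      ((ContinuousLinearMap.differentiable _).comp_differentiableOn h3) h1
  · have hFc := hF.continuous hl
    have hGc := hG.continuous hl
    set X := primitiveL1 hM' (mulL2L1 (extendL2 volume hM' (Ψ lam)) f) with hX
    have hXt : e X = ∫ s, G lam s * (f : Lp ℂ 2 (volume : Measure ℝ)) s := by
      have h0 : e X = ∫ s in (-M)..M, mulL2L1 (extendL2 volume hM' (Ψ lam)) f s := rfl
      rw [h0, intervalIntegral.integral_of_le hM', ← integral_Icc_eq_integral_Ioc,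
        ← setIntegral_eq_integral_of_ae_compl_eq_zero (s := Icc (-M) M)
          (f := fun s => G lam s * (f : Lp ℂ 2 (volume : Measure ℝ)) s)]
      · refine setIntegral_congr_ae measurableSet_Icc ?_
        filter_upwards [mulL2L1_ae (extendL2 volume hM' (Ψ lam)) f,
          extendL2_ae (μ := volume) hM' (Ψ lam)] with s h1 h2 h4
        rw [h1, h2, indicator_of_mem h4, IccExtend_of_mem _ _ h4, hΨ' lam hl]
      · filter_upwards [hf] with s hs h
        rw [hs h, mul_zero]
    filter_upwards [Lp.coeFn_smul (e X) (extendL2 volume hM' (Φ lam)),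
      extendL2_ae (μ := volume) hM' (Φ lam), toL2Loc_ae (mkC (F lam)),
      AEEqFun.coeFn_smul (compPairing (mkC (G lam)) f)
        (toL2Loc (mkC (F lam)) : ℝ →ₘ[(volume : Measure ℝ)] ℂ)] with t h1 h2 h3 h4
    refine h1.trans ?_
    rw [Pi.smul_apply, h2]
    by_cases ht : t ∈ Icc (-M) M
    · rw [indicator_of_mem ht, indicator_of_mem ht, IccExtend_of_mem _ _ ht, rankOneOp_apply]
      refine Eq.trans ?_ h4.symm
      rw [Pi.smul_apply, h3, hXt, compPairing_apply, coe_mkC hFc, coe_mkC hGc, hΦ' lam hl]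
    · rw [indicator_of_notMem ht, indicator_of_notMem ht, smul_zero]

end HolomorphicFamilyOn

/-! ### The scattering resolvent on the real line -/

/-- Expand `m` to order `n`, and in the term of order `l` expand `h` to order `n - l`; every
remainder then loses its negative power of `x`. The terms with `l + k = n - 1 - j` form the
coefficient of `x^{-(j+1)}`. -/
theorem laurent_bilinear {E F G : Type*} [AddCommMonoid E] [Module ℂ E] [AddCommMonoid F]
    [Module ℂ F] [AddCommMonoid G] [Module ℂ G] (ρ : E →ₗ[ℂ] F →ₗ[ℂ] G) (n : ℕ) {x : ℂ}
    (hx : x ≠ 0) (b : ℕ → E) {m r : E} (hm : m = ∑ l ∈ Finset.range n, x ^ l • b l + x ^ n • r)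
    (a s : ℕ → F) {h : F} (hh : ∀ N, h = ∑ k ∈ Finset.range N, x ^ k • a k + x ^ N • s N) :
    (x ^ n)⁻¹ • ρ m h =
      ∑ j : Fin n, (x ^ ((j : ℕ) + 1))⁻¹ •
        ∑ l ∈ Finset.range (n - j), ρ (b l) (a (n - 1 - j - l)) +
      (∑ l ∈ Finset.range n, ρ (b l) (s (n - l)) + ρ r h) := by
  have h1 : (x ^ n)⁻¹ • ρ m h = ∑ l ∈ Finset.range n, ((x ^ n)⁻¹ * x ^ l) • ρ (b l) h + ρ r h := by
    rw [hm]
    simp only [map_add, map_sum, map_smul, LinearMap.add_apply, LinearMap.sum_apply,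
      LinearMap.smul_apply, smul_add, Finset.smul_sum, smul_smul]
    rw [inv_mul_cancel₀ (pow_ne_zero n hx), one_smul]
  have h2 : ∀ l ∈ Finset.range n, ((x ^ n)⁻¹ * x ^ l) • ρ (b l) h =
      ∑ k ∈ Finset.range (n - l), (x ^ (n - 1 - l - k + 1))⁻¹ • ρ (b l) (a k) +
        ρ (b l) (s (n - l)) := by
    intro l hl
    rw [Finset.mem_range] at hl
    conv_lhs => rw [hh (n - l)]
    simp only [map_add, map_sum, map_smul, smul_add, Finset.smul_sum, smul_smul]
    congr 1
    · refine Finset.sum_congr rfl fun k hk => ?_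
      rw [Finset.mem_range] at hk
      congr 1
      have e : n = (n - 1 - l - k + 1) + l + k := by omega
      have h3 : x ^ n = x ^ (n - 1 - l - k + 1) * x ^ l * x ^ k := by
        rw [← pow_add, ← pow_add, ← e]
      rw [h3]
      field_simp
    · rw [mul_assoc, ← pow_add, Nat.add_sub_cancel' hl.le, inv_mul_cancel₀ (pow_ne_zero n hx),
        one_smul]
  rw [h1, Finset.sum_congr rfl h2, Finset.sum_add_distrib, add_assoc,
    ← Finset.sum_range fun j => (x ^ (j + 1))⁻¹ •
        ∑ l ∈ Finset.range (n - j), ρ (b l) (a (n - 1 - j - l))]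
  congr 1
  simp only [Finset.smul_sum]
  rw [Finset.sum_sigma', Finset.sum_sigma']
  -- Reindexing from the pair of Taylor orders `(l, k)` to the pair `(j, l)` with `j = n - 1 - l -
  -- k`.
  refine Finset.sum_nbij' (fun y => ⟨n - 1 - y.1 - y.2, y.1⟩) (fun y => ⟨y.2, n - 1 - y.1 - y.2⟩)
    ?_ ?_ ?_ ?_ ?_
  · rintro ⟨l, k⟩ h
    simp only [Finset.mem_sigma, Finset.mem_range] at h ⊢
    omega
  · rintro ⟨l, k⟩ h
    simp only [Finset.mem_sigma, Finset.mem_range] at h ⊢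
    omega
  · rintro ⟨l, k⟩ h
    simp only [Finset.mem_sigma, Finset.mem_range] at h ⊢
    congr 1
    omega
  · rintro ⟨l, k⟩ h
    simp only [Finset.mem_sigma, Finset.mem_range] at h ⊢
    congr 1
    omega
  · rintro ⟨l, k⟩ h
    simp only [Finset.mem_sigma, Finset.mem_range] at h ⊢
    have e : n - 1 - (n - 1 - l - k) - l = k := by omega
    rw [e]

/-- The system is triangular: `A (n - 1 - l)` applied to `f` is `α 0 f • b l` plus a combination of
the `b k` with `k < l`, so the vectors are recovered successively. -/
theorem iSup_range_eq_span {M N : Type*} [AddCommMonoid M] [Module ℂ M] [AddCommMonoid N]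
    [Module ℂ N] {n : ℕ} (A : Fin n → M →ₗ[ℂ] N) (b : ℕ → N) (α : ℕ → M → ℂ)
    (hA : ∀ j f, A j f = ∑ l ∈ Finset.range (n - j), α (n - 1 - j - l) f • b l)
    (hα : ∃ f, α 0 f ≠ 0) :
    (⨆ j, LinearMap.range (A j)) = Submodule.span ℂ (range fun l : Fin n => b l) := by
  let _ : AddCommGroup N := Module.addCommMonoidToAddCommGroup ℂ
  apply le_antisymm
  · refine iSup_le fun j => ?_
    rintro _ ⟨f, rfl⟩
    rw [hA]
    refine Submodule.sum_mem _ fun l hl => Submodule.smul_mem _ _ (Submodule.subset_span ?_)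
    rw [Finset.mem_range] at hl
    exact ⟨⟨l, by omega⟩, rfl⟩
  · obtain ⟨f, hf⟩ := hα
    rw [Submodule.span_le]
    rintro _ ⟨⟨l, hl⟩, rfl⟩
    simp only [SetLike.mem_coe]
    induction l using Nat.strong_induction_on with
    | _ l ih =>
      have h1 := hA ⟨n - 1 - l, by omega⟩ f
      have e : n - (n - 1 - l) = l + 1 := by omega
      have e' : n - 1 - (n - 1 - l) - l = 0 := by omega
      simp only at h1
      rw [e, Finset.sum_range_succ, e'] at h1
      have h2 : α 0 f • b l ∈ ⨆ j, LinearMap.range (A j) := by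
        rw [eq_sub_of_add_eq' h1.symm]
        refine Submodule.sub_mem _ (Submodule.mem_iSup_of_mem ⟨n - 1 - l, by omega⟩ ⟨f, rfl⟩)
          (Submodule.sum_mem _ fun k hk => Submodule.smul_mem _ _ ?_)
        rw [Finset.mem_range] at hk
        exact ih k hk (hk.trans hl)
      exact (Submodule.smul_mem_iff _ hf).1 h2

theorem finite_range_of_iSup_eq_span {ι κ M N : Type*} [Finite κ] [AddCommMonoid M] [Module ℂ M]
    [AddCommMonoid N] [Module ℂ N] (A : ι → M →ₗ[ℂ] N) {b : κ → N}
    (h : (⨆ j, LinearMap.range (A j)) = Submodule.span ℂ (range b)) (j : ι) :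
    Module.Finite ℂ (LinearMap.range (A j)) := by
  let _ : AddCommGroup N := Module.addCommMonoidToAddCommGroup ℂ
  have : FiniteDimensional ℂ (⨆ j, LinearMap.range (A j) : Submodule ℂ N) := by
    rw [h]
    exact FiniteDimensional.span_of_finite ℂ (finite_range _)
  exact Submodule.finiteDimensional_of_le (le_iSup (fun j => LinearMap.range (A j)) j)

theorem finrank_iSup_range_of_linearIndependent {ι κ M N : Type*} [Fintype κ] [AddCommMonoid M]
    [Module ℂ M] [AddCommMonoid N] [Module ℂ N] {A : ι → M →ₗ[ℂ] N} {b : κ → N}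
    (h : (⨆ j, LinearMap.range (A j)) = Submodule.span ℂ (range b)) (hb : LinearIndependent ℂ b) :
    Module.finrank ℂ (⨆ j, LinearMap.range (A j) : Submodule ℂ N) = Fintype.card κ := by
  let _ : AddCommGroup N := Module.addCommMonoidToAddCommGroup ℂ
  rw [h, finrank_span_eq_card hb]

theorem taylorRem_cexp (k z₀ : ℂ) (l : ℕ) :
    taylorRem (fun z => Complex.exp (k * z)) z₀ l z₀ =
      k ^ l / l.factorial * Complex.exp (k * z₀) := by
  have h1 : AnalyticAt ℂ (fun z => Complex.exp (k * z)) z₀ := by fun_prop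
  have h2 := h1.hasFPowerSeriesAt.has_fpower_series_iterate_dslope_fslope l
  have h3 := h2.coeff_zero 1
  have h4 := FormalMultilinearSeries.coeff_iterate_fslope
    (p := FormalMultilinearSeries.ofScalars ℂ
      (fun n => iteratedDeriv n (fun z => Complex.exp (k * z)) z₀ / n.factorial)) l 0
  rw [FormalMultilinearSeries.coeff_ofScalars, zero_add, iteratedDeriv_cexp_const_mul] at h4
  rw [taylorRem]
  refine h3.symm.trans (h4.trans ?_)
  simp only
  ring

/-- The conjugate of `u`, cut off to `[b, b + 1]`, pairs to a positive number. -/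
theorem exists_compPairing_ne_zero (u : C(ℝ, ℂ)) {b : ℝ} (hb : u b ≠ 0) :
    ∃ f : L2Comp, compPairing u f ≠ 0 := by
  set F : ℝ → ℂ := fun t => (starRingEnd ℂ) (u t) with hF
  have hFc : Continuous F := Complex.continuous_conj.comp u.continuous
  have hm := memLp_indicator_Icc (μ := (volume : Measure ℝ)) hFc b (b + 1)
  refine ⟨⟨hm.toLp _, |b| + 1, ?_⟩, ?_⟩
  · filter_upwards [hm.coeFn_toLp] with t ht h0
    rw [ht, indicator_of_notMem]
    refine fun h => h0 ⟨?_, ?_⟩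
    · linarith [h.1, neg_abs_le b]
    · linarith [h.2, le_abs_self b]
  · have h1 : compPairing u ⟨hm.toLp _, |b| + 1, by
          filter_upwards [hm.coeFn_toLp] with t ht h0
          rw [ht, indicator_of_notMem]
          refine fun h => h0 ⟨?_, ?_⟩
          · linarith [h.1, neg_abs_le b]
          · linarith [h.2, le_abs_self b]⟩ =
        ((∫ y in b..b + 1, Complex.normSq (u y) : ℝ) : ℂ) := by
      rw [compPairing_apply, ← intervalIntegral.integral_ofReal,
        intervalIntegral.integral_of_le (by linarith), ← integral_Icc_eq_integral_Ioc,
        ← integral_indicator measurableSet_Icc]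
      refine integral_congr_ae ?_
      filter_upwards [hm.coeFn_toLp] with t ht
      rw [ht]
      by_cases hmem : t ∈ Icc b (b + 1)
      · rw [indicator_of_mem hmem, indicator_of_mem hmem, Complex.mul_conj]
      · rw [indicator_of_notMem hmem, indicator_of_notMem hmem, mul_zero]
    rw [h1, Complex.ofReal_ne_zero]
    refine (intervalIntegral.integral_pos (by linarith) ?_ (fun y _ => Complex.normSq_nonneg _)
      ⟨b, ⟨le_rfl, by linarith⟩, Complex.normSq_pos.2 hb⟩).ne'
    exact (Complex.continuous_normSq.comp u.continuous).continuousOn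

theorem iSup_range_sum_rankOneOp (n : ℕ) (β α : ℕ → C(ℝ, ℂ)) (hα : ∃ f, compPairing (α 0) f ≠ 0) :
    (⨆ j : Fin n, LinearMap.range
      (∑ l ∈ Finset.range (n - j), rankOneOp (β l) (α (n - 1 - j - l)))) =
      Submodule.span ℂ (range fun l : Fin n => toL2Loc (β l)) := by
  refine iSup_range_eq_span _ (fun l => toL2Loc (β l)) (fun k f => compPairing (α k) f)
    (fun j f => ?_) hα
  rw [LinearMap.sum_apply]
  simp only [rankOneOp_apply]

namespace SimpleCurve.Jost

variable {q : ℝ → ℂ} {a b : ℝ} (J : realLine.Jost q a b)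

/-- The part of the resolvent which is entire in the spectral parameter. -/
noncomputable def volterraResolvent (lam : ℂ) : L2Comp →ₗ[ℂ] L2Loc :=
  volterraOp (mkC (J.c.u lam)) (mkC (J.s.u lam)) +
    (-1 : ℂ) • volterraOp (mkC (J.s.u lam)) (mkC (J.c.u lam))

/-- The scattering resolvent. -/
noncomputable def scatteringResolvent (lam : ℂ) : L2Comp →ₗ[ℂ] L2Loc :=
  J.volterraResolvent lam + (J.W lam)⁻¹ • rankOneOp (mkC (J.m.u lam)) (mkC (J.p.u lam))

theorem holomorphicFamilyOn_volterraResolvent (U : Set ℂ) :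
    HolomorphicFamilyOn J.volterraResolvent U :=
  (HolomorphicFamilyOn.volterraOp (J.c.hol_u.mono (subset_univ U))
    (J.s.hol_u.mono (subset_univ U))).add
    ((HolomorphicFamilyOn.volterraOp (J.s.hol_u.mono (subset_univ U))
      (J.c.hol_u.mono (subset_univ U))).const_smul (-1))

theorem memLp_arcLength {f : ℝ → ℂ} (hf : MemLp f 2 volume) : MemLp f 2 realLine.arcLength := by
  rwa [realLine.arcLength_eq]

theorem volterraOp_ae {F G : ℝ → ℂ} (hF : Continuous F) (hG : Continuous G) {M : ℝ} {f : L2Comp}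
    (hf : VanishesOutside M (f : Lp ℂ 2 (volume : Measure ℝ))) :
    (volterraOp (mkC F) (mkC G) f : ℝ →ₘ[(volume : Measure ℝ)] ℂ) =ᵐ[volume]
      fun t => F t * ∫ s in (-M)..t, G s * (f : Lp ℂ 2 (volume : Measure ℝ)) s := by
  filter_upwards [toL2Loc_ae (mkC F * compPrimitive (mkC G) f)] with t ht
  rw [volterraOp_apply, ht, ContinuousMap.mul_apply, compPrimitive_apply, coe_mkC hF, coe_mkC hG,
    integral_Iic_of_ae_eq_zero (A := -M) (B := M)
      (locallyIntegrable_continuous_mul hG (Lp_locallyIntegrable _))]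
  filter_upwards [hf] with s hs h
  rw [hs h, mul_zero]

theorem compPairing_mkC {G : ℝ → ℂ} (hG : Continuous G) {M : ℝ} (hM : 0 ≤ M) {f : L2Comp}
    (hf : VanishesOutside M (f : Lp ℂ 2 (volume : Measure ℝ))) :
    compPairing (mkC G) f = ∫ s in (-M)..M, G s * (f : Lp ℂ 2 (volume : Measure ℝ)) s := by
  rw [compPairing_apply, coe_mkC hG, intervalIntegral.integral_of_le (by linarith),
    ← integral_Icc_eq_integral_Ioc, setIntegral_eq_integral_of_ae_compl_eq_zero]
  filter_upwards [hf] with s hs h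
  rw [hs h, mul_zero]

theorem _root_.VanishesOutside.mono {M M' : ℝ} {f : ℝ → ℂ} (h : VanishesOutside M f)
    (hM : M ≤ M') : VanishesOutside M' f := by
  filter_upwards [h] with x hx h'
  exact hx fun hm => h' ⟨by linarith [hm.1], by linarith [hm.2]⟩

/-- This links the formula that continues to all of `ℂ` with the Green operator, whose square
integrability is known for `Im λ > 0`. -/
theorem scatteringResolvent_ae {lam : ℂ} (hW : J.W lam ≠ 0) (f : L2Comp) :
    (J.scatteringResolvent lam f : ℝ →ₘ[(volume : Measure ℝ)] ℂ) =ᵐ[volume]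
      J.greenU lam (f : Lp ℂ 2 (volume : Measure ℝ)) := by
  obtain ⟨M₀, hM₀⟩ := f.2
  obtain ⟨M, hM, hfM⟩ : ∃ M, 0 ≤ M ∧ VanishesOutside M (f : Lp ℂ 2 (volume : Measure ℝ)) :=
    ⟨|M₀|, abs_nonneg _, VanishesOutside.mono hM₀ (le_abs_self _)⟩
  have hc := (J.c.sol lam).1.continuous
  have hs := (J.s.sol lam).1.continuous
  have hm := (J.m.sol lam).1.continuous
  have hp := (J.p.sol lam).1.continuous
  set X := volterraOp (mkC (J.c.u lam)) (mkC (J.s.u lam)) f with hX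
  set Y := volterraOp (mkC (J.s.u lam)) (mkC (J.c.u lam)) f with hY
  set k := compPairing (mkC (J.p.u lam)) f with hk
  have e : (J.scatteringResolvent lam f : ℝ →ₘ[(volume : Measure ℝ)] ℂ) =
    ((X : ℝ →ₘ[(volume : Measure ℝ)] ℂ) + (-1 : ℂ) • (Y : ℝ →ₘ[(volume : Measure ℝ)] ℂ)) +
      (J.W lam)⁻¹ • (k • (toL2Loc (mkC (J.m.u lam)) : ℝ →ₘ[(volume : Measure ℝ)] ℂ)) := rfl
  rw [e]
  have hk' := compPairing_mkC hp hM hfM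
  rw [← hk] at hk'
  filter_upwards [AEEqFun.coeFn_add ((X : ℝ →ₘ[(volume : Measure ℝ)] ℂ) +
      (-1 : ℂ) • (Y : ℝ →ₘ[(volume : Measure ℝ)] ℂ))
      ((J.W lam)⁻¹ • (k • (toL2Loc (mkC (J.m.u lam)) : ℝ →ₘ[(volume : Measure ℝ)] ℂ))),
    AEEqFun.coeFn_add (X : ℝ →ₘ[(volume : Measure ℝ)] ℂ)
      ((-1 : ℂ) • (Y : ℝ →ₘ[(volume : Measure ℝ)] ℂ)),
    AEEqFun.coeFn_smul (-1 : ℂ) (Y : ℝ →ₘ[(volume : Measure ℝ)] ℂ),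
    AEEqFun.coeFn_smul (J.W lam)⁻¹
      (k • (toL2Loc (mkC (J.m.u lam)) : ℝ →ₘ[(volume : Measure ℝ)] ℂ)),
    AEEqFun.coeFn_smul k (toL2Loc (mkC (J.m.u lam)) : ℝ →ₘ[(volume : Measure ℝ)] ℂ),
    volterraOp_ae hc hs hfM, volterraOp_ae hs hc hfM, toL2Loc_ae (mkC (J.m.u lam))]
    with t h1 h2 h3 h4 h5 h6 h7 h8
  rw [J.greenU_eq hW (memLp_arcLength (Lp.memLp _)) hfM t, h1,
    Pi.add_apply, h2, Pi.add_apply, h3, Pi.smul_apply, h4, Pi.smul_apply, h5, Pi.smul_apply, h6, h7,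
    h8, coe_mkC hm, hk', volterraPart, pairing]
  simp only [realLine.deriv_γ, one_mul, smul_eq_mul]
  ring

theorem isH2Solution_scatteringResolvent (hq : IsCompPotential q a b) {lam : ℂ}
    (him : 0 < lam.im) (hW : J.W lam ≠ 0) (f : L2Comp) :
    IsH2Solution q lam (J.scatteringResolvent lam f : ℝ →ₘ[(volume : Measure ℝ)] ℂ)
      (f : Lp ℂ 2 (volume : Measure ℝ)) := by
  have hlam : lam ≠ 0 := by
    rintro rfl
    simp at him
  have hκ : 0 < (lam * Complex.exp ((0 : ℝ) * Complex.I)).im := by simpa using him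
  have hf := memLp_arcLength (Lp.memLp (f : Lp ℂ 2 (volume : Measure ℝ)))
  have hsol := J.isSolutionOf_green hq realLine.hasStraightEnds hlam hκ hf hW
  obtain ⟨C, hC, hb⟩ := J.exists_green_bound hq realLine.hasStraightEnds hlam hκ
  have hb' := hb _ hf
  rw [realLine.arcLength_eq] at hb'
  have hlt : C * eLpNorm (f : Lp ℂ 2 (volume : Measure ℝ)) 2 volume < ∞ :=
    ENNReal.mul_lt_top hC.lt_top (Lp.memLp (f : Lp ℂ 2 (volume : Measure ℝ))).2
  have hu : MemLp (J.greenU lam (f : Lp ℂ 2 (volume : Measure ℝ))) 2 volume :=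
    ⟨hsol.1.continuous.aestronglyMeasurable, hb'.1.trans_lt hlt⟩
  have hv : MemLp (J.greenV lam (f : Lp ℂ 2 (volume : Measure ℝ))) 2 volume :=
    ⟨hsol.2.continuous.aestronglyMeasurable, hb'.2.trans_lt hlt⟩
  have hae := J.scatteringResolvent_ae hW f
  obtain ⟨Q, hQ⟩ := hq.bdd
  have hqL : MemLp q ∞ volume := memLp_top_of_bound hq.meas Q hQ
  have hw : MemLp (fun t => q t * J.greenU lam (f : Lp ℂ 2 (volume : Measure ℝ)) t -
      lam ^ 2 * J.greenU lam (f : Lp ℂ 2 (volume : Measure ℝ)) t -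
        (f : Lp ℂ 2 (volume : Measure ℝ)) t) 2 volume :=
    ((hu.mul hqL).sub (hu.const_mul (lam ^ 2))).sub (Lp.memLp _)
  refine ⟨_, _, (memLp_congr_ae hae).2 hu, hv, hw, ?_, ?_, ?_⟩
  · refine hsol.1.hasWeakDeriv.congr hae.symm (ae_of_all _ fun t => ?_)
    simp
  · refine hsol.2.hasWeakDeriv.congr (ae_of_all _ fun t => rfl) (ae_of_all _ fun t => ?_)
    simp only [realLine.deriv_γ]
    ring
  · filter_upwards [hae] with t ht
    rw [ht]
    ring

/-- Taylor coefficients of the Jost solution `m` at `lam₀`. -/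
noncomputable def coeffM (lam₀ : ℂ) (l : ℕ) : C(ℝ, ℂ) :=
  mkC fun t => taylorRem (fun z => J.m.u z t) lam₀ l lam₀

theorem coeffM_apply (lam₀ : ℂ) (l : ℕ) (t : ℝ) :
    J.coeffM lam₀ l t = taylorRem (fun z => J.m.u z t) lam₀ l lam₀ := by
  rw [coeffM, coe_mkC ((J.m.hol_u.taylorRem univ_mem l).continuous (mem_univ lam₀))]

/-- To the left of the potential `m` is `e^{-iλt}`, so a linear relation between its Taylor
coefficients becomes a polynomial in `-it` vanishing on a half-line. -/
theorem linearIndependent_coeffM (hq : IsCompPotential q a b) (lam₀ : ℂ) (n : ℕ) :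
    LinearIndependent ℂ fun l : Fin n => J.coeffM lam₀ l := by
  rw [Fintype.linearIndependent_iff]
  intro k hk i
  have h1 : ∀ t ≤ a, ∑ l : Fin n, k l * ((-(Complex.I * t)) ^ (l : ℕ) / (l : ℕ).factorial) = 0 := by
    intro t ht
    have h2 := DFunLike.congr_fun hk t
    simp only [ContinuousMap.coe_sum, ContinuousMap.coe_smul, Finset.sum_apply, Pi.smul_apply,
      ContinuousMap.zero_apply, coeffM_apply, smul_eq_mul] at h2
    have h3 : (fun z => J.m.u z t) = fun z => Complex.exp (-(Complex.I * t) * z) := by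
      ext z
      rw [(J.m_left hq z ht).1, realLine.γ_apply]
      congr 1
      ring
    rw [h3] at h2
    simp only [taylorRem_cexp, ← mul_assoc] at h2
    rw [← Finset.sum_mul] at h2
    exact (mul_eq_zero.1 h2).resolve_right (Complex.exp_ne_zero _)
  set P : Polynomial ℂ := ∑ l : Fin n, Polynomial.monomial (l : ℕ) (k l / (l : ℕ).factorial) with hP
  have hroot : ∀ t ≤ a, P.IsRoot (-(Complex.I * t)) := by
    intro t ht
    rw [Polynomial.IsRoot, hP, Polynomial.eval_finsetSum, ← h1 t ht]
    refine Finset.sum_congr rfl fun l _ => ?_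
    rw [Polynomial.eval_monomial]
    ring
  have hinf : Set.Infinite {x | P.IsRoot x} := by
    have hinj : Function.Injective fun t : ℝ => -(Complex.I * (t : ℂ)) := fun s t h => by
      simpa using h
    exact ((Set.Iic_infinite a).image hinj.injOn).mono (by
      rintro _ ⟨t, ht, rfl⟩
      exact hroot t ht)
  have h0 := congrArg (fun R => Polynomial.coeff R (i : ℕ)) (P.eq_zero_of_infinite_isRoot hinf)
  simp only [hP, Polynomial.finsetSum_coeff, Polynomial.coeff_monomial, Polynomial.coeff_zero,
    Fin.val_inj, Finset.sum_ite_eq', Finset.mem_univ, if_true, div_eq_zero_iff,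
    Nat.cast_eq_zero, Nat.factorial_ne_zero, or_false] at h0
  exact h0

variable {lam₀ : ℂ} {n : ℕ} {g : ℂ → ℂ}

/-- The singular part is `(ζ - λ₀)^{-n}` times a rank one kernel that is holomorphic near `λ₀`. Its
polar coefficients are triangular in the Taylor coefficients of `m`, which are independent, so the
multiplicity equals the order of the zero. -/
theorem exists_hasLaurentExpansion (hq : IsCompPotential q a b) (hg : Differentiable ℂ g)
    (hWg : ∀ ζ, J.W ζ = (ζ - lam₀) ^ n * g ζ) (hg0 : g lam₀ ≠ 0) :
    ∃ A : Fin n → L2Comp →ₗ[ℂ] L2Loc,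
      HasLaurentExpansion J.scatteringResolvent lam₀ A ∧ polarMultiplicity A = n := by
  set U : Set ℂ := {ζ | g ζ ≠ 0} with hU
  have hUo : IsOpen U := isOpen_ne_fun hg.continuous continuous_const
  have hUn : U ∈ 𝓝 lam₀ := hUo.mem_nhds hg0
  -- The nonvanishing factor of the Wronskian is absorbed into `p`, leaving a pure power of `ζ -
  -- λ₀`.
  set h : ℂ → ℝ → ℂ := fun ζ t => (g ζ)⁻¹ * J.p.u ζ t with hh
  have hhol : HolFamOn U h :=
    HolFamOn.const_mul (hg.differentiableOn.inv fun ζ hζ => hζ) (J.p.hol_u.mono (subset_univ U))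
  have hm := J.m.hol_u.mono (subset_univ U)
  set α : ℕ → C(ℝ, ℂ) := fun k => mkC fun t => taylorRem (fun z => h z t) lam₀ k lam₀ with hα
  have hαa : ∀ k t, α k t = taylorRem (fun z => h z t) lam₀ k lam₀ := fun k t => by
    rw [hα, coe_mkC ((hhol.taylorRem hUn k).continuous hg0)]
  set A : Fin n → L2Comp →ₗ[ℂ] L2Loc := fun j =>
    ∑ l ∈ Finset.range (n - j), rankOneOp (J.coeffM lam₀ l) (α (n - 1 - j - l)) with hA
  have hspan : (⨆ j, LinearMap.range (A j)) =
      Submodule.span ℂ (range fun l : Fin n => toL2Loc (J.coeffM lam₀ l)) := by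
    refine iSup_range_sum_rankOneOp n (J.coeffM lam₀) α (exists_compPairing_ne_zero (α 0) (b := b) ?_)
    rw [hαa]
    change (g lam₀)⁻¹ * J.p.u lam₀ b ≠ 0
    rw [(J.p_b lam₀).1]
    exact mul_ne_zero (inv_ne_zero hg0) (Complex.exp_ne_zero _)
  refine ⟨A, ⟨fun j => ?_, fun ζ => J.volterraResolvent ζ +
      (∑ l ∈ Finset.range n, rankOneOp (J.coeffM lam₀ l)
        (mkC fun t => taylorRem (fun z => h z t) lam₀ (n - l) ζ) +
        rankOneOp (mkC fun t => taylorRem (fun z => J.m.u z t) lam₀ n ζ) (mkC (h ζ))), U, hUo, hg0,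
      ?_, fun ζ hζ hne => ?_⟩, ?_⟩
  · exact finite_range_of_iSup_eq_span A hspan j
  · refine (J.holomorphicFamilyOn_volterraResolvent U).add (HolomorphicFamilyOn.add ?_ ?_)
    · refine HolomorphicFamilyOn.sum _ fun l _ => HolomorphicFamilyOn.rankOneOp
        (HolFamOn.of_continuous ?_) (hhol.taylorRem hUn (n - l))
      exact (J.m.hol_u.taylorRem univ_mem l).continuous (mem_univ lam₀)
    · exact HolomorphicFamilyOn.rankOneOp (hm.taylorRem hUn n) hhol
  · have hx : ζ - lam₀ ≠ 0 := sub_ne_zero.2 hne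
    have key := laurent_bilinear rankOneOp n hx (J.coeffM lam₀) (m := mkC (J.m.u ζ))
      (r := mkC fun t => taylorRem (fun z => J.m.u z t) lam₀ n ζ) (by
        ext t
        simp only [ContinuousMap.add_apply, ContinuousMap.coe_sum, ContinuousMap.coe_smul,
          Finset.sum_apply, Pi.smul_apply, smul_eq_mul, coeffM_apply]
        rw [coe_mkC (J.m.sol ζ).1.continuous, coe_mkC ((hm.taylorRem hUn n).continuous hζ)]
        exact eq_sum_taylorRem (fun z => J.m.u z t) lam₀ n ζ)
      α (fun N => mkC fun t => taylorRem (fun z => h z t) lam₀ N ζ) (h := mkC (h ζ)) (fun N => by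
        ext t
        simp only [ContinuousMap.add_apply, ContinuousMap.coe_sum, ContinuousMap.coe_smul,
          Finset.sum_apply, Pi.smul_apply, smul_eq_mul, hαa]
        rw [coe_mkC (hhol.continuous hζ), coe_mkC ((hhol.taylorRem hUn N).continuous hζ)]
        exact eq_sum_taylorRem (fun z => h z t) lam₀ N ζ)
    have e : mkC (h ζ) = (g ζ)⁻¹ • mkC (J.p.u ζ) := by
      ext t
      rw [ContinuousMap.smul_apply, coe_mkC (hhol.continuous hζ),
        coe_mkC (J.p.sol ζ).1.continuous, smul_eq_mul]
    have e' : (J.W ζ)⁻¹ • rankOneOp (mkC (J.m.u ζ)) (mkC (J.p.u ζ)) =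
        ((ζ - lam₀) ^ n)⁻¹ • rankOneOp (mkC (J.m.u ζ)) (mkC (h ζ)) := by
      rw [e, map_smul, smul_smul, hWg, mul_inv]
    rw [scatteringResolvent, e', key]
    exact add_left_comm _ _ _
  · have hli : LinearIndependent ℂ fun l : Fin n => toL2Loc (J.coeffM lam₀ l) :=
      (J.linearIndependent_coeffM hq lam₀ n).map_injOn toL2Loc toL2Loc_injective.injOn
    exact (finrank_iSup_range_of_linearIndependent hspan hli).trans (Fintype.card_fin n)

theorem isScatteringResolvent (hq : IsCompPotential q a b) :
    IsScatteringResolvent q J.scatteringResolvent := by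
  obtain ⟨C, hC, hCW⟩ := J.exists_bound_W_ne_zero hq
  have hW : ∃ ζ, J.W ζ ≠ 0 := ⟨((C + 1 : ℝ) : ℂ) * Complex.I, hCW _ (by simp)⟩
  refine ⟨fun lam₀ => ?_, C, fun lam hlam f => ?_⟩
  · obtain ⟨n, g, hg, hWg, hg0⟩ := J.exists_W_eq hW lam₀
    obtain ⟨A, hA, -⟩ := J.exists_hasLaurentExpansion hq hg hWg hg0
    exact ⟨n, A, hA⟩
  · exact J.isH2Solution_scatteringResolvent hq (hC.trans_lt hlam) (hCW lam hlam) f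

end SimpleCurve.Jost

/-! ### Uniqueness of the scattering resolvent -/

/-- Truncation to `[-M, M]`. -/
noncomputable def truncLoc (M : ℝ) : L2Loc →ₗ[ℂ] Lp ℂ 2 (volume : Measure ℝ) where
  toFun f := ((memLp_indicator_iff_restrict measurableSet_Icc).2 (f.2 M)).toLp
    ((Icc (-M) M).indicator (f : ℝ →ₘ[(volume : Measure ℝ)] ℂ))
  map_add' f g := by
    rw [← MemLp.toLp_add]
    refine MemLp.toLp_congr _ _ ?_
    filter_upwards [AEEqFun.coeFn_add (f : ℝ →ₘ[(volume : Measure ℝ)] ℂ) g] with t ht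
    rw [Pi.add_apply]
    by_cases hm : t ∈ Icc (-M) M
    · simp only [indicator_of_mem hm]
      exact ht
    · simp only [indicator_of_notMem hm, add_zero]
  map_smul' c f := by
    rw [RingHom.id_apply, ← MemLp.toLp_const_smul]
    refine MemLp.toLp_congr _ _ ?_
    filter_upwards [AEEqFun.coeFn_smul c (f : ℝ →ₘ[(volume : Measure ℝ)] ℂ)] with t ht
    rw [Pi.smul_apply]
    by_cases hm : t ∈ Icc (-M) M
    · simp only [indicator_of_mem hm]
      exact ht
    · simp only [indicator_of_notMem hm, smul_zero]

theorem truncLoc_ae (M : ℝ) (f : L2Loc) : truncLoc M f =ᵐ[volume]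
    (Icc (-M) M).indicator (f : ℝ →ₘ[(volume : Measure ℝ)] ℂ) :=
  ((memLp_indicator_iff_restrict measurableSet_Icc).2 (f.2 M)).coeFn_toLp

/-- The threshold `M₀` is there because truncated identities are available only for intervals that
contain the support of the argument. -/
theorem L2Loc.ext_truncLoc {f g : L2Loc} {M₀ : ℝ}
    (h : ∀ M, M₀ ≤ M → truncLoc M f = truncLoc M g) : f = g := by
  refine Subtype.ext (AEEqFun.ext ?_)
  have h1 : ∀ N : ℕ, ∀ᵐ t, (Icc (-(M₀ + N)) (M₀ + N)).indicator
      (f : ℝ →ₘ[(volume : Measure ℝ)] ℂ) t =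
      (Icc (-(M₀ + N)) (M₀ + N)).indicator (g : ℝ →ₘ[(volume : Measure ℝ)] ℂ) t := fun N => by
    have h2 := truncLoc_ae (M₀ + N) f
    rw [h (M₀ + N) (by linarith [N.cast_nonneg (α := ℝ)])] at h2
    exact h2.symm.trans (truncLoc_ae _ g)
  filter_upwards [ae_all_iff.2 h1] with t ht
  obtain ⟨N, hN⟩ := exists_nat_gt (|t| - M₀)
  have hm : t ∈ Icc (-(M₀ + N)) (M₀ + N) := abs_le.1 (by linarith)
  have := ht N
  rwa [indicator_of_mem hm, indicator_of_mem hm] at this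

/-- The difference of two solutions solves the homogeneous equation and is square integrable
together with its derivative, so `solution_eq_zero` applies. This fixes the resolvent high in the
upper half plane. -/
theorem IsH2Solution.ae_eq {q : ℝ → ℂ} {a b : ℝ} (J : realLine.Jost q a b)
    (hq : IsCompPotential q a b) {lam : ℂ} (him : 0 < lam.im) (hW : J.W lam ≠ 0)
    {u u' f : ℝ → ℂ} (h : IsH2Solution q lam u f) (h' : IsH2Solution q lam u' f) :
    u =ᵐ[volume] u' := by
  obtain ⟨v, w, hu, hv, -, huv, hvw, he⟩ := h
  obtain ⟨v', w', hu', hv', -, huv', hvw', he'⟩ := h'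
  obtain ⟨U, hU, hUp⟩ := huv.exists_hasPrim
  obtain ⟨V, hV, hVp⟩ := hvw.exists_hasPrim
  obtain ⟨U', hU', hUp'⟩ := huv'.exists_hasPrim
  obtain ⟨V', hV', hVp'⟩ := hvw'.exists_hasPrim
  have hlam : lam ≠ 0 := by
    rintro rfl
    simp at him
  have hκ : 0 < (lam * Complex.exp ((0 : ℝ) * Complex.I)).im := by simpa using him
  have hsol : realLine.IsSolution q lam (fun t => U t - U' t) (fun t => V t - V' t) := by
    refine ⟨(hUp.sub hUp').congr ?_, (hVp.sub hVp').congr ?_⟩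
    · filter_upwards [hV, hV'] with t h1 h2
      rw [realLine.deriv_γ, one_mul, h1, h2]
    · filter_upwards [hU, hU', he, he'] with t h1 h2 h3 h4
      rw [realLine.deriv_γ, ← h1, ← h2]
      linear_combination h4 - h3
  have h0 := J.solution_eq_zero hq realLine.hasStraightEnds hlam hκ hW hsol
    (SimpleCurve.Jost.memLp_arcLength
      (((memLp_congr_ae hU).1 hu).sub ((memLp_congr_ae hU').1 hu')))
    (SimpleCurve.Jost.memLp_arcLength
      (((memLp_congr_ae hV).1 hv).sub ((memLp_congr_ae hV').1 hv')))
  filter_upwards [hU, hU'] with t h1 h2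
  rw [h1, h2]
  exact sub_eq_zero.1 (congrFun h0.1 t)

/-- Fixing the argument and truncating the output turns the family into a function with values in
`L²`, to which one-variable function theory applies. -/
theorem meromorphicAt_truncLoc {R : ℂ → L2Comp →ₗ[ℂ] L2Loc} {lam₀ : ℂ} {J : ℕ}
    {A : Fin J → L2Comp →ₗ[ℂ] L2Loc} (hA : HasLaurentExpansion R lam₀ A) {M : ℝ} {f : L2Comp}
    (hf : VanishesOutside M (f : Lp ℂ 2 (volume : Measure ℝ))) :
    ∃ G : ℂ → Lp ℂ 2 (volume : Measure ℝ), AnalyticAt ℂ G lam₀ ∧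
      ∀ᶠ lam in 𝓝[≠] lam₀, truncLoc M (R lam f) =
        ∑ j : Fin J, ((lam - lam₀) ^ ((j : ℕ) + 1))⁻¹ • truncLoc M (A j f) + G lam := by
  obtain ⟨-, B, U, hU, hU₀, hB, hR⟩ := hA
  obtain ⟨T, hT, hT'⟩ := hB M
  refine ⟨fun lam => T lam f, ?_, ?_⟩
  · exact (hT.clm_apply (differentiableOn_const _)).analyticAt (hU.mem_nhds hU₀)
  · filter_upwards [self_mem_nhdsWithin, mem_nhdsWithin_of_mem_nhds (hU.mem_nhds hU₀)]
      with lam hne hl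
    rw [hR lam hl hne, LinearMap.add_apply, LinearMap.sum_apply, map_add, map_sum]
    congr 1
    · refine Finset.sum_congr rfl fun j _ => ?_
      rw [LinearMap.smul_apply, map_smul]
    · exact Lp.ext ((truncLoc_ae M _).trans (hT' lam hl f hf).symm)

theorem meromorphicAt_of_laurent {E : Type*} [NormedAddCommGroup E] [NormedSpace ℂ E] {F : ℂ → E}
    {lam₀ : ℂ} {J : ℕ} {d : Fin J → E} {G : ℂ → E} (hG : AnalyticAt ℂ G lam₀)
    (h : ∀ᶠ lam in 𝓝[≠] lam₀, F lam =
      ∑ j : Fin J, ((lam - lam₀) ^ ((j : ℕ) + 1))⁻¹ • d j + G lam) : MeromorphicAt F lam₀ := by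
  refine MeromorphicAt.congr (f := fun lam =>
    ∑ j : Fin J, ((lam - lam₀) ^ ((j : ℕ) + 1))⁻¹ • d j + G lam) ?_
    (h.mono fun lam hl => hl.symm)
  refine MeromorphicAt.add (MeromorphicAt.fun_sum fun j _ => ?_) hG.meromorphicAt
  have h1 : MeromorphicAt (fun lam : ℂ => (lam - lam₀) ^ ((j : ℕ) + 1)) lam₀ :=
    AnalyticAt.meromorphicAt (by fun_prop)
  exact h1.inv.smul (MeromorphicAt.const (d j) lam₀)

/-- The identity theorem for meromorphic families. -/
theorem IsMeromorphicFamily.eventually_truncLoc_eq {R R' : ℂ → L2Comp →ₗ[ℂ] L2Loc}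
    (hR : IsMeromorphicFamily R) (hR' : IsMeromorphicFamily R') {C : ℝ}
    (h : ∀ lam : ℂ, C < lam.im → R lam = R' lam) {M : ℝ} {f : L2Comp}
    (hf : VanishesOutside M (f : Lp ℂ 2 (volume : Measure ℝ))) (lam₀ : ℂ) :
    ∀ᶠ lam in 𝓝[≠] lam₀, truncLoc M (R lam f) = truncLoc M (R' lam f) := by
  set D : ℂ → Lp ℂ 2 (volume : Measure ℝ) :=
    fun lam => truncLoc M (R lam f) - truncLoc M (R' lam f) with hD
  have hmer : MeromorphicOn D univ := fun x _ => by
    obtain ⟨_, A, hA⟩ := hR x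
    obtain ⟨_, A', hA'⟩ := hR' x
    obtain ⟨G, hG, hGe⟩ := meromorphicAt_truncLoc hA hf
    obtain ⟨G', hG', hGe'⟩ := meromorphicAt_truncLoc hA' hf
    exact (meromorphicAt_of_laurent hG hGe).sub (meromorphicAt_of_laurent hG' hGe')
  set x₁ : ℂ := ((C + 1 : ℝ) : ℂ) * Complex.I with hx₁
  have h1 : meromorphicOrderAt D x₁ = ⊤ := by
    rw [meromorphicOrderAt_eq_top_iff]
    have hopen : IsOpen {lam : ℂ | C < lam.im} := isOpen_lt continuous_const Complex.continuous_im
    refine mem_nhdsWithin_of_mem_nhds (mem_of_superset (hopen.mem_nhds (by simp [hx₁])) ?_)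
    intro lam hl
    change truncLoc M (R lam f) - truncLoc M (R' lam f) = 0
    rw [h lam hl, sub_self]
  -- The difference has infinite order at a point of the half plane where the families agree, and
  -- infinite order propagates through the connected set `ℂ`.
  have h2 : meromorphicOrderAt D lam₀ = ⊤ := by
    by_contra hne
    exact hmer.meromorphicOrderAt_ne_top_of_isPreconnected isPreconnected_univ (mem_univ lam₀)
      (mem_univ x₁) hne h1
  filter_upwards [meromorphicOrderAt_eq_top_iff.1 h2] with lam hl
  exact sub_eq_zero.1 hl

/-- Multiplying by the highest power that occurs and letting `λ → λ₀` kills the top coefficient;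
then the order drops by one. -/
theorem polar_part_eq_zero {E : Type*} [NormedAddCommGroup E] [NormedSpace ℂ E] {lam₀ : ℂ}
    {G : ℂ → E} (hG : ContinuousAt G lam₀) (N : ℕ) (d : ℕ → E)
    (h : ∀ᶠ lam in 𝓝[≠] lam₀,
      ∑ j ∈ Finset.range N, ((lam - lam₀) ^ (j + 1))⁻¹ • d j = G lam) : ∀ j < N, d j = 0 := by
  induction N with
  | zero => simp
  | succ N ih =>
    have h0 : d N = 0 := by
      have h1 : ∀ᶠ lam in 𝓝[≠] lam₀, ∑ j ∈ Finset.range (N + 1), (lam - lam₀) ^ (N - j) • d j =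
          (lam - lam₀) ^ (N + 1) • G lam := by
        filter_upwards [h, self_mem_nhdsWithin] with lam hl hne
        have hx : lam - lam₀ ≠ 0 := sub_ne_zero.2 hne
        rw [← hl, Finset.smul_sum]
        refine Finset.sum_congr rfl fun j hj => ?_
        rw [Finset.mem_range] at hj
        rw [smul_smul]
        congr 1
        have e : N + 1 = (N - j) + (j + 1) := by omega
        rw [e, pow_add, mul_assoc, mul_inv_cancel₀ (pow_ne_zero _ hx), mul_one]
      have h2 : Tendsto (fun lam => ∑ j ∈ Finset.range (N + 1), (lam - lam₀) ^ (N - j) • d j)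
          (𝓝[≠] lam₀) (𝓝 (d N)) := by
        have hc : Continuous fun lam => ∑ j ∈ Finset.range (N + 1), (lam - lam₀) ^ (N - j) • d j := by
          fun_prop
        have h3 := (hc.tendsto lam₀).mono_left (nhdsWithin_le_nhds (s := {lam₀}ᶜ))
        convert h3 using 2
        rw [Finset.sum_range_succ, Finset.sum_eq_zero fun j hj => ?_]
        · simp
        · rw [Finset.mem_range] at hj
          rw [sub_self, zero_pow (by omega), zero_smul]
      have h4 : Tendsto (fun lam => (lam - lam₀) ^ (N + 1) • G lam) (𝓝[≠] lam₀) (𝓝 0) := by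
        have h5 : ContinuousAt (fun lam => (lam - lam₀) ^ (N + 1) • G lam) lam₀ :=
          ContinuousAt.smul (by fun_prop) hG
        have h6 := h5.tendsto.mono_left (nhdsWithin_le_nhds (s := {lam₀}ᶜ))
        simpa using h6
      exact tendsto_nhds_unique (h2.congr' h1) h4
    have h7 := ih (by
      filter_upwards [h] with lam hl
      rw [← hl, Finset.sum_range_succ, h0, smul_zero, add_zero])
    intro j hj
    rcases Nat.lt_succ_iff_lt_or_eq.1 hj with hj | rfl
    · exact h7 j hj
    · exact h0

/-- Extension of a finite family by zero. -/
def extendZero {X : Type*} [Zero X] {J : ℕ} (A : Fin J → X) (j : ℕ) : X :=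
  if h : j < J then A ⟨j, h⟩ else 0

theorem extendZero_of_lt {X : Type*} [Zero X] {J : ℕ} (A : Fin J → X) {j : ℕ} (h : j < J) :
    extendZero A j = A ⟨j, h⟩ := dif_pos h

theorem extendZero_of_le {X : Type*} [Zero X] {J : ℕ} (A : Fin J → X) {j : ℕ} (h : J ≤ j) :
    extendZero A j = 0 := dif_neg (not_lt.2 h)

theorem sum_extendZero {X E : Type*} [Zero X] [AddCommMonoid E] {J N : ℕ} (hN : J ≤ N)
    (A : Fin J → X) (φ : ℕ → X → E) (hφ : ∀ j, φ j 0 = 0) :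
    ∑ j : Fin J, φ j (A j) = ∑ j ∈ Finset.range N, φ j (extendZero A j) := by
  rw [← Finset.sum_subset (Finset.range_subset_range.2 hN) (fun j _ hj => ?_), Finset.sum_range]
  · exact Finset.sum_congr rfl fun j _ => by rw [extendZero_of_lt A j.2]
  · rw [extendZero_of_le A (by simpa using hj), hφ]

/-- The polar part of a meromorphic family is unique. -/
theorem HasLaurentExpansion.extendZero_eq {R R' : ℂ → L2Comp →ₗ[ℂ] L2Loc} {lam₀ : ℂ} {J J' : ℕ}
    {A : Fin J → L2Comp →ₗ[ℂ] L2Loc} {A' : Fin J' → L2Comp →ₗ[ℂ] L2Loc}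
    (hA : HasLaurentExpansion R lam₀ A) (hA' : HasLaurentExpansion R' lam₀ A')
    (h : ∀ (M : ℝ) (f : L2Comp), VanishesOutside M (f : Lp ℂ 2 (volume : Measure ℝ)) →
      ∀ᶠ lam in 𝓝[≠] lam₀, truncLoc M (R lam f) = truncLoc M (R' lam f)) :
    extendZero A = extendZero A' := by
  ext1 j
  ext1 f
  obtain ⟨M₀, hM₀⟩ := f.2
  refine L2Loc.ext_truncLoc (M₀ := M₀) fun M hM => ?_
  have hf : VanishesOutside M (f : Lp ℂ 2 (volume : Measure ℝ)) := hM₀.mono hM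
  obtain ⟨G, hG, hGe⟩ := meromorphicAt_truncLoc hA hf
  obtain ⟨G', hG', hGe'⟩ := meromorphicAt_truncLoc hA' hf
  set N := max (max J J') (j + 1) with hN
  have key := polar_part_eq_zero (hG'.continuousAt.sub hG.continuousAt) N
    (fun i => truncLoc M (extendZero A i f) - truncLoc M (extendZero A' i f)) (by
      filter_upwards [hGe, hGe', h M f hf] with lam h1 h2 h3
      have e1 := sum_extendZero (N := N) ((le_max_left J J').trans (le_max_left _ _)) A
        (fun i X => ((lam - lam₀) ^ (i + 1))⁻¹ • truncLoc M (X f)) (fun i => by simp)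
      have e2 := sum_extendZero (N := N) ((le_max_right J J').trans (le_max_left _ _)) A'
        (fun i X => ((lam - lam₀) ^ (i + 1))⁻¹ • truncLoc M (X f)) (fun i => by simp)
      simp only [smul_sub, Finset.sum_sub_distrib]
      rw [← e1, ← e2, Pi.sub_apply, sub_eq_sub_iff_add_eq_add, ← h1, h3, h2, add_comm])
  exact sub_eq_zero.1 (key j ((Nat.lt_succ_self j).trans_le (le_max_right _ _)))

/-- Padding with zero coefficients does not change the span, so expansions of different lengths can
be compared. -/
theorem polarMultiplicity_eq {J : ℕ} (A : Fin J → L2Comp →ₗ[ℂ] L2Loc) :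
    polarMultiplicity A =
      Module.finrank ℂ (⨆ j, LinearMap.range (extendZero A j) : Submodule ℂ L2Loc) := by
  rw [polarMultiplicity]
  have h : (⨆ j, LinearMap.range (A j)) = ⨆ j, LinearMap.range (extendZero A j) := by
    apply le_antisymm
    · refine iSup_le fun j => ?_
      rw [← extendZero_of_lt A j.2]
      exact le_iSup (fun i => LinearMap.range (extendZero A i)) (j : ℕ)
    · refine iSup_le fun j => ?_
      rcases lt_or_ge j J with hj | hj
      · rw [extendZero_of_lt A hj]
        exact le_iSup (fun i => LinearMap.range (A i)) ⟨j, hj⟩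
      · rw [extendZero_of_le A hj, LinearMap.range_zero]
        exact bot_le
  rw [h]

/-! ### Poles and multiplicities of the scattering resolvent from zeros of the Wronskian -/

namespace SimpleCurve.Jost

variable {q : ℝ → ℂ} {a b : ℝ} {lam₀ : ℂ} {n : ℕ} {g : ℂ → ℂ}

theorem eventually_truncLoc_eq (J : realLine.Jost q a b) (hq : IsCompPotential q a b)
    {R : ℂ → L2Comp →ₗ[ℂ] L2Loc} (hR : IsScatteringResolvent q R) (lam₀ : ℂ) (M : ℝ) (f : L2Comp)
    (hf : VanishesOutside M (f : Lp ℂ 2 (volume : Measure ℝ))) :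
    ∀ᶠ lam in 𝓝[≠] lam₀, truncLoc M (R lam f) = truncLoc M (J.scatteringResolvent lam f) := by
  obtain ⟨hR1, C, hR2⟩ := hR
  obtain ⟨hS1, C', hS2⟩ := J.isScatteringResolvent hq
  obtain ⟨D, hD, hDW⟩ := J.exists_bound_W_ne_zero hq
  refine hR1.eventually_truncLoc_eq hS1 (C := max (max C C') D) (fun lam hl => ?_) hf lam₀
  ext1 g
  refine Subtype.ext (AEEqFun.ext ?_)
  have h1 : D < lam.im := (le_max_right _ _).trans_lt hl
  have h2 := (le_max_left (max C C') D).trans_lt hl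
  exact IsH2Solution.ae_eq J hq (hD.trans_lt h1) (hDW lam h1)
    (hR2 lam ((le_max_left _ _).trans_lt h2) g) (hS2 lam ((le_max_right _ _).trans_lt h2) g)

theorem polarMultiplicity_eq (J : realLine.Jost q a b) (hq : IsCompPotential q a b)
    (hg : Differentiable ℂ g) (hWg : ∀ ζ, J.W ζ = (ζ - lam₀) ^ n * g ζ) (hg0 : g lam₀ ≠ 0)
    {R : ℂ → L2Comp →ₗ[ℂ] L2Loc} (hR : IsScatteringResolvent q R) {k : ℕ}
    {A : Fin k → L2Comp →ₗ[ℂ] L2Loc} (hA : HasLaurentExpansion R lam₀ A) :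
    polarMultiplicity A = n := by
  obtain ⟨A', hA', h'⟩ := J.exists_hasLaurentExpansion hq hg hWg hg0
  rw [← h', _root_.polarMultiplicity_eq, _root_.polarMultiplicity_eq,
    hA.extendZero_eq hA' (J.eventually_truncLoc_eq hq hR lam₀)]

/-- Uniqueness of the polar part makes the choice of expansion irrelevant. For `n = 0` the explicit
expansion has no polar terms; for `n ≠ 0` the multiplicity `n` forces a nonzero coefficient. -/
theorem isPole_iff (J : realLine.Jost q a b) (hq : IsCompPotential q a b)
    (hg : Differentiable ℂ g) (hWg : ∀ ζ, J.W ζ = (ζ - lam₀) ^ n * g ζ) (hg0 : g lam₀ ≠ 0)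
    {R : ℂ → L2Comp →ₗ[ℂ] L2Loc} (hR : IsScatteringResolvent q R) : IsPole R lam₀ ↔ J.W lam₀ = 0 := by
  have h1 : J.W lam₀ = 0 ↔ n ≠ 0 := by
    rw [hWg, sub_self]
    rcases Nat.eq_zero_or_pos n with rfl | hn
    · simpa using hg0
    · simp [hn.ne']
  rw [h1]
  constructor
  · rintro ⟨k, A, hA, j, hj⟩ rfl
    obtain ⟨A', hA', -⟩ := J.exists_hasLaurentExpansion hq hg hWg hg0
    have h2 := congrFun (hA.extendZero_eq hA' (J.eventually_truncLoc_eq hq hR lam₀)) j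
    rw [extendZero_of_lt A j.2, extendZero_of_le A' (Nat.zero_le _)] at h2
    exact hj h2
  · intro hn
    obtain ⟨k, A, hA⟩ := hR.1 lam₀
    refine ⟨k, A, hA, ?_⟩
    by_contra! h0
    refine hn ?_
    rw [← J.polarMultiplicity_eq hq hg hWg hg0 hR hA, polarMultiplicity]
    have h3 : (⨆ j, LinearMap.range (A j)) = ⊥ := by simp [h0]
    rw [h3, finrank_bot]

end SimpleCurve.Jost

/-! ### Complex scaling contours -/

theorem im_ofReal_mul_exp (r φ : ℝ) :
    ((r : ℂ) * Complex.exp (φ * Complex.I)).im = r * Real.sin φ := by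
  rw [Complex.im_ofReal_mul, Complex.exp_ofReal_mul_I_im]

/-- The argument of `λ e^{iθ}` is `arg λ + θ`, which lies in `(0, π)` by the definition of the
sector. -/
theorem im_mul_exp_pos_of_mem_scalingSector {θ : ℝ} {lam : ℂ} (h : lam ∈ scalingSector θ) :
    0 < (lam * Complex.exp (θ * Complex.I)).im := by
  obtain ⟨h1, h2, h3⟩ := h
  have hne : lam ≠ 0 := Complex.slitPlane_ne_zero h1
  have e : lam * Complex.exp (θ * Complex.I) =
      ‖lam‖ * Complex.exp ((lam.arg + θ : ℝ) * Complex.I) := by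
    conv_lhs => rw [← Complex.norm_mul_exp_arg_mul_I lam]
    rw [mul_assoc, ← Complex.exp_add]
    congr 2
    push_cast
    ring
  rw [e, im_ofReal_mul_exp]
  exact mul_pos (norm_pos_iff.2 hne) (Real.sin_pos_of_pos_of_lt_pi (by linarith) (by linarith))

namespace SimpleCurve

variable {Γ : SimpleCurve} {θ L a b : ℝ}

theorem hasDerivAt_re (Γ : SimpleCurve) (t : ℝ) :
    HasDerivAt (fun s => (Γ.γ s).re) (deriv Γ.γ t).re t :=
  Complex.reCLM.hasFDerivAt.comp_hasDerivAt t (Γ.hasDerivAt t)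

theorem hasDerivAt_im (Γ : SimpleCurve) (t : ℝ) :
    HasDerivAt (fun s => (Γ.γ s).im) (deriv Γ.γ t).im t :=
  Complex.imCLM.hasFDerivAt.comp_hasDerivAt t (Γ.hasDerivAt t)

/-- The parameter interval `[a, b]` corresponds to the segment `[-L, L]` of `Γ`. -/
structure IsSegmentParam (Γ : SimpleCurve) (L a b : ℝ) : Prop where
  lt : a < b
  left : (Γ.γ a).re = -L
  right : (Γ.γ b).re = L
  im_eq_zero : ∀ t ∈ Icc a b, (Γ.γ t).im = 0
  strictMono : StrictMonoOn (fun t => (Γ.γ t).re) (Icc a b)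
  mem : ∀ t, (Γ.γ t).im = 0 → (Γ.γ t).re ∈ Icc (-L) L → t ∈ Icc a b

namespace IsScalingContour

theorem tendsto_norm_atTop (h : Γ.IsScalingContour θ L) : Tendsto (fun t => ‖Γ.γ t‖) atTop atTop :=
  tendsto_atTop_mono (fun _ => (le_abs_self _).trans (Complex.abs_im_le_norm _)) h.im_atTop

theorem tendsto_norm_atBot (h : Γ.IsScalingContour θ L) : Tendsto (fun t => ‖Γ.γ t‖) atBot atTop :=
  tendsto_atTop_mono (fun _ => (neg_le_abs _).trans (Complex.abs_im_le_norm _))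
    (tendsto_neg_atBot_atTop.comp h.im_atBot)

/-- Since `|Im γ|` tends to infinity at both ends, `γ` is proper, and a proper continuous injection
is a closed embedding. This makes the inverse parametrization of the segment continuous. -/
theorem isClosedEmbedding (h : Γ.IsScalingContour θ L) : IsClosedEmbedding Γ.γ := by
  have hp : IsProperMap Γ.γ := by
    rw [isProperMap_iff_tendsto_cocompact]
    refine ⟨Γ.continuous_γ, ?_⟩
    rw [← Metric.cobounded_eq_cocompact (α := ℂ), ← tendsto_norm_atTop_iff_cobounded,
      cocompact_eq_atBot_atTop]
    exact h.tendsto_norm_atBot.sup h.tendsto_norm_atTop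
  exact IsClosedEmbedding.of_continuous_injective_isClosedMap Γ.continuous_γ Γ.injective
    hp.isClosedMap

/-- The inverse `ι` of `γ` on `[-L, L]` is continuous and injective, hence strictly monotone, and
the orientation assumption makes it increasing. Its image is therefore the whole parameter interval
between its end values. -/
theorem exists_isSegmentParam (h : Γ.IsScalingContour θ L) (hL : 0 < L) :
    ∃ a b, Γ.IsSegmentParam L a b := by
  have hLL : -L ≤ L := by linarith
  choose! ι hι using h.segment
  have hmem : ∀ t, (Γ.γ t).im = 0 → (Γ.γ t).re ∈ Icc (-L) L → t = ι (Γ.γ t).re :=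
    fun t ht ht' => Γ.injective (by
      rw [hι _ ht']
      exact Complex.ext rfl (by simpa using ht))
  have hab : ι (-L) < ι L := h.oriented _ _ (hι _ (left_mem_Icc.2 hLL)) (hι _ (right_mem_Icc.2 hLL))
  have hc : ContinuousOn ι (Icc (-L) L) := by
    rw [h.isClosedEmbedding.isInducing.continuousOn_iff]
    exact Complex.continuous_ofReal.continuousOn.congr hι
  have hinj : InjOn ι (Icc (-L) L) := fun x hx y hy hxy => by
    have := congrArg Γ.γ hxy
    rw [hι x hx, hι y hy] at this
    exact Complex.ofReal_injective this
  have hmono := hc.strictMonoOn_of_injOn_Icc hLL hab.le hinj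
  have hsurj : ∀ t ∈ Icc (ι (-L)) (ι L), ∃ x ∈ Icc (-L) L, ι x = t ∧ Γ.γ t = x := by
    intro t ht
    obtain ⟨x, hx, rfl⟩ := intermediate_value_Icc hLL hc ht
    exact ⟨x, hx, rfl, hι x hx⟩
  refine ⟨ι (-L), ι L, hab, ?_, ?_, fun t ht => ?_, fun s hs t ht hst => ?_, fun t ht ht' => ?_⟩
  · rw [hι _ (left_mem_Icc.2 hLL)]
    simp
  · rw [hι _ (right_mem_Icc.2 hLL)]
    simp
  · obtain ⟨x, -, -, hx⟩ := hsurj t ht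
    rw [hx]
    simp
  · obtain ⟨x, hx, rfl, hx'⟩ := hsurj s hs
    obtain ⟨y, hy, rfl, hy'⟩ := hsurj t ht
    simp only [hx', hy', Complex.ofReal_re]
    exact (hmono.lt_iff_lt hx hy).1 hst
  · rw [hmem t ht ht']
    exact ⟨hmono.monotoneOn (left_mem_Icc.2 hLL) ht' ht'.1,
      hmono.monotoneOn ht' (right_mem_Icc.2 hLL) ht'.2⟩

end IsScalingContour

/-- The tangent vector along a straight part of `Γ`. -/
theorem deriv_eq_of_straight (Γ : SimpleCurve) (hθ : 0 < Real.sin θ) {z : ℂ} {t₁ t₂ : ℝ}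
    (h : ∀ s ∈ Icc t₁ t₂, ∃ r : ℝ, Γ.γ s = z + r * Complex.exp (θ * Complex.I)) (hlt : t₁ < t₂)
    (him : (Γ.γ t₁).im < (Γ.γ t₂).im) {t : ℝ} (ht : t ∈ Ioo t₁ t₂) :
    deriv Γ.γ t = ‖deriv Γ.γ t‖ * Complex.exp (θ * Complex.I) := by
  have hexp : ∀ s ∈ Icc t₁ t₂, Γ.γ s =
      z + (((Γ.γ s).im - z.im) / Real.sin θ : ℝ) * Complex.exp (θ * Complex.I) := by
    intro s hs
    obtain ⟨r, hr⟩ := h s hs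
    have h1 : (Γ.γ s).im = z.im + r * Real.sin θ := by
      rw [hr, Complex.add_im, im_ofReal_mul_exp]
    have h2 : ((Γ.γ s).im - z.im) / Real.sin θ = r := by
      rw [h1]
      field_simp
      ring
    rw [h2, hr]
  -- As `sin θ ≠ 0`, a point of the straight line is determined by its imaginary part. Injectivity
  -- of `γ` then makes `Im γ` strictly monotone, and the end values show that it increases.
  have hinj : InjOn (fun s => (Γ.γ s).im) (Icc t₁ t₂) := fun s hs s' hs' he => by
    refine Γ.injective ?_
    rw [hexp s hs, hexp s' hs']
    simp only at he
    rw [he]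
  have hmono := ContinuousOn.strictMonoOn_of_injOn_Icc hlt.le him.le
    (Complex.continuous_im.comp Γ.continuous_γ).continuousOn hinj
  set y := (deriv Γ.γ t).im with hy
  have hy0 : 0 ≤ y := by
    have h1 := hmono.monotoneOn.derivWithin_nonneg (x := t)
    rw [derivWithin_of_mem_nhds (Icc_mem_nhds ht.1 ht.2)] at h1
    exact h1.trans_eq (Γ.hasDerivAt_im t).deriv
  have hd : HasDerivAt (fun s => z + (((Γ.γ s).im - z.im) / Real.sin θ : ℝ) *
      Complex.exp (θ * Complex.I)) ((y / Real.sin θ : ℝ) * Complex.exp (θ * Complex.I)) t :=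
    ((((Γ.hasDerivAt_im t).sub_const z.im).div_const (Real.sin θ)).ofReal_comp.mul_const _).const_add z
  have he : deriv Γ.γ t = (y / Real.sin θ : ℝ) * Complex.exp (θ * Complex.I) := by
    refine (hd.congr_of_eventuallyEq ?_).deriv
    filter_upwards [Icc_mem_nhds ht.1 ht.2] with s hs
    exact hexp s hs
  have hn : ‖deriv Γ.γ t‖ = y / Real.sin θ := by
    rw [he, norm_mul, Complex.norm_exp_ofReal_mul_I, mul_one, Complex.norm_real, Real.norm_eq_abs,
      abs_of_nonneg (div_nonneg hy0 hθ.le)]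
  rw [hn]
  exact he

/-- Near each end the curve has left `K` and is on one of the rays; the sign of `Im γ` decides which
one, since `sin θ > 0`. On that ray the tangent direction is `e^{iθ}`. -/
theorem IsScalingContour.hasStraightEnds (h : Γ.IsScalingContour θ L) (hθ : 0 < θ)
    (hθπ : θ < Real.pi) : Γ.HasStraightEnds θ := by
  have hsin : 0 < Real.sin θ := Real.sin_pos_of_pos_of_lt_pi hθ hθπ
  refine ⟨?_, h.tendsto_norm_atTop, h.tendsto_norm_atBot⟩
  obtain ⟨zp, zm, K, hK, hrays⟩ := h.rays
  obtain ⟨D, hD⟩ := hK.isBounded.exists_norm_le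
  have him : ∀ (z : ℂ) (r : ℝ), (z + r * Complex.exp (θ * Complex.I)).im = z.im + r * Real.sin θ :=
    fun z r => by rw [Complex.add_im, im_ofReal_mul_exp]
  have hray : ∀ t, D < ‖Γ.γ t‖ →
      (∃ s : ℝ, 0 < s ∧ Γ.γ t = zp + s * Complex.exp (θ * Complex.I)) ∨
        ∃ s : ℝ, 0 < s ∧ Γ.γ t = zm - s * Complex.exp (θ * Complex.I) := by
    intro t ht
    have hmem : Γ.γ t ∈ range Γ.γ \ K := ⟨mem_range_self t, fun hk => not_lt.2 (hD _ hk) ht⟩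
    rw [hrays] at hmem
    exact hmem.1
  obtain ⟨T₁, hT₁⟩ := eventually_atTop.1 ((h.tendsto_norm_atTop.eventually_gt_atTop D).and
    (h.im_atTop.eventually_gt_atTop zm.im))
  obtain ⟨T₂, hT₂⟩ := eventually_atBot.1 ((h.tendsto_norm_atBot.eventually_gt_atTop D).and
    (h.im_atBot.eventually_lt_atBot zp.im))
  -- Points of the lower ray have imaginary part below `Im zm`, which `T₁` was chosen to exclude.
  have hp : ∀ t, T₁ ≤ t → ∃ r : ℝ, Γ.γ t = zp + r * Complex.exp (θ * Complex.I) := by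
    intro t ht
    rcases hray t (hT₁ t ht).1 with ⟨s, -, hs⟩ | ⟨s, hs0, hs⟩
    · exact ⟨s, hs⟩
    · exfalso
      have h1 := (hT₁ t ht).2
      have h2 := him zm (-s)
      rw [Complex.ofReal_neg, neg_mul, ← sub_eq_add_neg, ← hs] at h2
      nlinarith
  have hm : ∀ t, t ≤ T₂ → ∃ r : ℝ, Γ.γ t = zm + r * Complex.exp (θ * Complex.I) := by
    intro t ht
    rcases hray t (hT₂ t ht).1 with ⟨s, hs0, hs⟩ | ⟨s, -, hs⟩
    · exfalso
      have h1 := (hT₂ t ht).2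
      have h2 := him zp s
      rw [← hs] at h2
      nlinarith
    · exact ⟨-s, by rw [hs]; push_cast; ring⟩
  -- The extra `1` puts `t` strictly inside a straight piece, as required for computing a two-sided
  -- derivative.
  refine ⟨max T₁ (-T₂) + 1, fun t ht => ?_⟩
  rcases le_abs.1 ht with ht | ht
  · have h1 : T₁ < t := by linarith [le_max_left T₁ (-T₂)]
    obtain ⟨t₂, h2, h3⟩ := ((eventually_gt_atTop t).and
      (h.im_atTop.eventually_gt_atTop (Γ.γ T₁).im)).exists
    exact Γ.deriv_eq_of_straight hsin (fun s hs => hp s hs.1) (h1.trans h2) h3 ⟨h1, h2⟩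
  · have h1 : t < T₂ := by linarith [le_max_right T₁ (-T₂)]
    obtain ⟨t₁, h2, h3⟩ := ((eventually_lt_atBot t).and
      (h.im_atBot.eventually_lt_atBot (Γ.γ T₂).im)).exists
    exact Γ.deriv_eq_of_straight hsin (fun s hs => hm s hs.2) (h2.trans h1) h3 ⟨h2, h1⟩

namespace IsSegmentParam

variable {V : ℝ → ℂ}

theorem γ_eq (h : Γ.IsSegmentParam L a b) {t : ℝ} (ht : t ∈ Icc a b) : Γ.γ t = (Γ.γ t).re :=
  Complex.ext rfl (by simpa using h.im_eq_zero t ht)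

theorem restrict_eq (h : Γ.IsSegmentParam L a b) {t : ℝ} (ht : t ∈ Icc a b) :
    Γ.restrict V t = V (Γ.γ t).re := by
  rw [restrict, if_pos (h.im_eq_zero t ht)]

theorem isCompPotential (h : Γ.IsSegmentParam L a b) (hV : MemLp V ∞ volume)
    (hV0 : IsCompPotential V (-L) L) : IsCompPotential (Γ.restrict V) a b := by
  have hm := Γ.memLp_restrict hV
  refine ⟨hm.1.mono_ac Γ.volume_absolutelyContinuous, ?_, fun t ht => ?_, h.lt.le⟩
  · refine ⟨(eLpNorm (Γ.restrict V) ∞ Γ.arcLength).toReal, Γ.ae_volume_of_ae ?_⟩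
    filter_upwards [ae_le_eLpNormEssSup (f := Γ.restrict V) (μ := Γ.arcLength)] with x hx
    rw [eLpNorm_exponent_top]
    have := ENNReal.toReal_mono (by simpa using hm.2.ne) hx
    simpa using this
  · rw [restrict]
    split_ifs with h0
    · exact hV0.zero _ fun h1 => ht (h.mem t h0 h1)
    · rfl

/-- On the segment `γ` is real and increasing, so this is the substitution `y = Re γ(s)`, with `γ'`
real in the interior. -/
theorem integral_comp (h : Γ.IsSegmentParam L a b) (F : ℝ → ℂ) {t : ℝ} (ht : t ∈ Icc a b) :
    ∫ s in a..t, deriv Γ.γ s * F (Γ.γ s).re = ∫ y in (-L)..(Γ.γ t).re, F y := by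
  have hab := h.lt
  have hmono := h.strictMono.mono (Icc_subset_Icc_right ht.2)
  have hle : -L ≤ (Γ.γ t).re := by
    rw [← h.left]
    exact h.strictMono.monotoneOn (left_mem_Icc.2 hab.le) ht ht.1
  have himg : (fun s => (Γ.γ s).re) '' Ioo a t = Ioo (-L) (Γ.γ t).re := by
    apply Subset.antisymm
    · rintro _ ⟨s, hs, rfl⟩
      refine ⟨?_, hmono ⟨hs.1.le, hs.2.le⟩ (right_mem_Icc.2 ht.1) hs.2⟩
      rw [← h.left]
      exact hmono (left_mem_Icc.2 ht.1) ⟨hs.1.le, hs.2.le⟩ hs.1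
    · rw [← h.left]
      exact intermediate_value_Ioo ht.1 (Complex.continuous_re.comp Γ.continuous_γ).continuousOn
  rw [intervalIntegral.integral_of_le ht.1, intervalIntegral.integral_of_le hle,
    integral_Ioc_eq_integral_Ioo, integral_Ioc_eq_integral_Ioo, ← himg,
    integral_image_eq_integral_deriv_smul_of_monotoneOn measurableSet_Ioo
      (fun s _ => (Γ.hasDerivAt_re s).hasDerivWithinAt)
      (hmono.monotoneOn.mono Ioo_subset_Icc_self)]
  refine setIntegral_congr_fun measurableSet_Ioo fun s hs => ?_
  have hi : (deriv Γ.γ s).im = 0 := by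
    rw [← (Γ.hasDerivAt_im s).deriv]
    have : (fun x => (Γ.γ x).im) =ᶠ[𝓝 s] fun _ => 0 := by
      filter_upwards [Icc_mem_nhds hs.1 (hs.2.trans_le ht.2)] with x hx
      exact h.im_eq_zero x hx
    rw [this.deriv_eq, deriv_const]
  have he : deriv Γ.γ s = (deriv Γ.γ s).re := Complex.ext rfl (by simpa using hi)
  rw [Complex.real_smul, ← he]

/-- On `[a, b]` both `m` along the curve and the pullback of `m` from the line solve the same
Volterra system, with the same data at `γ(a) = -L`; uniqueness gives equality up to the other
endpoint. -/
theorem jost_m_eq (h : Γ.IsSegmentParam L a b)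
    (hq : IsCompPotential (Γ.restrict V) a b) (J : Γ.Jost (Γ.restrict V) a b)
    (J' : realLine.Jost V (-L) L) (lam : ℂ) :
    J.m.u lam b = J'.m.u lam L ∧ J.m.v lam b = J'.m.v lam L := by
  have hab := h.lt.le
  obtain ⟨C, hC⟩ := isCompact_Icc.exists_bound_of_continuousOn
    (Γ.continuous_deriv.continuousOn (s := Icc a b))
  obtain ⟨Q, hQ⟩ := hq.bdd
  have hx : Continuous fun s => (Γ.γ s).re := Complex.continuous_re.comp Γ.continuous_γ
  have hs := J.m.sol lam
  have hs' := J'.m.sol lam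
  set w : ℝ → ℂ := fun t => deriv Γ.γ t with hw
  set z : ℝ → ℂ := fun t => deriv Γ.γ t * Γ.restrict V t - lam ^ 2 * deriv Γ.γ t with hz
  set u : ℝ → ℂ := fun t => J'.m.u lam (Γ.γ t).re with hu
  set v : ℝ → ℂ := fun t => J'.m.v lam (Γ.γ t).re with hv
  have huc : Continuous u := hs'.1.continuous.comp hx
  have hvc : Continuous v := hs'.2.continuous.comp hx
  have hzl : LocallyIntegrable z volume :=
    (hq.locallyIntegrable.continuous_smul Γ.continuous_deriv).sub
      (continuous_const.mul Γ.continuous_deriv).locallyIntegrable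
  have hγa : Γ.γ a = ((-L : ℝ) : ℂ) := by rw [h.γ_eq (left_mem_Icc.2 hab), h.left]
  have hua : J.m.u lam a = J'.m.u lam (-L) ∧ J.m.v lam a = J'.m.v lam (-L) := by
    rw [(J.m_a lam).1, (J.m_a lam).2, (J'.m_a lam).1, (J'.m_a lam).2, hγa]
    exact ⟨rfl, rfl⟩
  have iu : ∀ t ∈ Icc a b, J'.m.u lam (Γ.γ t).re - J'.m.u lam (-L) = ∫ s in a..t, w s * v s := by
    intro t ht
    rw [hs'.1.sub_eq, hw, hv, h.integral_comp (fun y => J'.m.v lam y) ht]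
    exact intervalIntegral.integral_congr fun y _ => by simp
  have iv : ∀ t ∈ Icc a b, J'.m.v lam (Γ.γ t).re - J'.m.v lam (-L) = ∫ s in a..t, z s * u s := by
    intro t ht
    have h1 : ∫ s in a..t, z s * u s = ∫ s in a..t, deriv Γ.γ s *
        (fun y => (V y - lam ^ 2) * J'.m.u lam y) (Γ.γ s).re := by
      refine intervalIntegral.integral_congr fun s hs => ?_
      rw [uIcc_of_le ht.1] at hs
      simp only [hz, hu]
      rw [h.restrict_eq ⟨hs.1, hs.2.trans ht.2⟩]
      ring
    rw [h1, h.integral_comp (fun y => (V y - lam ^ 2) * J'.m.u lam y) ht, hs'.2.sub_eq]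
    exact intervalIntegral.integral_congr fun y _ => by simp
  have key := volterra_unique (w := w) (z := z) (u := fun t => J.m.u lam t - u t)
    (v := fun t => J.m.v lam t - v t) (A := a) (B := b) (t₀ := a)
    (C := |C| + |C| * |Q| + ‖lam‖ ^ 2 * |C|) (by positivity)
    (ae_of_all _ fun s hs => by
      have h1 := (hC s hs).trans (le_abs_self C)
      have h2 : 0 ≤ |C| * |Q| := by positivity
      have h3 : 0 ≤ ‖lam‖ ^ 2 * |C| := by positivity
      linarith)
    (by
      filter_upwards [hQ] with s hs hmem
      have h1 := (hC s hmem).trans (le_abs_self C)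
      have h2 := hs.trans (le_abs_self Q)
      have h3 : ‖z s‖ ≤ ‖deriv Γ.γ s‖ * ‖Γ.restrict V s‖ + ‖lam‖ ^ 2 * ‖deriv Γ.γ s‖ := by
        refine (norm_sub_le _ _).trans (le_of_eq ?_)
        rw [norm_mul, norm_mul, norm_pow]
      have h4 := mul_le_mul h1 h2 (norm_nonneg _) (abs_nonneg _)
      have h5 := mul_le_mul_of_nonneg_left h1 (sq_nonneg ‖lam‖)
      linarith [abs_nonneg C])
    (left_mem_Icc.2 hab) (hs.1.continuous.sub huc).continuousOn
    (hs.2.continuous.sub hvc).continuousOn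
    (fun t ht => by
      have h1 := hs.1.sub_eq a t
      have h2 : IntervalIntegrable (fun s => w s * v s) volume a t :=
        (Γ.continuous_deriv.mul hvc).intervalIntegrable _ _
      simp only [mul_sub]
      rw [intervalIntegral.integral_sub (hs.1.1.intervalIntegrable' a t) h2, ← h1, ← iu t ht, hua.1]
      ring)
    (fun t ht => by
      have h1 := hs.2.sub_eq a t
      have h2 : IntervalIntegrable (fun s => z s * u s) volume a t :=
        (hzl.intervalIntegrable' a t).mul_continuousOn huc.continuousOn
      simp only [mul_sub]
      rw [intervalIntegral.integral_sub (hs.2.1.intervalIntegrable' a t) h2, ← h1, ← iv t ht, hua.2]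
      ring)
    b (right_mem_Icc.2 hab)
  simp only [hu, hv, h.right] at key
  exact ⟨sub_eq_zero.1 key.1, sub_eq_zero.1 key.2⟩

/-- The Jost functions on `Γ` and on the real line have the same Wronskian. -/
theorem jost_W_eq (h : Γ.IsSegmentParam L a b)
    (hq : IsCompPotential (Γ.restrict V) a b) (J : Γ.Jost (Γ.restrict V) a b)
    (J' : realLine.Jost V (-L) L) (lam : ℂ) : J.W lam = J'.W lam := by
  obtain ⟨h1, h2⟩ := h.jost_m_eq hq J J' lam
  have hγb : Γ.γ b = (L : ℂ) := by rw [h.γ_eq (right_mem_Icc.2 h.lt.le), h.right]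
  rw [← J.W_eq lam b, ← J'.W_eq lam L, h1, h2, (J.p_b lam).1, (J.p_b lam).2, (J'.p_b lam).1,
    (J'.p_b lam).2, hγb]
  rfl

end IsSegmentParam

end SimpleCurve

/-! ### The theorem on complex scaling -/

theorem mainTheorem5 (Γ : SimpleCurve) (θ L : ℝ) (hθ : 0 < θ) (hθπ : θ < Real.pi) (hL : 0 < L)
    (hΓ : Γ.IsScalingContour θ L)
    (V : ℝ → ℂ) (hV : MemLp V ∞ volume) (hsupp : tsupport V ⊆ Ioo (-L) L) :
    -- Fredholm property
    (∀ lam ∈ scalingSector θ, (Γ.P hV - lam ^ 2 • Γ.incl).IsFredholm) ∧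
    -- the spectrum is discrete in the sector and consists of eigenvalues
    (∀ lam₀ ∈ scalingSector θ, ∀ᶠ lam in 𝓝[≠] lam₀, ¬ Γ.IsSpectral hV lam) ∧
    (∀ lam ∈ scalingSector θ, Γ.IsSpectral hV lam ↔ Γ.IsEigen hV lam) ∧
    -- the scattering resolvent exists; eigenvalues are resonances, with the trace formula
    (∃ R, IsScatteringResolvent V R) ∧
    ∀ R, IsScatteringResolvent V R →
      (∀ lam ∈ scalingSector θ, Γ.IsEigen hV lam ↔ IsPole R lam) ∧
      (∀ lam ∈ scalingSector θ, ∀ (J : ℕ) (A : Fin J → L2Comp →ₗ[ℂ] L2Loc),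
        HasLaurentExpansion R lam A →
        ∃ ε₀ > 0, ∀ ε ∈ Ioo 0 ε₀,
          (∀ ζ ∈ Metric.sphere lam ε, ¬ Γ.IsSpectral hV ζ) ∧
          CircleIntegrable (fun ζ => (2 * ζ) • Γ.resolvent hV ζ) lam ε ∧
          HasFiniteRankTrace (Γ.riesz hV lam ε) (polarMultiplicity A)) := by
  have hE := hΓ.hasStraightEnds hθ hθπ
  obtain ⟨a, b, hab⟩ := hΓ.exists_isSegmentParam hL
  have hV0 := isCompPotential_of_tsupport hV hL hsupp
  have hq := hab.isCompPotential hV hV0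
  obtain ⟨J⟩ := Γ.exists_jost hq
  obtain ⟨J'⟩ := realLine.exists_jost hV0
  have hWW := hab.jost_W_eq hq J J'
  -- That the Wronskian is not identically zero is known on the line, high in the upper half plane,
  -- and is transferred to the curve by equality of the two Wronskians.
  have hW : ∃ ζ, J.W ζ ≠ 0 := by
    obtain ⟨C, hC, hCW⟩ := J'.exists_bound_W_ne_zero hV0
    exact ⟨((C + 1 : ℝ) : ℂ) * Complex.I, by rw [hWW]; exact hCW _ (by simp)⟩
  have hκ : ∀ lam ∈ scalingSector θ, 0 < (lam * Complex.exp (θ * Complex.I)).im :=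
    fun lam hl => im_mul_exp_pos_of_mem_scalingSector hl
  have zeroData : ∀ lam ∈ scalingSector θ, ∃ (n : ℕ) (g : ℂ → ℂ) (ε : ℝ), Differentiable ℂ g ∧
      (∀ ζ, J.W ζ = (ζ - lam) ^ n * g ζ) ∧ g lam ≠ 0 ∧ J.IsZeroData θ lam n g ε := by
    intro lam hl
    obtain ⟨n, g, hg, hWg, hg0⟩ := J.exists_W_eq hW lam
    obtain ⟨ε, hε⟩ := SimpleCurve.Jost.exists_isZeroData hg hWg hg0 (hκ lam hl)
    exact ⟨n, g, ε, hg, hWg, hg0, hε⟩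
  refine ⟨fun lam hl => ?_, fun lam hl => ?_, fun lam hl => ?_,
    ⟨_, J'.isScatteringResolvent hV0⟩, fun R hR => ⟨fun lam hl => ?_, fun lam hl k A hA => ?_⟩⟩
  · obtain ⟨n, g, ε, -, -, -, hε⟩ := zeroData lam hl
    have := hε.completeSpace hV hq hE
    exact hε.isFredholm hV hq hE
  · obtain ⟨n, g, ε, -, -, -, hε⟩ := zeroData lam hl
    filter_upwards [self_mem_nhdsWithin,
      mem_nhdsWithin_of_mem_nhds (Metric.closedBall_mem_nhds lam hε.pos)] with ζ hne hζ
    rw [J.isSpectral_iff hV hq hE (hε.sector ζ hζ)]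
    exact hε.W_ne_zero hζ hne
  · rw [J.isSpectral_iff hV hq hE (hκ lam hl), J.isEigen_iff hV hq hE (hκ lam hl)]
  · obtain ⟨n, g, ε, hg, hWg, hg0, hε⟩ := zeroData lam hl
    rw [J.isEigen_iff hV hq hE (hκ lam hl), hWW,
      J'.isPole_iff hV0 hg (fun ζ => (hWW ζ).symm.trans (hWg ζ)) hg0 hR]
  · obtain ⟨n, g, ε₀, hg, hWg, hg0, hε₀⟩ := zeroData lam hl
    refine ⟨ε₀, hε₀.pos, fun ε hε => ?_⟩
    have h := hε₀.mono hε.1 hε.2.le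
    have := h.completeSpace hV hq hE
    refine ⟨fun ζ hζ => ?_, h.circleIntegrable_resolvent hV hq hE, ?_⟩
    · rw [J.isSpectral_iff hV hq hE (h.sector ζ (Metric.sphere_subset_closedBall hζ))]
      exact h.W_ne_zero (Metric.sphere_subset_closedBall hζ) (h.sphere_ne hζ)
    · rw [J'.polarMultiplicity_eq hV0 hg (fun ζ => (hWW ζ).symm.trans (hWg ζ)) hg0 hR hA]
      exact h.hasFiniteRankTrace_riesz hV hq hE
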